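/- A mixed graph $G=(V,D,B)$ has a finite node set $V=\{1,\dots,m\}$, directed edges $v\to w$ ($(v,w)\in D$) and bidirected edges $v\leftrightarrow w$ ($(v,w)\in B$, $B$ symmetric), without self-loops. Write $\mathrm{pa}(v)=\{w: w\to v\in D\}$ and $\mathrm{sib}(v)=\{w: w\leftrightarrow v\in B\}$. A half-trek from $y$ to $x_n$ is a path $x_0\to x_1\to\cdots\to x_n$ ($n\ge 0$) with $x_0=y$, or a path $y\leftrightarrow x_0\to x_1\to\cdots\to x_n$; its left side is $\{y\}$ and its right side is $\{x_0,\dots,x_n\}$ (nodes may repeat). Let $\mathrm{htr}(v)$ be the set of nodes outside $\{v\}\cup\mathrm{sib}(v)$ that are the target of a half-trek from $v$. A set $Y\subseteq V$ satisfies the half-trek criterion with respect to $v$ if $|Y|=|\mathrm{pa}(v)|$, $Y\cap(\{v\}\cup\mathrm{sib}(v))=\varnothing$, and there is a set of half-treks with pairwise distinct sources forming $Y$, pairwise distinct targets forming $\mathrm{pa}(v)$, pairwise disjoint left sides and pairwise disjoint right sides. $G$ is HTC-identifiable if there are sets $Y_v$ $(v\in V)$, each satisfying the half-trek criterion with respect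 to $v$, and a strict total order $\prec$ on $V$ with $w\prec v$ whenever $w\in Y_v\cap\mathrm{htr}(v)$. For $v\in V$ and $A\subseteq V\setminus(\{v\}\cup\mathrm{sib}(v))$ let $G_{\mathrm{flow}}(v,A)$ be the flow network with nodes $s$, $t$, $L(a)$ $(a\in A)$ and $R(w)$ $(w\in V)$, and edges $s\to L(a)$ and $L(a)\to R(a)$ for $a\in A$, $L(a)\to R(w)$ for $a\in A$, $a\leftrightarrow w\in B$, $R(w)\to R(u)$ for $w\to u\in D$, and $R(w)\to t$ for $w\in\mathrm{pa}(v)$; the edges and $s$, $t$ have capacity $\infty$, all other nodes have capacity $1$. Consider the following algorithm with input $G$. Set $S\leftarrow\{v:\mathrm{pa}(v)=\varnothing\}$. Repeat: for $v=1,\dots,m$, if $v\notin S$, let $A=(S\cup(V\setminus\mathrm{htr}(v)))\setminus(\{v\}\cup\mathrm{sib}(v))$, and if the maximum flow size of $G_{\mathrm{flow}}(v,A)$ from $s$ to $t$ equals $|\mathrm{pa}(v)|$, set $S\leftarrow S\cup\{v\}$; until $S=V$ or no change has occurred in the last iteration. Return "yes" if $S=V$, and "no" otherwise. **Theorem.**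 The algorithm always halts, and it returns "yes" if and only if $G$ is HTC-identifiable. Furthermore, with a maximum flow subroutine that takes $\mathcal{O}((n+q)^3)$ steps on the networks $G_{\mathrm{flow}}(v,A)$, where $n$ is the number of nodes and $q$ the number of reciprocal edge pairs of the network (such a subroutine exists), the algorithm takes at most $\mathcal{O}(|V|^2(|V|+r)^3)$ elementary steps on a unit-cost random access machine, where $r\le|D|/2$ is the number of reciprocal edge pairs $\{v\to w,\ w\to v\}$, $v\ne w$, in $D$. -/

import Mathlib

open scoped NNReal ENNReal

/-! ## Mixed graphs and the half-trek criterion -/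

/-- A mixed graph on the node set `V`: directed edges `dir v w` (`v → w`) and bidirected edges
`bi v w` (`v ↔ w`), without self-loops. -/
structure MixedGraph (V : Type*) where
  dir : V → V → Prop
  bi : V → V → Prop
  dir_irrefl : ∀ v, ¬ dir v v
  bi_irrefl : ∀ v, ¬ bi v v
  bi_symm : ∀ v w, bi v w → bi w v

/-- The number of reciprocal edge pairs `v → w`, `w → v` (`v ≠ w`) of a directed graph. -/
noncomputable def reciprocalPairs {V : Type*} (E : V → V → Prop) : ℕ :=
  Set.ncard {e : Sym2 V | ∃ v w, e = s(v, w) ∧ v ≠ w ∧ E v w ∧ E w v}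

namespace MixedGraph

variable {V : Type*} (G : MixedGraph V)

/-- The parents of `v`. -/
def pa (v : V) : Set V := {w | G.dir w v}

/-- The siblings of `v`. -/
def sib (v : V) : Set V := {w | G.bi w v}

/-- A half-trek: a trek whose left-hand side is the single node `source`. Its right-hand side is
the directed path `head → ⋯` (nodes may repeat), which either starts at `source` itself (then
`source` is the top node, and belongs to both sides) or is joined to `source` by a bidirected
edge. -/
structure HalfTrek where
  source : V
  head : V
  tail : List V
  start : head = source ∨ G.bi source head
  path : List.IsChain G.dir (head :: tail)

namespace HalfTrek

variable {G}

/-- The last node of a half-trek. -/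
def target (π : G.HalfTrek) : V := (π.head :: π.tail).getLast (List.cons_ne_nil _ _)

/-- The left-hand side. -/
def left (π : G.HalfTrek) : Set V := {π.source}

/-- The right-hand side. -/
def right (π : G.HalfTrek) : Set V := {w | w ∈ π.head :: π.tail}

end HalfTrek

/-- `htr(v)`: the nodes other than `v` and its siblings that are reachable from `v` by a
half-trek. -/
def htr (v : V) : Set V :=
  {w | w ∉ insert v (G.sib v) ∧ ∃ π : G.HalfTrek, π.source = v ∧ π.target = w}

/-- `S` is a system of half-treks from `X` to `Y`: distinct sources, forming `X`, and distinct
targets, forming `Y`. -/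
def IsHalfTrekSystem (S : Set G.HalfTrek) (X Y : Set V) : Prop :=
  Set.BijOn HalfTrek.source S X ∧ Set.BijOn HalfTrek.target S Y

/-- A set of half-treks without sided intersection. -/
def NoSidedIntersection (S : Set G.HalfTrek) : Prop :=
  ∀ π ∈ S, ∀ ρ ∈ S, π ≠ ρ → π.left ∩ ρ.left = ∅ ∧ π.right ∩ ρ.right = ∅

/-- The half-trek criterion for `Y` with respect to `v`. -/
def HalfTrekCriterion (Y : Set V) (v : V) : Prop :=
  Y.ncard = (G.pa v).ncard ∧
  Y ∩ insert v (G.sib v) = ∅ ∧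
  ∃ S : Set G.HalfTrek, G.IsHalfTrekSystem S Y (G.pa v) ∧ G.NoSidedIntersection S

/-- HTC-identifiability. -/
def HTCIdentifiable : Prop :=
  ∃ Y : V → Set V, (∀ v, G.HalfTrekCriterion (Y v) v) ∧
    ∃ prec : V → V → Prop, IsStrictTotalOrder V prec ∧
      ∀ v w, w ∈ Y v ∩ G.htr v → prec w v

end MixedGraph

/-! ## Maximum flow -/

/-- A directed graph with a source, a sink, node capacities and edge capacities. -/
structure FlowNetwork (ν : Type*) where
  edge : ν → ν → Prop
  source : ν
  sink : ν
  nodeCap : ν → ℝ≥0∞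
  edgeCap : ν → ν → ℝ≥0∞

namespace FlowNetwork

variable {ν : Type*} [Fintype ν] (N : FlowNetwork ν)

/-- A flow; it is extended by `0` to pairs that are not edges. -/
def IsFlow (f : ν → ν → ℝ≥0) : Prop :=
  (∀ u v, ¬ N.edge u v → f u v = 0) ∧
  (∀ v, v ≠ N.source → v ≠ N.sink →
    ∑ u, f u v = ∑ w, f v w ∧ ((∑ w, f v w : ℝ≥0) : ℝ≥0∞) ≤ N.nodeCap v) ∧
  (∀ u v, N.edge u v → (f u v : ℝ≥0∞) ≤ N.edgeCap u v)

/-- The size of a flow. -/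
def flowSize (f : ν → ν → ℝ≥0) : ℝ≥0 := ∑ w, f N.source w

/-- `k` is the maximal size of a flow. -/
def IsMaxFlow (k : ℝ≥0) : Prop := IsGreatest {x | ∃ f, N.IsFlow f ∧ N.flowSize f = x} k

end FlowNetwork

/-- The nodes of the network `G_flow(v, A)`: source, sink, a left-hand copy `L(a)` of every
`a ∈ A`, and a right-hand copy `R(w)` of every node `w`. -/
inductive FlowNode {V : Type*} (A : Set V) : Type _
  | source : FlowNode A
  | sink : FlowNode A
  | left (a : A) : FlowNode A
  | right (w : V) : FlowNode A

/-- `FlowNode A` is the disjoint union of two points, `A` and `V`. -/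
def FlowNode.equivSum {V : Type*} (A : Set V) : Bool ⊕ (A ⊕ V) ≃ FlowNode A where
  toFun
    | .inl true => .source
    | .inl false => .sink
    | .inr (.inl a) => .left a
    | .inr (.inr w) => .right w
  invFun
    | .source => .inl true
    | .sink => .inl false
    | .left a => .inr (.inl a)
    | .right w => .inr (.inr w)
  left_inv := by rintro ((_ | _) | (_ | _)) <;> rfl
  right_inv := by rintro (_ | _ | _ | _) <;> rfl

noncomputable instance {V : Type*} [Finite V] (A : Set V) : Fintype (FlowNode A) :=
  haveI : Finite (FlowNode A) := Finite.of_equiv _ (FlowNode.equivSum A)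
  Fintype.ofFinite _

namespace MixedGraph

variable {V : Type*} (G : MixedGraph V)

/-- The edges of `G_flow(v, A)`. -/
inductive FlowEdge (v : V) (A : Set V) : FlowNode A → FlowNode A → Prop
  | source_left (a : A) : FlowEdge v A .source (.left a)
  | left_right (a : A) : FlowEdge v A (.left a) (.right a)
  | left_sibling (a : A) (w : V) : G.bi a w → FlowEdge v A (.left a) (.right w)
  | right_right (w u : V) : G.dir w u → FlowEdge v A (.right w) (.right u)
  | right_sink (w : V) : w ∈ G.pa v → FlowEdge v A (.right w) .sink

/-- The network `G_flow(v, A)`: edges, source and sink have capacity `∞`, all other nodes have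
capacity `1`. -/
def flowNetwork (v : V) (A : Set V) : FlowNetwork (FlowNode A) where
  edge := G.FlowEdge v A
  source := .source
  sink := .sink
  nodeCap
    | .source => ⊤
    | .sink => ⊤
    | .left _ => 1
    | .right _ => 1
  edgeCap _ _ := ⊤

end MixedGraph

/-! ## A random access machine with unit costs

A memory consists of registers and two-dimensional arrays (both named by natural numbers) that
hold natural numbers. Every elementary operation (reading a constant or a register, an array
access, an addition, a truncated subtraction, a comparison, an assignment, a branching) costs one
step. There is no multiplication. -/

namespace RAM

/-- A memory state. -/
structure Memory where
  reg : ℕ → ℕ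
  arr : ℕ → ℕ → ℕ → ℕ

/-- Expressions; comparisons have the value `1` (true) or `0` (false). -/
inductive Expr : Type
  | lit (n : ℕ) : Expr
  | reg (x : ℕ) : Expr
  | get (a : ℕ) (i j : Expr) : Expr
  | add (e e' : Expr) : Expr
  | sub (e e' : Expr) : Expr
  | eq (e e' : Expr) : Expr
  | lt (e e' : Expr) : Expr

/-- The value of an expression. -/
def Expr.eval (σ : Memory) : Expr → ℕ
  | lit n => n
  | reg x => σ.reg x
  | get a i j => σ.arr a (i.eval σ) (j.eval σ)
  | add e e' => e.eval σ + e'.eval σ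
  | sub e e' => e.eval σ - e'.eval σ
  | eq e e' => if e.eval σ = e'.eval σ then 1 else 0
  | lt e e' => if e.eval σ < e'.eval σ then 1 else 0

/-- The number of steps that the evaluation of an expression takes. -/
def Expr.cost : Expr → ℕ
  | lit _ => 1
  | reg _ => 1
  | get _ i j => 1 + i.cost + j.cost
  | add e e' => 1 + e.cost + e'.cost
  | sub e e' => 1 + e.cost + e'.cost
  | eq e e' => 1 + e.cost + e'.cost
  | lt e e' => 1 + e.cost + e'.cost

/-- Programs. A condition holds if its value is not `0`. -/
inductive Cmd : Type
  | skip : Cmd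
  | assign (x : ℕ) (e : Expr) : Cmd
  | put (a : ℕ) (i j e : Expr) : Cmd
  | seq (c c' : Cmd) : Cmd
  | cond (b : Expr) (c c' : Cmd) : Cmd
  | loop (b : Expr) (c : Cmd) : Cmd

/-- `Exec c σ t τ`: the program `c`, started in the memory `σ`, halts after exactly `t` steps with
the memory `τ`. -/
inductive Exec : Cmd → Memory → ℕ → Memory → Prop
  | skip (σ : Memory) : Exec .skip σ 1 σ
  | assign (x : ℕ) (e : Expr) (σ : Memory) :
      Exec (.assign x e) σ (1 + e.cost) ⟨Function.update σ.reg x (e.eval σ), σ.arr⟩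
  | put (a : ℕ) (i j e : Expr) (σ : Memory) :
      Exec (.put a i j e) σ (1 + i.cost + j.cost + e.cost)
        ⟨σ.reg, fun b k l =>
          if b = a ∧ k = i.eval σ ∧ l = j.eval σ then e.eval σ else σ.arr b k l⟩
  | seq {c c' : Cmd} {σ τ ρ : Memory} {t t' : ℕ} :
      Exec c σ t τ → Exec c' τ t' ρ → Exec (.seq c c') σ (t + t') ρ
  | cond_true {b : Expr} {c c' : Cmd} {σ τ : Memory} {t : ℕ} :
      b.eval σ ≠ 0 → Exec c σ t τ → Exec (.cond b c c') σ (1 + b.cost + t) τ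
  | cond_false {b : Expr} {c c' : Cmd} {σ τ : Memory} {t : ℕ} :
      b.eval σ = 0 → Exec c' σ t τ → Exec (.cond b c c') σ (1 + b.cost + t) τ
  | loop_false {b : Expr} {c : Cmd} {σ : Memory} :
      b.eval σ = 0 → Exec (.loop b c) σ (1 + b.cost) σ
  | loop_true {b : Expr} {c : Cmd} {σ τ ρ : Memory} {t t' : ℕ} :
      b.eval σ ≠ 0 → Exec c σ t τ → Exec (.loop b c) τ t' ρ →
        Exec (.loop b c) σ (1 + b.cost + t + t') ρ

/-- Execution is deterministic, so the running time and the result of a program are well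
defined. -/
theorem Exec.deterministic {c : Cmd} {σ τ : Memory} {t : ℕ} (h : Exec c σ t τ) :
    ∀ {t' : ℕ} {τ' : Memory}, Exec c σ t' τ' → t' = t ∧ τ' = τ := by
  induction h with
  | skip | assign | put => intro t' τ' h'; cases h'; exact ⟨rfl, rfl⟩
  | seq _ _ ih₁ ih₂ =>
    intro t' τ' h'
    cases h' with
    | seq k₁ k₂ =>
      obtain ⟨rfl, rfl⟩ := ih₁ k₁
      obtain ⟨rfl, rfl⟩ := ih₂ k₂
      exact ⟨rfl, rfl⟩
  | cond_true hb _ ih =>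
    intro t' τ' h'
    cases h' with
    | cond_true _ k => obtain ⟨rfl, rfl⟩ := ih k; exact ⟨rfl, rfl⟩
    | cond_false hb' _ => exact absurd hb' hb
  | cond_false hb _ ih =>
    intro t' τ' h'
    cases h' with
    | cond_true hb' _ => exact absurd hb hb'
    | cond_false _ k => obtain ⟨rfl, rfl⟩ := ih k; exact ⟨rfl, rfl⟩
  | loop_false hb =>
    intro t' τ' h'
    cases h' with
    | loop_false _ => exact ⟨rfl, rfl⟩
    | loop_true hb' _ _ => exact absurd hb hb'
  | loop_true hb _ _ ih₁ ih₂ =>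
    intro t' τ' h'
    cases h' with
    | loop_false hb' => exact absurd hb' hb
    | loop_true _ k₁ k₂ =>
      obtain ⟨rfl, rfl⟩ := ih₁ k₁
      obtain ⟨rfl, rfl⟩ := ih₂ k₂
      exact ⟨rfl, rfl⟩

/-- Sequential composition of a list of programs. -/
def Cmd.block : List Cmd → Cmd
  | [] => .skip
  | c :: l => .seq c (block l)

/-- `if b then c`. -/
def Cmd.when (b : Expr) (c : Cmd) : Cmd := .cond b c .skip

/-- `for x = 0, …, n - 1 do c`, where `n` is the content of the register `bound`. -/
def Cmd.forBelow (x bound : ℕ) (c : Cmd) : Cmd :=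
  .block [.assign x (.lit 0),
    .loop (.lt (.reg x) (.reg bound)) (.block [c, .assign x (.add (.reg x) (.lit 1))])]

/-- `repeat c until b`. -/
def Cmd.repeatUntil (c : Cmd) (b : Expr) : Cmd := .seq c (.loop (.eq b (.lit 0)) c)

end RAM

/-! ## The algorithm -/

namespace HTCAlgorithm

open RAM RAM.Cmd

/-! Names of registers. The graph has the nodes `0, …, m - 1`. -/

/-- The number of nodes of the graph (input). -/
abbrev rM : ℕ := 0
/-- The output: `1` for "yes", `0` for "no". -/
abbrev rAnswer : ℕ := 1
/-- The node under consideration. -/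
abbrev rV : ℕ := 2
/-- Whether a change has occurred in the current iteration. -/
abbrev rChanged : ℕ := 3
/-- The value returned by the maximum flow procedure. -/
abbrev rFlow : ℕ := 4
/-- The number of rows and columns of the adjacency matrix of the flow network. -/
abbrev rSize : ℕ := 5
/-- The row of the source of the flow network. -/
abbrev rSource : ℕ := 6
/-- The row of the sink of the flow network. -/
abbrev rSink : ℕ := 7
/-- The number of parents of the node under consideration. -/
abbrev rParents : ℕ := 8
/-- Counters. -/
abbrev rI : ℕ := 9
/-- Counters. -/
abbrev rJ : ℕ := 10
/-- Counters. -/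
abbrev rK : ℕ := 11

/-! Names of arrays. A set of nodes is stored as the row `0` of an array, with entries `0`, `1`. -/

/-- The adjacency matrix of the directed part (input). -/
abbrev aDir : ℕ := 0
/-- The adjacency matrix of the bidirected part (input). -/
abbrev aBi : ℕ := 1
/-- `SolvedNodes`. -/
abbrev aSolved : ℕ := 2
/-- `htr(v)`. -/
abbrev aHtr : ℕ := 3
/-- The set `A` of allowed nodes. -/
abbrev aAllowed : ℕ := 4
/-- The adjacency matrix of the flow network. -/
abbrev aNet : ℕ := 5

/-- Membership of the node in register `x` in the set stored in `a`. -/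
abbrev mem (a x : ℕ) : Expr := .get a (.lit 0) (.reg x)

/-- Set the membership of the node in register `x` in the set stored in `a` to `e`. -/
abbrev setMem (a x : ℕ) (e : Expr) : Cmd := .put a (.lit 0) (.reg x) e

/-- Negation. -/
abbrev not (e : Expr) : Expr := .eq e (.lit 0)

/-- `rParents := |pa(v)|`. -/
def countParents : Cmd :=
  .block [.assign rParents (.lit 0),
    .forBelow rI rM (.when (.get aDir (.reg rI) (.reg rV))
      (.assign rParents (.add (.reg rParents) (.lit 1))))]

/-- The node in register `x` is `v` or a sibling of `v`. -/
abbrev isSelfOrSib (x : ℕ) : Expr := .add (.eq (.reg x) (.reg rV)) (.get aBi (.reg rV) (.reg x))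

/-- `aHtr := htr(v)`: start from `v` and its siblings, close `m` times under children, and remove
`v` and its siblings again. -/
def computeHtr : Cmd :=
  .block [
    .forBelow rI rM
      (.cond (isSelfOrSib rI) (setMem aHtr rI (.lit 1)) (setMem aHtr rI (.lit 0))),
    .forBelow rK rM (.forBelow rI rM (.forBelow rJ rM
      (.when (mem aHtr rI) (.when (.get aDir (.reg rI) (.reg rJ))
        (setMem aHtr rJ (.lit 1)))))),
    .forBelow rI rM (.when (isSelfOrSib rI) (setMem aHtr rI (.lit 0)))]

/-- `A := (SolvedNodes ∪ (V \ htr(v))) \ ({v} ∪ sib(v))`. -/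
def computeAllowed : Cmd :=
  .forBelow rI rM
    (.cond (isSelfOrSib rI) (setMem aAllowed rI (.lit 0))
      (.cond (.add (mem aSolved rI) (not (mem aHtr rI)))
        (setMem aAllowed rI (.lit 1)) (setMem aAllowed rI (.lit 0))))

/-- Write down the network `G_flow(v, A)`: the node `L(a)` has the row `a`, the node `R(w)` has
the row `m + w`, the source has the row `2m`, the sink has the row `2m + 1`. -/
def buildNetwork : Cmd :=
  .block [
    .assign rSource (.add (.reg rM) (.reg rM)),
    .assign rSink (.add (.reg rSource) (.lit 1)),
    .assign rSize (.add (.reg rSink) (.lit 1)),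
    .forBelow rI rSize (.forBelow rJ rSize (.put aNet (.reg rI) (.reg rJ) (.lit 0))),
    .forBelow rI rM (.when (mem aAllowed rI) (.block [
      .put aNet (.reg rSource) (.reg rI) (.lit 1),
      .put aNet (.reg rI) (.add (.reg rM) (.reg rI)) (.lit 1),
      .forBelow rJ rM (.when (.get aBi (.reg rI) (.reg rJ))
        (.put aNet (.reg rI) (.add (.reg rM) (.reg rJ)) (.lit 1)))])),
    .forBelow rI rM (.forBelow rJ rM (.when (.get aDir (.reg rI) (.reg rJ))
      (.put aNet (.add (.reg rM) (.reg rI)) (.add (.reg rM) (.reg rJ)) (.lit 1)))),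
    .forBelow rI rM (.when (.get aDir (.reg rI) (.reg rV))
      (.put aNet (.add (.reg rM) (.reg rI)) (.reg rSink) (.lit 1)))]

/-- `rAnswer := 1` if `SolvedNodes = V`, and `rAnswer := 0` otherwise. -/
def checkAllSolved : Cmd :=
  .block [.assign rAnswer (.lit 1),
    .forBelow rI rM (.when (not (mem aSolved rI)) (.assign rAnswer (.lit 0)))]

/-- The algorithm that tests HTC-identifiability, with the procedure `maxFlow` as its maximum flow
subroutine. -/
def testHTC (maxFlow : Cmd) : Cmd :=
  .block [
    -- initialize `SolvedNodes` as the set of nodes without parents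
    .forBelow rV rM (.block [countParents, setMem aSolved rV (not (.reg rParents))]),
    .repeatUntil
      (.block [
        .assign rChanged (.lit 0),
        .forBelow rV rM (.when (not (mem aSolved rV)) (.block [
          computeHtr,
          computeAllowed,
          buildNetwork,
          maxFlow,
          countParents,
          .when (.eq (.reg rFlow) (.reg rParents)) (.block [
            setMem aSolved rV (.lit 1),
            .assign rChanged (.lit 1)])])),
        checkAllSolved])
      -- until `SolvedNodes = V` or no change has occurred in the last iteration
      (.add (.reg rAnswer) (not (.reg rChanged)))]

open Classical in
/-- The matrix (with entries `0`, `1`) of a relation between natural numbers. -/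
noncomputable def matrixOf (R : ℕ → ℕ → Prop) : ℕ → ℕ → ℕ := fun i j => if R i j then 1 else 0

/-- The initial memory: the number of nodes and the two adjacency matrices, and `0` everywhere
else. -/
noncomputable def input {m : ℕ} (G : MixedGraph (Fin m)) : Memory where
  reg := Function.update (fun _ => 0) rM m
  arr := fun a =>
    if a = aDir then matrixOf fun i j => ∃ v w : Fin m, i = v ∧ j = w ∧ G.dir v w
    else if a = aBi then matrixOf fun i j => ∃ v w : Fin m, i = v ∧ j = w ∧ G.bi v w
    else fun _ _ => 0

/-- The row of a node of `G_flow(v, A)` in the adjacency matrix of the network. -/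
def row {m : ℕ} {A : Set (Fin m)} : FlowNode A → ℕ
  | .left a => (a : Fin m)
  | .right w => m + w
  | .source => 2 * m
  | .sink => 2 * m + 1

/-- The memory `σ` holds the network `G_flow(v, A)`. -/
def HoldsNetwork {m : ℕ} (G : MixedGraph (Fin m)) (v : Fin m) (A : Set (Fin m)) (σ : Memory) :
    Prop :=
  σ.reg rSize = 2 * m + 2 ∧
  σ.reg rSource = row (A := A) .source ∧
  σ.reg rSink = row (A := A) .sink ∧
  ∀ i < 2 * m + 2, ∀ j < 2 * m + 2, σ.arr aNet i j =
    matrixOf (fun i j => ∃ x y : FlowNode A,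
      i = row x ∧ j = row y ∧ (G.flowNetwork v A).edge x y) i j

/-- The program `P` is a maximum flow procedure for the networks `G_flow(v, A)`: started in any
memory that holds such a network, it halts with the maximal size of a flow in `rFlow`, and all
other data of the calling program (registers below `12`, arrays below `5`) are unchanged. -/
def IsMaxFlowProcedure (P : Cmd) : Prop :=
  ∀ (m : ℕ) (G : MixedGraph (Fin m)) (v : Fin m) (A : Set (Fin m)),
    A ⊆ (insert v (G.sib v))ᶜ → ∀ σ : Memory, HoldsNetwork G v A σ →
      ∃ (t : ℕ) (τ : Memory), Exec P σ t τ ∧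
        (G.flowNetwork v A).IsMaxFlow (τ.reg rFlow : ℝ≥0) ∧
        (∀ x < 12, x ≠ rFlow → τ.reg x = σ.reg x) ∧
        (∀ a < 5, τ.arr a = σ.arr a)

/-- On a network `G_flow(v, A)` with `n` nodes and `s` reciprocal edge pairs, the program `P` takes
`O((n + s)^3)` steps. -/
def RunsInCubicTime (P : Cmd) : Prop :=
  ∃ K : ℕ, ∀ (m : ℕ) (G : MixedGraph (Fin m)) (v : Fin m) (A : Set (Fin m)),
    A ⊆ (insert v (G.sib v))ᶜ → ∀ σ : Memory, HoldsNetwork G v A σ →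
      ∀ (t : ℕ) (τ : Memory), Exec P σ t τ →
        t ≤ K * (Fintype.card (FlowNode A) + reciprocalPairs (G.flowNetwork v A).edge) ^ 3

end HTCAlgorithm

/-!
A half-trek system with source set contained in `A` and target set `pa v` is the same thing as a
linking of `s` to `t` of size `|pa v|` in `G_flow(v, A)`. The Menger type duality for linkings is
proved by augmenting paths: when no path augments a maximum linking, the nodes reached by
alternating walks from `s` bound the size of every flow. So a maximum flow has size `|pa v|` if and
only if some `Y ⊆ A` satisfies the half-trek criterion with respect to `v`.

The algorithm is correct because its test is monotone in the set `S` of solved nodes: if `G` is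
HTC-identifiable and `S ≠ V`, then the first node outside `S` in the order `≺` passes the test, and
conversely the order in which the nodes are solved is a valid choice of `≺`. An iteration without a
newly solved node is the last one, so there are at most `|V| + 1` iterations, each with at most
`|V|` maximum flow computations on networks with at most `2 |V| + 2` nodes and `r` reciprocal
pairs; these dominate the cost of the remaining steps.
-/

/-! ## Weakest preconditions -/

namespace RAM

/-- `c`, started in `σ`, halts, and the running time and the final memory satisfy `Q`. -/
def wp (c : Cmd) (σ : Memory) (Q : ℕ → Memory → Prop) : Prop := ∃ t τ, Exec c σ t τ ∧ Q t τ

theorem wp.mono {c : Cmd} {σ : Memory} {Q Q' : ℕ → Memory → Prop} (h : wp c σ Q)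
    (hQ : ∀ t τ, Q t τ → Q' t τ) : wp c σ Q' := by
  obtain ⟨t, τ, h₁, h₂⟩ := h
  exact ⟨t, τ, h₁, hQ _ _ h₂⟩

@[simp] theorem wp_skip {σ : Memory} {Q : ℕ → Memory → Prop} : wp .skip σ Q ↔ Q 1 σ := by
  constructor
  · rintro ⟨t, τ, h, hQ⟩
    cases h
    exact hQ
  · exact fun h => ⟨_, _, .skip σ, h⟩

@[simp] theorem wp_assign {x : ℕ} {e : Expr} {σ : Memory} {Q : ℕ → Memory → Prop} :
    wp (.assign x e) σ Q ↔ Q (1 + e.cost) ⟨Function.update σ.reg x (e.eval σ), σ.arr⟩ := by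
  constructor
  · rintro ⟨t, τ, h, hQ⟩
    cases h
    exact hQ
  · exact fun h => ⟨_, _, .assign x e σ, h⟩

@[simp] theorem wp_put {a : ℕ} {i j e : Expr} {σ : Memory} {Q : ℕ → Memory → Prop} :
    wp (.put a i j e) σ Q ↔ Q (1 + i.cost + j.cost + e.cost)
      ⟨σ.reg, fun b k l =>
        if b = a ∧ k = i.eval σ ∧ l = j.eval σ then e.eval σ else σ.arr b k l⟩ := by
  constructor
  · rintro ⟨t, τ, h, hQ⟩
    cases h
    exact hQ
  · exact fun h => ⟨_, _, .put a i j e σ, h⟩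

@[simp] theorem wp_seq {c c' : Cmd} {σ : Memory} {Q : ℕ → Memory → Prop} :
    wp (.seq c c') σ Q ↔ wp c σ fun t τ => wp c' τ fun t' ρ => Q (t + t') ρ := by
  constructor
  · rintro ⟨t, τ, h, hQ⟩
    cases h with
    | seq h₁ h₂ => exact ⟨_, _, h₁, _, _, h₂, hQ⟩
  · rintro ⟨t, τ, h₁, t', ρ, h₂, hQ⟩
    exact ⟨_, _, .seq h₁ h₂, hQ⟩

theorem wp_cond {b : Expr} {c c' : Cmd} {σ : Memory} {Q : ℕ → Memory → Prop} :
    wp (.cond b c c') σ Q ↔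
      (b.eval σ ≠ 0 → wp c σ fun t τ => Q (1 + b.cost + t) τ) ∧
      (b.eval σ = 0 → wp c' σ fun t τ => Q (1 + b.cost + t) τ) := by
  constructor
  · rintro ⟨t, τ, h, hQ⟩
    cases h with
    | cond_true hb h => exact ⟨fun _ => ⟨_, _, h, hQ⟩, fun h' => absurd h' hb⟩
    | cond_false hb h => exact ⟨fun h' => absurd hb h', fun _ => ⟨_, _, h, hQ⟩⟩
  · rintro ⟨h₁, h₂⟩
    by_cases hb : b.eval σ = 0
    · obtain ⟨t, τ, h, hQ⟩ := h₂ hb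
      exact ⟨_, _, .cond_false hb h, hQ⟩
    · obtain ⟨t, τ, h, hQ⟩ := h₁ hb
      exact ⟨_, _, .cond_true hb h, hQ⟩

@[simp] theorem wp_when {b : Expr} {c : Cmd} {σ : Memory} {Q : ℕ → Memory → Prop} :
    wp (.when b c) σ Q ↔
      (b.eval σ ≠ 0 → wp c σ fun t τ => Q (1 + b.cost + t) τ) ∧
      (b.eval σ = 0 → Q (1 + b.cost + 1) σ) := by
  simp [Cmd.when, wp_cond]

@[simp] theorem wp_block_nil {σ : Memory} {Q : ℕ → Memory → Prop} :
    wp (.block []) σ Q ↔ Q 1 σ := wp_skip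

@[simp] theorem wp_block_cons {c : Cmd} {l : List Cmd} {σ : Memory} {Q : ℕ → Memory → Prop} :
    wp (.block (c :: l)) σ Q ↔ wp c σ fun t τ => wp (.block l) τ fun t' ρ => Q (t + t') ρ :=
  wp_seq

theorem Expr.eval_lt_ne_zero {e e' : Expr} {σ : Memory} :
    (Expr.lt e e').eval σ ≠ 0 ↔ e.eval σ < e'.eval σ := by
  simp [Expr.eval]

/-- With the condition `B` on the time bound, one analysis of a loop covers both its termination for
an arbitrary body (`B` false) and its running time for a body of bounded cost. -/
theorem wp_loop {B : Prop} {b : Expr} {c : Cmd} (I : ℕ → Memory → Prop) (T : ℕ)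
    (hstep : ∀ n σ, I n σ → b.eval σ ≠ 0 →
      wp c σ fun t τ => (B → t ≤ T) ∧ ∃ n' < n, I n' τ) :
    ∀ n σ, I n σ → wp (.loop b c) σ fun t τ =>
      (B → t ≤ n * (1 + b.cost + T) + (1 + b.cost)) ∧ (∃ n' ≤ n, I n' τ) ∧ b.eval τ = 0 := by
  intro n
  induction n using Nat.strong_induction_on with
  | _ n ih =>
    intro σ hI
    by_cases hb : b.eval σ = 0
    · exact ⟨_, _, .loop_false hb, fun _ => Nat.le_add_left _ _, ⟨n, le_rfl, hI⟩, hb⟩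
    · obtain ⟨t, τ, h, ht, n', hn', hI'⟩ := hstep n σ hI hb
      obtain ⟨t', ρ, h', ht', ⟨n'', hn'', hI''⟩, hb'⟩ := ih n' hn' τ hI'
      refine ⟨_, _, .loop_true hb h h', fun hB => ?_, ⟨n'', by omega, hI''⟩, hb'⟩
      calc 1 + b.cost + t + t'
          ≤ 1 + b.cost + T + (n' * (1 + b.cost + T) + (1 + b.cost)) := by
            gcongr
            · exact ht hB
            · exact ht' hB
        _ = (n' + 1) * (1 + b.cost + T) + (1 + b.cost) := by ring
        _ ≤ n * (1 + b.cost + T) + (1 + b.cost) := by gcongr; exact hn'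

theorem wp_forBelow {B : Prop} {x bound : ℕ} {c : Cmd} {σ : Memory} (n T : ℕ)
    (I : ℕ → Memory → Prop) (hx : bound ≠ x) (hn : σ.reg bound = n)
    (h0 : I 0 ⟨Function.update σ.reg x 0, σ.arr⟩)
    (hstep : ∀ k < n, ∀ τ, τ.reg x = k → τ.reg bound = n → I k τ →
      wp c τ fun t ρ => (B → t ≤ T) ∧ ρ.reg x = k ∧ ρ.reg bound = n ∧
        I (k + 1) ⟨Function.update ρ.reg x (k + 1), ρ.arr⟩) :
    wp (.forBelow x bound c) σ fun t τ => (B → t ≤ n * (T + 9) + 7) ∧ I n τ := by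
  have key := wp_loop (B := B) (b := .lt (.reg x) (.reg bound))
    (c := .block [c, .assign x (.add (.reg x) (.lit 1))])
    (fun j τ => ∃ k, k + j = n ∧ τ.reg x = k ∧ τ.reg bound = n ∧ I k τ) (T + 5) (by
      rintro j τ ⟨k, hk, hxk, hbn, hI⟩ hb
      have hkn : k < n := by simpa [Expr.eval, hxk, hbn] using Expr.eval_lt_ne_zero.1 hb
      simp only [wp_block_cons, wp_block_nil, wp_assign, Expr.cost, Expr.eval]
      refine (hstep k hkn τ hxk hbn hI).mono ?_
      rintro t ρ ⟨ht, hxk', hbn', hI'⟩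
      refine ⟨fun hB => by have := ht hB; omega, j - 1, by omega, k + 1, by omega, ?_, ?_, ?_⟩
      · simp [hxk']
      · simp [Function.update_of_ne hx, hbn']
      · rwa [hxk'])
  simp only [Cmd.forBelow, wp_block_cons, wp_block_nil, wp_assign, Expr.cost, Expr.eval]
  refine (key n _ ⟨0, by simp, by simp, by simp [Function.update_of_ne hx, hn], h0⟩).mono ?_
  rintro t τ ⟨ht, ⟨j, hj, k, hk, hxk, hbn, hI⟩, hb⟩
  have hkn : k = n := by
    have : ¬ k < n := by simpa [Expr.eval, hxk, hbn] using hb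
    omega
  subst hkn
  refine ⟨fun hB => ?_, hI⟩
  calc 1 + 1 + (t + 1) ≤ 1 + 1 + (k * (1 + (1 + 1 + 1) + (T + 5)) + (1 + (1 + 1 + 1)) + 1) := by
        gcongr; exact ht hB
    _ = k * (T + 9) + 7 := by ring

/-- The program `c` assigns to the register `r`. -/
def Cmd.writesReg : Cmd → ℕ → Bool
  | skip, _ => false
  | assign x _, r => r == x
  | put _ _ _ _, _ => false
  | seq c c', r => c.writesReg r || c'.writesReg r
  | cond _ c c', r => c.writesReg r || c'.writesReg r
  | loop _ c, r => c.writesReg r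

/-- The program `c` assigns to an entry of the array `a`. -/
def Cmd.writesArr : Cmd → ℕ → Bool
  | skip, _ => false
  | assign _ _, _ => false
  | put b _ _ _, a => a == b
  | seq c c', a => c.writesArr a || c'.writesArr a
  | cond _ c c', a => c.writesArr a || c'.writesArr a
  | loop _ c, a => c.writesArr a

theorem Cmd.writesReg_forBelow {x bound r : ℕ} {c : Cmd} :
    (forBelow x bound c).writesReg r = false ↔ r ≠ x ∧ c.writesReg r = false := by
  simp [forBelow, block, writesReg, and_comm]

theorem Cmd.writesArr_forBelow {x bound a : ℕ} {c : Cmd} :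
    (forBelow x bound c).writesArr a = c.writesArr a := by
  simp [forBelow, block, writesArr]

/-- The memories `σ` and `τ` agree on all registers and arrays to which `c` does not assign. -/
structure Frame (c : Cmd) (σ τ : Memory) : Prop where
  reg : ∀ r, c.writesReg r = false → τ.reg r = σ.reg r
  arr : ∀ a, c.writesArr a = false → τ.arr a = σ.arr a

theorem Exec.reg_eq {c : Cmd} {σ τ : Memory} {t : ℕ} (h : Exec c σ t τ) {r : ℕ}
    (hr : c.writesReg r = false) : τ.reg r = σ.reg r := by
  induction h <;> simp_all [Cmd.writesReg, Function.update_of_ne]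

theorem Exec.arr_eq {c : Cmd} {σ τ : Memory} {t : ℕ} (h : Exec c σ t τ) {a : ℕ}
    (ha : c.writesArr a = false) : τ.arr a = σ.arr a := by
  induction h <;> simp_all [Cmd.writesArr]

theorem wp.frame {c : Cmd} {σ : Memory} {Q : ℕ → Memory → Prop} (h : wp c σ Q) :
    wp c σ fun t τ => Q t τ ∧ Frame c σ τ := by
  obtain ⟨t, τ, h, hQ⟩ := h
  exact ⟨t, τ, h, hQ, fun _ => h.reg_eq, fun _ => h.arr_eq⟩

theorem wp_forBelow_frame {x bound : ℕ} {c : Cmd} {σ : Memory} (n T : ℕ)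
    (I : ℕ → Memory → Prop) (hn : σ.reg bound = n)
    (h0 : I 0 ⟨Function.update σ.reg x 0, σ.arr⟩)
    (hstep : ∀ k < n, ∀ τ, τ.reg x = k → Frame (.forBelow x bound c) σ τ → I k τ →
      wp c τ fun t ρ => t ≤ T ∧ I (k + 1) ⟨Function.update ρ.reg x (k + 1), ρ.arr⟩)
    (hx : bound ≠ x := by decide) (hcx : c.writesReg x = false := by rfl)
    (hcb : c.writesReg bound = false := by rfl) :
    wp (.forBelow x bound c) σ fun t τ => t ≤ n * (T + 9) + 7 ∧ I n τ := by
  have hloop := wp_forBelow (B := True) (c := c) n T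
    (fun k τ => I k τ ∧ Frame (.forBelow x bound c) σ τ) hx hn
    ⟨h0, fun r hr => Function.update_of_ne (Cmd.writesReg_forBelow.1 hr).1 _ _, fun a _ => rfl⟩ (by
      rintro k hk τ hxk hbn ⟨hI, hF⟩
      refine (hstep k hk τ hxk hF hI).frame.mono ?_
      rintro t ρ ⟨⟨ht, hI'⟩, hF'⟩
      refine ⟨fun _ => ht, by rw [hF'.reg _ hcx, hxk], by rw [hF'.reg _ hcb, hbn], hI', ?_, ?_⟩
      · intro r hr
        obtain ⟨hrx, hrc⟩ := Cmd.writesReg_forBelow.1 hr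
        simp only [Function.update_of_ne hrx, hF'.reg _ hrc, hF.reg _ hr]
      · intro a ha
        simp only [hF'.arr _ (Cmd.writesArr_forBelow.symm.trans ha), hF.arr _ ha])
  exact hloop.mono fun t τ ⟨ht, hI, _⟩ => ⟨ht trivial, hI⟩

end RAM

/-! ## Linkings and alternating paths -/

/-- A system of paths from `s` to `t` without common inner nodes (and perhaps some cycles), stored
as the map that sends every inner node of a path to its predecessor, and all other nodes to
themselves. The last edge of every path, which leads to `t`, is left implicit. -/
structure IsLinking {ν : Type*} (E : ν → ν → Prop) (s t : ν) (M : ν → ν) : Prop where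
  source : M s = s
  sink : M t = t
  step : ∀ x, M x = x ∨ E (M x) x
  inj : ∀ x y, M x = M y → M x ≠ s → x = y
  exit : ∀ u ∉ Set.range M, E u t

/-- The number of paths of a linking. -/
noncomputable def linkingSize {ν : Type*} (s : ν) (M : ν → ν) : ℕ :=
  Set.ncard {x | x ≠ s ∧ M x = s}

/-- A step of an alternating walk: leave the linking at `x`, that is, follow an edge out of the
predecessor of `x`, or walk back along the linking. -/
def AltStep {ν : Type*} (E : ν → ν → Prop) (M : ν → ν) (x y : ν) : Prop := E (M x) y ∨ M x = y

/-- A set of nodes that is closed under alternating steps and contains the source but not the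
sink. It certifies that the linking has the maximal size, as a cut certifies a maximum flow. -/
structure IsAlternatingClosed {ν : Type*} (E : ν → ν → Prop) (s t : ν) (M : ν → ν) (X : Set ν) :
    Prop where
  source : s ∈ X
  sink : t ∉ X
  step : ∀ x ∈ X, ∀ y, AltStep E M x y → y ∈ X

namespace IsAlternatingClosed

variable {ν : Type*} {E : ν → ν → Prop} {s t : ν} {M : ν → ν} {X : Set ν}

theorem edge (h : IsAlternatingClosed E s t M X) {x y : ν} (hx : x ∈ X) (hy : E (M x) y) :
    y ∈ X :=
  h.step x hx y (.inl hy)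

theorem mate (h : IsAlternatingClosed E s t M X) {x : ν} (hx : x ∈ X) : M x ∈ X :=
  h.step x hx _ (.inr rfl)

theorem mem_of_mate_eq_source (h : IsAlternatingClosed E s t M X) (hM : IsLinking E s t M) {x : ν}
    (hx : M x = s) : x ∈ X := by
  rcases hM.step x with hxx | hxx
  · exact (hxx.symm.trans hx) ▸ h.source
  · exact h.edge h.source (by rwa [hM.source, ← hx])

end IsAlternatingClosed

namespace IsLinking

variable {ν : Type*} {E : ν → ν → Prop} {s t : ν} {M : ν → ν}

theorem of_forall_eq (hM : ∀ x, M x = x) : IsLinking E s t M where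
  source := hM s
  sink := hM t
  step x := .inl (hM x)
  inj x y hxy _ := by rwa [hM, hM] at hxy
  exit u hu := absurd ⟨u, hM u⟩ hu

theorem ncard_sdiff_image [Finite ν] (h : IsLinking E s t M) {X : Set ν}
    (hX : ∀ x, M x = s → x ∈ X) (hM : ∀ x ∈ X, M x ∈ X) :
    (X \ M '' X).ncard = linkingSize s M := by
  have himage : M '' (X \ {x | x ≠ s ∧ M x = s}) = M '' X := by
    refine (Set.image_mono Set.sdiff_subset).antisymm ?_
    rintro _ ⟨x, hx, rfl⟩
    by_cases hxs : M x = s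
    · exact ⟨s, ⟨hX s h.source, fun hs => hs.1 rfl⟩, h.source.trans hxs.symm⟩
    · exact ⟨x, ⟨hx, fun hs => hxs hs.2⟩, rfl⟩
  have hinj : Set.InjOn M (X \ {x | x ≠ s ∧ M x = s}) := by
    rintro x ⟨_, hx⟩ y ⟨_, hy⟩ hxy
    by_cases hxs : M x = s
    · simp only [Set.mem_ofPred_eq, hxs, hxy ▸ hxs, and_true, not_not] at hx hy
      rw [hx, hy]
    · exact h.inj x y hxy hxs
  have hcard := hinj.ncard_image
  rw [himage] at hcard
  have hsub : {x | x ≠ s ∧ M x = s} ⊆ X := fun x hx => hX x hx.2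
  have hsdiff := Set.ncard_sdiff_add_ncard_of_subset hsub
  have hsdiff' := Set.ncard_sdiff_add_ncard_of_subset (Set.image_subset_iff.2 hM)
  rw [linkingSize]
  omega

theorem ncard_compl_range [Finite ν] (h : IsLinking E s t M) :
    (Set.range M)ᶜ.ncard = linkingSize s M := by
  rw [← h.ncard_sdiff_image (X := Set.univ) (by simp) (by simp), Set.image_univ,
    Set.compl_eq_univ_sdiff]

theorem iterate_inj (h : IsLinking E s t M) {n : ℕ} {x y : ν} (hxy : M^[n] x = M^[n] y)
    (hs : M^[n] x ≠ s) : x = y := by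
  induction n with
  | zero => exact hxy
  | succ n ih =>
    rw [Function.iterate_succ_apply', Function.iterate_succ_apply'] at hxy
    rw [Function.iterate_succ_apply'] at hs
    refine ih (h.inj _ _ hxy hs) fun h' => hs ?_
    rw [h', h.source]

theorem eq_of_iterate_eq (h : IsLinking E s t M) {u v : ν} (hu : u ∉ Set.range M)
    (hv : v ∉ Set.range M) {i j : ℕ} (hij : M^[i] u = M^[j] v) (hs : M^[i] u ≠ s) :
    u = v ∧ i = j := by
  wlog hle : i ≤ j generalizing i j u v
  · obtain ⟨huv, hji⟩ := this hv hu hij.symm (hij ▸ hs) (by omega)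
    exact ⟨huv.symm, hji.symm⟩
  obtain ⟨d, rfl⟩ := Nat.exists_eq_add_of_le hle
  rw [Function.iterate_add_apply] at hij
  have huv := h.iterate_inj hij hs
  rcases d with _ | d
  · exact ⟨huv, rfl⟩
  · rw [Function.iterate_succ_apply'] at huv
    exact absurd ⟨_, huv.symm⟩ hu

theorem exists_iterate_eq_source [Finite ν] (h : IsLinking E s t M) {u : ν}
    (hu : u ∉ Set.range M) : ∃ n, M^[n] u = s := by
  by_contra! hne
  obtain ⟨i, j, hij, heq⟩ := Finite.exists_ne_map_eq_of_infinite fun n => M^[n] u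
  exact hij (h.eq_of_iterate_eq hu hu heq (hne i)).2

end IsLinking

theorem linkingSize_of_forall_eq {ν : Type*} {s : ν} {M : ν → ν} (hM : ∀ x, M x = x) :
    linkingSize s M = 0 := by
  simp [linkingSize, hM]

theorem linkingSize_lt_card {ν : Type*} [Fintype ν] (s : ν) (M : ν → ν) :
    linkingSize s M < Fintype.card ν := by
  rw [← Nat.card_eq_fintype_card]
  exact Set.ncard_lt_card fun h => (h ▸ Set.mem_univ s : s ∈ {x | x ≠ s ∧ M x = s}).1 rfl

/-- A linking that is being changed along an alternating path, which is traversed backwards: the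
value of `M` at the current node `h` is to be disregarded. -/
structure IsOpenLinking {ν : Type*} (E : ν → ν → Prop) (s t : ν) (M : ν → ν) (h : ν) : Prop where
  source : M s = s
  step : ∀ x ≠ h, M x = x ∨ E (M x) x
  inj : ∀ x ≠ h, ∀ y ≠ h, M x = M y → M x ≠ s → x = y
  exit : ∀ u ≠ t, u ∉ M '' {h}ᶜ → E u t

/-- The number of nodes other than `h` that `M` sends to `s`. For `h = s` this is
`linkingSize s M`; for `h ≠ s` it also counts `s` itself, which stands for the new path. -/
noncomputable def openSize {ν : Type*} (s : ν) (M : ν → ν) (h : ν) : ℕ :=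
  Set.ncard {x | x ≠ h ∧ M x = s}

namespace IsLinking

variable {ν : Type*} {E : ν → ν → Prop} {s t : ν} {M : ν → ν}

theorem isOpenLinking (h : IsLinking E s t M) : IsOpenLinking E s t M t where
  source := h.source
  step x _ := h.step x
  inj x _ y _ := h.inj x y
  exit u hut hu := h.exit u fun ⟨x, hx⟩ =>
    hu ⟨x, fun hxt => hut (by rw [← hx, hxt, h.sink]), hx⟩

theorem openSize_sink [Finite ν] (h : IsLinking E s t M) (hst : s ≠ t) :
    openSize s M t = linkingSize s M + 1 := by
  have hinsert : {x | x ≠ t ∧ M x = s} = insert s {x | x ≠ s ∧ M x = s} := by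
    ext x
    simp only [Set.mem_ofPred_eq, Set.mem_insert_iff]
    constructor
    · rintro ⟨_, hx⟩
      exact or_iff_not_imp_left.2 fun hxs => ⟨hxs, hx⟩
    · rintro (rfl | ⟨_, hx⟩)
      · exact ⟨hst, h.source⟩
      · exact ⟨fun hxt => hst (by rw [← hx, hxt, h.sink]), hx⟩
  rw [openSize, hinsert, Set.ncard_insert_of_notMem fun hs => hs.1 rfl, linkingSize]

end IsLinking

theorem openSize_update {ν : Type*} [DecidableEq ν] (s : ν) (M : ν → ν) (h p : ν) :
    openSize s (Function.update M h (M p)) p = openSize s M h := by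
  refine Set.ncard_congr (fun x _ => Equiv.swap h p x) ?_ (fun _ _ _ _ => by simp) ?_
  · rintro x ⟨hxp, hx⟩
    by_cases hxh : x = h
    · subst hxh
      exact ⟨by simpa using hxp.symm, by simpa using hx⟩
    · rw [Equiv.swap_apply_of_ne_of_ne hxh hxp]
      exact ⟨hxh, by rwa [Function.update_of_ne hxh] at hx⟩
  · rintro x ⟨hxh, hx⟩
    by_cases hxp : x = p
    · subst hxp
      exact ⟨h, ⟨hxh.symm, by simpa using hx⟩, by simp⟩
    · exact ⟨x, ⟨hxp, by rwa [Function.update_of_ne hxh]⟩, Equiv.swap_apply_of_ne_of_ne hxh hxp⟩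

namespace IsOpenLinking

variable {ν : Type*} {E : ν → ν → Prop} {s t : ν} {M : ν → ν}

theorem ne_sink (hM : IsOpenLinking E s t M s) (hst : s ≠ t) (hEt : ∀ x, ¬ E t x) {x : ν}
    (hx : x ≠ t) : M x ≠ t := by
  intro hMx
  by_cases hxs : x = s
  · exact hst (by rw [← hMx, hxs, hM.source])
  · rcases hM.step x hxs with h | h
    · exact hx (h.symm.trans hMx)
    · exact hEt x (hMx ▸ h)

variable [DecidableEq ν]

theorem move {h p : ν} (hM : IsOpenLinking E s t M h) (hhs : h ≠ s) (hph : p ≠ h)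
    (he : AltStep E M p h) : IsOpenLinking E s t (Function.update M h (M p)) p where
  source := by rw [Function.update_of_ne hhs.symm, hM.source]
  step x _ := by
    by_cases hxh : x = h
    · rw [hxh, Function.update_self]
      exact he.symm
    · rw [Function.update_of_ne hxh]
      exact hM.step x hxh
  inj x hxp y hyp := by
    by_cases hxh : x = h <;> by_cases hyh : y = h
    · exact fun _ _ => hxh.trans hyh.symm
    · rw [hxh, Function.update_self, Function.update_of_ne hyh]
      exact fun hpy hps => absurd (hM.inj p hph y hyh hpy hps) hyp.symm
    · rw [hyh, Function.update_self, Function.update_of_ne hxh]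
      exact fun hxp' hxs => absurd (hM.inj x hxh p hph hxp' hxs) hxp
    · rw [Function.update_of_ne hxh, Function.update_of_ne hyh]
      exact hM.inj x hxh y hyh
  exit u hut hu := by
    refine hM.exit u hut ?_
    rintro ⟨x, hxh : x ≠ h, rfl⟩
    by_cases hxp : x = p
    · exact hu ⟨h, hph.symm, by rw [Function.update_self, hxp]⟩
    · exact hu ⟨x, hxp, Function.update_of_ne hxh _ _⟩

theorem close (hM : IsOpenLinking E s t M s) (hst : s ≠ t) (hEt : ∀ x, ¬ E t x) :
    IsLinking E s t (Function.update M t t) where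
  source := by rw [Function.update_of_ne hst, hM.source]
  sink := Function.update_self ..
  step x := by
    by_cases hxt : x = t
    · exact .inl (by rw [hxt, Function.update_self])
    · rw [Function.update_of_ne hxt]
      by_cases hxs : x = s
      · exact .inl (by rw [hxs, hM.source])
      · exact hM.step x hxs
  inj x y := by
    by_cases hxt : x = t <;> by_cases hyt : y = t
    · exact fun _ _ => hxt.trans hyt.symm
    · rw [hxt, Function.update_self, Function.update_of_ne hyt]
      exact fun h _ => absurd h.symm (hM.ne_sink hst hEt hyt)
    · rw [hyt, Function.update_self, Function.update_of_ne hxt]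
      exact fun h _ => absurd h (hM.ne_sink hst hEt hxt)
    · rw [Function.update_of_ne hxt, Function.update_of_ne hyt]
      intro h hne
      refine hM.inj x (fun e => hne ?_) y (fun e => hne ?_) h hne
      · rw [e, hM.source]
      · rw [h, e, hM.source]
  exit u hu := by
    have hut : u ≠ t := fun hut => hu ⟨t, by rw [Function.update_self, hut]⟩
    by_cases hMt : M t = u
    · rcases hM.step t hst.symm with h | h
      · exact absurd (hMt.symm.trans h) hut
      · exact hMt ▸ h
    · refine hM.exit u hut ?_
      rintro ⟨x, _, hx⟩
      have hxt : x ≠ t := fun hxt => hMt (hxt ▸ hx)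
      exact hu ⟨x, by rw [Function.update_of_ne hxt, hx]⟩

theorem linkingSize_close (hM : IsOpenLinking E s t M s) (hst : s ≠ t) (hE : ¬ E s t) :
    linkingSize s (Function.update M t t) = openSize s M s := by
  have hMt : M t ≠ s := by
    intro hMt
    rcases hM.step t hst.symm with h | h
    · exact hst (hMt.symm.trans h)
    · exact hE (hMt ▸ h)
  rw [linkingSize, openSize]
  congr 1
  ext x
  by_cases hxt : x = t
  · simp [hxt, hMt]
  · simp [Function.update_of_ne hxt]

end IsOpenLinking

/-- The first `n` entries of `q` are distinct nodes and form a tree with the root `s`, in which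
`q i` is the child of `q (link i)` along a step of `R`. -/
structure IsSearchTree {ν : Type*} (R : ν → ν → Prop) (s : ν) (q : ℕ → ν) (link : ℕ → ℕ) (n : ℕ) :
    Prop where
  pos : 0 < n
  root : q 0 = s
  inj : Set.InjOn q (Set.Iio n)
  parent : ∀ i < n, 0 < i → link i < i ∧ R (q (link i)) (q i)

namespace IsSearchTree

variable {ν : Type*} {R : ν → ν → Prop} {s : ν} {q : ℕ → ν} {link : ℕ → ℕ} {n : ℕ}

theorem singleton (hq : q 0 = s) : IsSearchTree R s q link 1 where
  pos := one_pos
  root := hq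
  inj i hi j hj _ := by rw [Nat.lt_one_iff.1 hi, Nat.lt_one_iff.1 hj]
  parent i hi h := by omega

theorem le_card [Fintype ν] (h : IsSearchTree R s q link n) : n ≤ Fintype.card ν := by
  have := Fintype.card_le_of_injective (fun i : Fin n => q i) fun i j hij =>
    Fin.ext (h.inj i.2 j.2 hij)
  simpa using this

theorem push (h : IsSearchTree R s q link n) {x : ν} {i : ℕ} (hx : ∀ j < n, q j ≠ x) (hi : i < n)
    (he : R (q i) x) :
    IsSearchTree R s (Function.update q n x) (Function.update link n i) (n + 1) := by
  have hq {j : ℕ} (hj : j < n) : Function.update q n x j = q j :=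
    Function.update_of_ne hj.ne _ _
  refine ⟨by omega, by rw [hq h.pos, h.root], fun j hj k hk => ?_, fun j hj hj0 => ?_⟩
  · rcases Nat.lt_succ_iff_lt_or_eq.1 hj with hj | rfl <;>
      rcases Nat.lt_succ_iff_lt_or_eq.1 hk with hk | rfl
    · rw [hq hj, hq hk]
      exact h.inj hj hk
    · rw [hq hj, Function.update_self]
      exact fun hjx => absurd hjx (hx j hj)
    · rw [hq hk, Function.update_self]
      exact fun hkx => absurd hkx.symm (hx k hk)
    · exact fun _ => rfl
  · rcases Nat.lt_succ_iff_lt_or_eq.1 hj with hj | rfl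
    · obtain ⟨hlt, hR⟩ := h.parent j hj hj0
      rw [Function.update_of_ne hj.ne, hq hj, hq (hlt.trans hj)]
      exact ⟨hlt, hR⟩
    · rw [Function.update_self, Function.update_self, hq hi]
      exact ⟨hi, he⟩

end IsSearchTree

/-- The intermediate stage of enlarging the linking `M` backwards along a branch of a search tree
in which the places of the branch beyond `p` have been treated, with the result `M'`. -/
structure IsAugmentation {ν : Type*} (E : ν → ν → Prop) (s t : ν) (M : ν → ν) (q : ℕ → ν) (p : ℕ)
    (M' : ν → ν) : Prop where
  isOpen : IsOpenLinking E s t M' (q p)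
  size : openSize s M' (q p) = linkingSize s M + 1
  eq : ∀ l ≤ p, M' (q l) = M (q l)

namespace IsAugmentation

variable {ν : Type*} {E : ν → ν → Prop} {s t : ν} {M M' : ν → ν} {q : ℕ → ν} {p : ℕ}

theorem refl [Finite ν] (hM : IsLinking E s t M) (hst : s ≠ t) (hp : q p = t) :
    IsAugmentation E s t M q p M :=
  ⟨hp ▸ hM.isOpenLinking, hp ▸ hM.openSize_sink hst, fun _ _ => rfl⟩

theorem move [DecidableEq ν] {link : ℕ → ℕ} {n : ℕ} (h : IsAugmentation E s t M q p M')
    (hq : IsSearchTree (AltStep E M) s q link n) (hp : p < n) (h0 : 0 < p) :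
    IsAugmentation E s t M q (link p) (Function.update M' (q p) (M' (q (link p)))) := by
  obtain ⟨hlt, he⟩ := hq.parent p hp h0
  have hne : ∀ l < p, q l ≠ q p := fun l hl hql => hl.ne (hq.inj (hl.trans hp) hp hql)
  refine ⟨h.isOpen.move (hq.root ▸ (hne 0 h0).symm) (hne _ hlt) ?_, ?_, fun l hl => ?_⟩
  · rwa [AltStep, h.eq _ hlt.le]
  · rw [openSize_update, h.size]
  · rw [Function.update_of_ne (hne l (hl.trans_lt hlt)), h.eq l (hl.trans hlt.le)]

end IsAugmentation

/-! ## Flows in networks with unit node capacities -/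

/-- The linking sends one unit of flow along the pair `(u, w)`: either `u` precedes `w` on a path
or cycle, or `u` is the last inner node of a path and `w` is the sink. -/
def Carries {ν : Type*} (t : ν) (M : ν → ν) (u w : ν) : Prop :=
  (u ≠ w ∧ M w = u) ∨ (w = t ∧ u ∉ Set.range M)

theorem carries_iff_eq_mate {ν : Type*} {t : ν} {M : ν → ν} {u v : ν} (ht : v ≠ t) (hv : M v ≠ v) :
    Carries t M u v ↔ u = M v := by
  simp only [Carries, ht, false_and, or_false]
  exact ⟨fun h => h.2.symm, fun h => ⟨h ▸ hv, h.symm⟩⟩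

namespace IsLinking

variable {ν : Type*} {E : ν → ν → Prop} {s t : ν} {M : ν → ν}

theorem edge_of_carries (h : IsLinking E s t M) {u w : ν} (huw : Carries t M u w) : E u w := by
  rcases huw with ⟨hne, rfl⟩ | ⟨rfl, hu⟩
  · exact (h.step w).resolve_left hne
  · exact h.exit u hu

theorem carries_source_iff (h : IsLinking E s t M) {w : ν} :
    Carries t M s w ↔ w ≠ s ∧ M w = s := by
  have hs : s ∈ Set.range M := ⟨s, h.source⟩
  simp [Carries, hs, eq_comm]

theorem not_carries_of_eq_self (h : IsLinking E s t M) {v : ν} (hs : v ≠ s) (ht : v ≠ t)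
    (hv : M v = v) (w : ν) : ¬ Carries t M w v ∧ ¬ Carries t M v w := by
  refine ⟨?_, ?_⟩
  · rintro (⟨hne, hw⟩ | ⟨hvt, _⟩)
    · exact hne (hw.symm.trans hv)
    · exact ht hvt
  · rintro (⟨hne, hw⟩ | ⟨_, hr⟩)
    · exact hne (h.inj v w (hv.trans hw.symm) (by rwa [hv]))
    · exact hr ⟨v, hv⟩

theorem exists_carries_iff_eq (h : IsLinking E s t M) {v : ν} (hs : v ≠ s) (hv : M v ≠ v) :
    ∃ w₀, ∀ w, Carries t M v w ↔ w = w₀ := by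
  by_cases hr : v ∈ Set.range M
  · obtain ⟨x, rfl⟩ := hr
    refine ⟨x, fun w => ⟨?_, ?_⟩⟩
    · rintro (⟨_, hw⟩ | ⟨_, hr⟩)
      · exact h.inj w x hw (hw ▸ hs)
      · exact absurd ⟨x, rfl⟩ hr
    · rintro rfl
      exact .inl ⟨fun hx => hv (by rw [hx, hx]), rfl⟩
  · refine ⟨t, fun w => ⟨?_, fun hw => .inr ⟨hw, hr⟩⟩⟩
    rintro (⟨_, hw⟩ | ⟨hw, _⟩)
    · exact absurd ⟨w, hw⟩ hr
    · exact hw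

end IsLinking

namespace FlowNetwork

variable {ν : Type*} [Fintype ν] {N : FlowNetwork ν}

/-- A network whose inner nodes have capacity `1` and whose edges have capacity `∞`, without edges
into the source or out of the sink. -/
structure IsUnit (N : FlowNetwork ν) : Prop where
  nodeCap : ∀ v, v ≠ N.source → v ≠ N.sink → N.nodeCap v = 1
  edgeCap : ∀ u v, N.edgeCap u v = ⊤
  not_edge_source : ∀ v, ¬ N.edge v N.source
  not_edge_sink : ∀ v, ¬ N.edge N.sink v

open Classical in
/-- The flow with one unit along each path of a linking. -/
noncomputable def linkingFlow (N : FlowNetwork ν) (M : ν → ν) (u w : ν) : ℝ≥0 :=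
  if Carries N.sink M u w then 1 else 0

variable {M : ν → ν}

theorem linkingFlow_conservation (hM : IsLinking N.edge N.source N.sink M) {v : ν}
    (hs : v ≠ N.source) (ht : v ≠ N.sink) :
    ∑ u, N.linkingFlow M u v = ∑ w, N.linkingFlow M v w ∧ ∑ w, N.linkingFlow M v w ≤ 1 := by
  by_cases hv : M v = v
  · have hzero := hM.not_carries_of_eq_self hs ht hv
    simp [linkingFlow, fun w => (hzero w).1, fun w => (hzero w).2]
  · obtain ⟨w₀, hw₀⟩ := hM.exists_carries_iff_eq hs hv
    classical
    simp only [linkingFlow, hw₀, carries_iff_eq_mate ht hv]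
    simp

theorem IsUnit.isFlow_linkingFlow (hN : N.IsUnit) (hM : IsLinking N.edge N.source N.sink M) :
    N.IsFlow (N.linkingFlow M) := by
  refine ⟨fun u v huv => if_neg fun h => huv (hM.edge_of_carries h), fun v hs ht => ?_,
    fun u v _ => by simp [hN.edgeCap]⟩
  obtain ⟨heq, hle⟩ := linkingFlow_conservation hM hs ht
  exact ⟨heq, by rw [hN.nodeCap v hs ht]; exact_mod_cast hle⟩

theorem flowSize_linkingFlow (hM : IsLinking N.edge N.source N.sink M) :
    N.flowSize (N.linkingFlow M) = linkingSize N.source M := by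
  classical
  simp [flowSize, linkingFlow, hM.carries_source_iff, linkingSize, Set.ncard_eq_toFinset_card']

variable {f : ν → ν → ℝ≥0} {O Y : Finset ν}

theorem IsFlow.sum_outflow_le (hf : N.IsFlow f) (hs : N.source ∉ Y) (ht : N.sink ∉ Y)
    (hOY : ∀ u ∈ O, ∀ w, N.edge u w → w ∈ Y) :
    ∑ u ∈ O, ∑ w, f u w ≤ ∑ w ∈ Y, ∑ x, f w x :=
  calc ∑ u ∈ O, ∑ w, f u w = ∑ u ∈ O, ∑ w ∈ Y, f u w :=
        Finset.sum_congr rfl fun u hu => (Finset.sum_subset (Finset.subset_univ _)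
          fun w _ hw => hf.1 u w fun he => hw (hOY u hu w he)).symm
    _ ≤ ∑ u, ∑ w ∈ Y, f u w := Finset.sum_le_sum_of_subset (Finset.subset_univ _)
    _ = ∑ w ∈ Y, ∑ u, f u w := Finset.sum_comm
    _ = ∑ w ∈ Y, ∑ x, f w x := Finset.sum_congr rfl fun w hw =>
        (hf.2.1 w (ne_of_mem_of_not_mem hw hs) (ne_of_mem_of_not_mem hw ht)).1

theorem IsFlow.flowSize_le_card_sdiff [DecidableEq ν] (hf : N.IsFlow f) (hN : N.IsUnit)
    (hO : N.source ∈ O) (hs : N.source ∉ Y) (ht : N.sink ∉ Y)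
    (hOY : ∀ u ∈ O, ∀ w, N.edge u w → w ∈ Y) :
    N.flowSize f ≤ (Y \ O).card := by
  have hsplit : Y ⊆ O.erase N.source ∪ Y \ O := by
    intro w hw
    by_cases hwO : w ∈ O
    · exact Finset.mem_union_left _ (Finset.mem_erase.2 ⟨ne_of_mem_of_not_mem hw hs, hwO⟩)
    · exact Finset.mem_union_right _ (Finset.mem_sdiff.2 ⟨hw, hwO⟩)
  have hdisj : Disjoint (O.erase N.source) (Y \ O) :=
    Finset.disjoint_sdiff.mono_left (Finset.erase_subset _ _)
  have hle : ∑ w ∈ O.erase N.source, ∑ x, f w x + N.flowSize f ≤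
      ∑ w ∈ O.erase N.source, ∑ x, f w x + ∑ w ∈ Y \ O, ∑ x, f w x :=
    calc _ = ∑ w ∈ O, ∑ x, f w x := Finset.sum_erase_add _ _ hO
      _ ≤ ∑ w ∈ Y, ∑ x, f w x := hf.sum_outflow_le hs ht hOY
      _ ≤ _ := (Finset.sum_le_sum_of_subset hsplit).trans_eq (Finset.sum_union hdisj)
  refine (le_of_add_le_add_left hle).trans
    ((Finset.sum_le_card_nsmul _ _ 1 fun w hw => ?_).trans (by simp))
  have hwY := (Finset.mem_sdiff.1 hw).1
  have hws := ne_of_mem_of_not_mem hwY hs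
  have hwt := ne_of_mem_of_not_mem hwY ht
  have hcap := (hf.2.1 w hws hwt).2
  rw [hN.nodeCap w hws hwt] at hcap
  exact_mod_cast hcap

theorem IsUnit.flowSize_le (hN : N.IsUnit) (hM : IsLinking N.edge N.source N.sink M) {X : Set ν}
    (hX : IsAlternatingClosed N.edge N.source N.sink M X) (hf : N.IsFlow f) :
    N.flowSize f ≤ linkingSize N.source M := by
  classical
  have hcard : ((X.toFinset.erase N.source) \ (M '' X).toFinset).card = linkingSize N.source M := by
    rw [← hM.ncard_sdiff_image (fun x => hX.mem_of_mate_eq_source hM) (fun x => hX.mate),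
      Set.ncard_eq_toFinset_card']
    congr 1
    ext x
    simp only [Finset.mem_sdiff, Finset.mem_erase, Set.mem_toFinset, Set.mem_sdiff]
    have hsX : N.source ∈ M '' X := ⟨_, hX.source, hM.source⟩
    exact ⟨fun h => ⟨h.1.2, h.2⟩, fun h => ⟨⟨fun hx => h.2 (hx ▸ hsX), h.1⟩, h.2⟩⟩
  rw [← hcard]
  refine hf.flowSize_le_card_sdiff hN (Set.mem_toFinset.2 ⟨_, hX.source, hM.source⟩)
    (Finset.notMem_erase _ _) (fun h => hX.sink (Set.mem_toFinset.1 (Finset.mem_of_mem_erase h))) ?_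
  intro u hu w he
  obtain ⟨x, hx, rfl⟩ := Set.mem_toFinset.1 hu
  refine Finset.mem_erase.2 ⟨?_, Set.mem_toFinset.2 (hX.edge hx he)⟩
  rintro rfl
  exact hN.not_edge_source _ he

theorem IsUnit.isMaxFlow_of_isAlternatingClosed (hN : N.IsUnit)
    (hM : IsLinking N.edge N.source N.sink M) {X : Set ν}
    (hX : IsAlternatingClosed N.edge N.source N.sink M X) :
    N.IsMaxFlow (linkingSize N.source M) := by
  refine ⟨⟨_, hN.isFlow_linkingFlow hM, flowSize_linkingFlow hM⟩, ?_⟩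
  rintro _ ⟨f, hf, rfl⟩
  exact hN.flowSize_le hM hX hf

end FlowNetwork

/-! ## Half-treks in the flow network -/

theorem FlowNode.left_injective {V : Type*} {A : Set V} :
    Function.Injective (FlowNode.left : A → FlowNode A) :=
  fun _ _ h => FlowNode.left.inj h

theorem FlowNode.right_injective {V : Type*} {A : Set V} :
    Function.Injective (FlowNode.right : V → FlowNode A) :=
  fun _ _ h => FlowNode.right.inj h

namespace MixedGraph

variable {V : Type*} {G : MixedGraph V} {v : V} {A : Set V}

namespace HalfTrek

/-- The half-trek without directed edges: a single node or a bidirected edge. -/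
def base {v w : V} (h : w = v ∨ G.bi v w) : G.HalfTrek := ⟨v, w, [], h, List.isChain_singleton _⟩

/-- A half-trek extended by a directed edge at its target. -/
def extend (π : G.HalfTrek) {w : V} (h : G.dir π.target w) : G.HalfTrek where
  source := π.source
  head := π.head
  tail := π.tail ++ [w]
  start := π.start
  path := List.IsChain.append π.path (List.isChain_singleton w) <| by
    rintro x hx y hy
    rw [List.getLast?_eq_some_getLast (List.cons_ne_nil _ _), Option.mem_some_iff] at hx
    rw [List.head?_cons, Option.mem_some_iff] at hy
    exact hx ▸ hy ▸ h

theorem target_extend (π : G.HalfTrek) {w : V} (h : G.dir π.target w) :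
    (π.extend h).target = w := by
  simp [target, extend]

theorem right_extend (π : G.HalfTrek) {w : V} (h : G.dir π.target w) :
    (π.extend h).right = insert w π.right := by
  ext x
  simp only [right, extend, Set.mem_ofPred_eq, Set.mem_insert_iff, List.mem_cons, List.mem_append,
    List.not_mem_nil, or_false]
  tauto

/-- The inner nodes of the path in `G_flow(v, A)` that corresponds to a half-trek. -/
def flowNodes (A : Set V) (π : G.HalfTrek) : Set (FlowNode A) :=
  FlowNode.left '' (Subtype.val ⁻¹' π.left) ∪ FlowNode.right '' π.right

theorem disjoint_flowNodes_iff {π ρ : G.HalfTrek} (hπ : π.source ∈ A) :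
    Disjoint (π.flowNodes A) (ρ.flowNodes A) ↔
      π.left ∩ ρ.left = ∅ ∧ π.right ∩ ρ.right = ∅ := by
  have hlr (X : Set A) (Y : Set V) :
      Disjoint (FlowNode.left '' X) (FlowNode.right '' Y : Set (FlowNode A)) := by
    rw [Set.disjoint_left]
    rintro _ ⟨a, _, rfl⟩ ⟨w, _, hw⟩
    cases hw
  have hleft : Disjoint (Subtype.val ⁻¹' π.left : Set A) (Subtype.val ⁻¹' ρ.left) ↔
      Disjoint π.left ρ.left := by
    simp only [left, Set.mem_preimage, Set.disjoint_left]
    exact ⟨fun h a ha => @h ⟨a, ha ▸ hπ⟩ ha, fun h a ha => h ha⟩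
  simp only [← Set.disjoint_iff_inter_eq_empty, flowNodes, Set.disjoint_union_left,
    Set.disjoint_union_right, hlr, (hlr _ _).symm, Set.disjoint_image_iff FlowNode.left_injective,
    Set.disjoint_image_iff FlowNode.right_injective, hleft, true_and, and_true]

theorem flowNodes_base_subset (a : A) {w : V} (h : w = a ∨ G.bi a w) :
    (base h).flowNodes A ⊆ {.left a, .right w} := by
  rintro _ (⟨b, hb, rfl⟩ | ⟨x, hx, rfl⟩)
  · exact .inl (congrArg _ (Subtype.ext hb))
  · exact .inr (congrArg _ (List.mem_singleton.1 hx))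

theorem flowNodes_extend (π : G.HalfTrek) {w : V} (h : G.dir π.target w) :
    (π.extend h).flowNodes A = insert (.right w) (π.flowNodes A) := by
  rw [flowNodes, right_extend, Set.image_insert_eq, Set.union_insert]
  rfl

end HalfTrek

section

variable {M : FlowNode A → FlowNode A}

theorem exists_halfTrek_of_iterate_eq_source (hM : IsLinking (G.FlowEdge v A) .source .sink M)
    {n : ℕ} {p : V} (hp : M^[n] (.right p) = .source) :
    ∃ π : G.HalfTrek, π.target = p ∧ π.source ∈ A ∧
      ∀ u ∈ π.flowNodes A, ∃ i, M^[i] (.right p) = u := by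
  induction n generalizing p with
  | zero => exact nomatch hp
  | succ n ih =>
    rw [Function.iterate_succ_apply] at hp
    rcases hM.step (.right p) with heq | he
    · exact ih (heq ▸ hp)
    have hbase (a : A) (ha : M (.right p) = .left a) (h : p = a ∨ G.bi a p) :
        ∃ π : G.HalfTrek, π.target = p ∧ π.source ∈ A ∧
          ∀ u ∈ π.flowNodes A, ∃ i, M^[i] (.right p) = u := by
      refine ⟨.base h, rfl, a.2, fun u hu => ?_⟩
      rcases HalfTrek.flowNodes_base_subset a h hu with rfl | rfl
      exacts [⟨1, ha⟩, ⟨0, rfl⟩]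
    generalize hy : M (.right p) = y at he
    cases he with
    | left_right a => exact hbase a hy (.inl rfl)
    | left_sibling a _ hbi => exact hbase a hy (.inr hbi)
    | right_right w _ hdir =>
      obtain ⟨π, rfl, hsource, hnodes⟩ := ih (hy ▸ hp)
      refine ⟨π.extend hdir, π.target_extend hdir, hsource, fun u hu => ?_⟩
      rw [HalfTrek.flowNodes_extend] at hu
      rcases hu with rfl | hu
      · exact ⟨0, rfl⟩
      · obtain ⟨i, hi⟩ := hnodes u hu
        exact ⟨i + 1, by rw [Function.iterate_succ_apply, hy, hi]⟩

theorem compl_range_subset_image_pa (hM : IsLinking (G.FlowEdge v A) .source .sink M) :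
    (Set.range M)ᶜ ⊆ FlowNode.right '' G.pa v := by
  intro u hu
  cases hM.exit u hu with
  | right_sink w hw => exact ⟨w, hw, rfl⟩

theorem linkingSize_le_ncard_pa [Finite V] (hM : IsLinking (G.FlowEdge v A) .source .sink M) :
    linkingSize .source M ≤ (G.pa v).ncard := by
  rw [← hM.ncard_compl_range, ← Set.ncard_image_of_injective _ (FlowNode.right_injective (A := A))]
  exact Set.ncard_le_ncard (compl_range_subset_image_pa hM)

theorem right_notMem_range [Finite V] (hM : IsLinking (G.FlowEdge v A) .source .sink M)
    (hk : linkingSize .source M = (G.pa v).ncard) {p : V} (hp : p ∈ G.pa v) :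
    FlowNode.right p ∉ Set.range M := by
  have heq : (Set.range M)ᶜ = FlowNode.right '' G.pa v := by
    refine Set.eq_of_subset_of_ncard_le (compl_range_subset_image_pa hM) ?_
    rw [Set.ncard_image_of_injective _ FlowNode.right_injective, hM.ncard_compl_range, hk]
  exact heq.superset ⟨p, hp, rfl⟩

end

theorem halfTrekCriterion_of_disjoint (π : V → G.HalfTrek)
    (htarget : ∀ p ∈ G.pa v, (π p).target = p) (hA : A ⊆ (insert v (G.sib v))ᶜ)
    (hsource : ∀ p ∈ G.pa v, (π p).source ∈ A)
    (hdisj : (G.pa v).PairwiseDisjoint fun p => (π p).flowNodes A) :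
    ∃ Y ⊆ A, G.HalfTrekCriterion Y v := by
  have hsided {p q : V} (hp : p ∈ G.pa v) (hq : q ∈ G.pa v) (hpq : p ≠ q) :
      (π p).left ∩ (π q).left = ∅ ∧ (π p).right ∩ (π q).right = ∅ :=
    (HalfTrek.disjoint_flowNodes_iff (hsource p hp)).1 (hdisj hp hq hpq)
  have hinj : Set.InjOn (fun p => (π p).source) (G.pa v) := by
    intro p hp q hq hpq
    by_contra hne
    exact (hsided hp hq hne).1.subset ⟨rfl, hpq⟩
  refine ⟨(fun p => (π p).source) '' G.pa v, Set.image_subset_iff.2 hsource, hinj.ncard_image, ?_,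
    π '' G.pa v, ⟨?_, ?_⟩, ?_⟩
  · rw [← Set.disjoint_iff_inter_eq_empty, Set.disjoint_left]
    rintro _ ⟨p, hp, rfl⟩
    exact hA (hsource p hp)
  · rw [← Function.comp_def, Set.image_comp]
    exact Set.InjOn.bijOn_image hinj.image_of_comp
  · have himage : HalfTrek.target '' (π '' G.pa v) = G.pa v := by
      rw [← Set.image_comp, Set.EqOn.image_eq_self (f := HalfTrek.target ∘ π) htarget]
    have htinj : Set.InjOn (HalfTrek.target ∘ π) (G.pa v) :=
      (Set.injOn_id _).congr fun p hp => (htarget p hp).symm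
    have hbij := htinj.image_of_comp.bijOn_image
    rwa [himage] at hbij
  · rintro _ ⟨p, hp, rfl⟩ _ ⟨q, hq, rfl⟩ hne
    exact hsided hp hq fun h => hne (h ▸ rfl)

section

variable {M : FlowNode A → FlowNode A} {X : Set (FlowNode A)}

theorem halfTrekCriterion_of_isLinking [Finite V] (hA : A ⊆ (insert v (G.sib v))ᶜ)
    (hM : IsLinking (G.FlowEdge v A) .source .sink M)
    (hk : linkingSize .source M = (G.pa v).ncard) :
    ∃ Y ⊆ A, G.HalfTrekCriterion Y v := by
  have : Nonempty G.HalfTrek := ⟨.base (v := v) (.inl rfl)⟩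
  have hexists : ∀ p ∈ G.pa v, ∃ π : G.HalfTrek, π.target = p ∧ π.source ∈ A ∧
      ∀ u ∈ π.flowNodes A, ∃ i, M^[i] (.right p) = u := fun p hp =>
    let ⟨_, hn⟩ := hM.exists_iterate_eq_source (right_notMem_range hM hk hp)
    exists_halfTrek_of_iterate_eq_source hM hn
  choose! π htarget hsource hnodes using hexists
  refine halfTrekCriterion_of_disjoint π htarget hA hsource fun p hp q hq hpq => ?_
  rw [Function.onFun, Set.disjoint_left]
  intro u hu hu'
  obtain ⟨i, hi⟩ := hnodes p hp u hu
  obtain ⟨j, hj⟩ := hnodes q hq u hu'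
  have hus : u ≠ .source := by
    rintro rfl
    rcases hu with ⟨_, _, h⟩ | ⟨_, _, h⟩ <;> exact nomatch h
  exact hpq (FlowNode.right_injective (hM.eq_of_iterate_eq (right_notMem_range hM hk hp)
    (right_notMem_range hM hk hq) (hi.trans hj.symm) (hi ▸ hus)).1)

theorem exists_mem_sdiff_image_of_isChain
    (hX : IsAlternatingClosed (G.FlowEdge v A) .source .sink M X) {h : V} {l : List V}
    (hl : List.IsChain G.dir (h :: l))
    (hlast : (h :: l).getLast (List.cons_ne_nil _ _) ∈ G.pa v) (hh : FlowNode.right h ∈ X) :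
    ∃ w ∈ h :: l, FlowNode.right w ∈ X \ M '' X := by
  induction l generalizing h with
  | nil =>
    refine ⟨h, List.mem_cons_self, hh, ?_⟩
    rintro ⟨x, hx, hxh⟩
    exact hX.sink (hX.edge hx (hxh ▸ .right_sink h hlast))
  | cons u l ih =>
    obtain ⟨hdir, hl⟩ := List.isChain_cons_cons.1 hl
    by_cases hm : FlowNode.right h ∈ M '' X
    · obtain ⟨x, hx, hxh⟩ := hm
      obtain ⟨w, hw, hwX⟩ := ih hl (by simpa using hlast) (hX.edge hx (hxh ▸ .right_right h u hdir))
      exact ⟨w, List.mem_cons_of_mem _ hw, hwX⟩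
    · exact ⟨h, List.mem_cons_self, hh, hm⟩

theorem exists_mem_flowNodes_sdiff_image
    (hX : IsAlternatingClosed (G.FlowEdge v A) .source .sink M X)
    (hM : IsLinking (G.FlowEdge v A) .source .sink M)
    {π : G.HalfTrek} (hsource : π.source ∈ A) (htarget : π.target ∈ G.pa v) :
    ∃ u ∈ π.flowNodes A, u ∈ X \ M '' X := by
  have hleft : FlowNode.left ⟨π.source, hsource⟩ ∈ X :=
    hX.edge hX.source (hM.source.symm ▸ .source_left _)
  by_cases hm : FlowNode.left ⟨π.source, hsource⟩ ∈ M '' X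
  · obtain ⟨x, hx, hxh⟩ := hm
    have hhead : FlowNode.right π.head ∈ X := by
      refine hX.edge hx ?_
      rw [hxh]
      rcases π.start with h | h
      · rw [h]
        exact .left_right ⟨π.source, hsource⟩
      · exact .left_sibling ⟨π.source, hsource⟩ _ h
    obtain ⟨w, hw, hwX⟩ := exists_mem_sdiff_image_of_isChain hX π.path htarget hhead
    exact ⟨_, .inr ⟨w, hw, rfl⟩, hwX⟩
  · exact ⟨_, .inl ⟨_, rfl, rfl⟩, hleft, hm⟩

theorem ncard_pa_le_of_isAlternatingClosed [Finite V]
    (hX : IsAlternatingClosed (G.FlowEdge v A) .source .sink M X)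
    (hM : IsLinking (G.FlowEdge v A) .source .sink M) {Y : Set V} (hY : Y ⊆ A)
    (hv : G.HalfTrekCriterion Y v) : (G.pa v).ncard ≤ linkingSize .source M := by
  obtain ⟨_, _, S, ⟨hsource, htarget⟩, hsided⟩ := hv
  have : Nonempty (FlowNode A) := ⟨.source⟩
  choose! u hu huX using fun π (hπ : π ∈ S) => exists_mem_flowNodes_sdiff_image hX hM
    (hY (hsource.mapsTo hπ)) (htarget.mapsTo hπ)
  have hinj : Set.InjOn u S := by
    intro π hπ ρ hρ hpr
    by_contra hne
    have hdisj := (HalfTrek.disjoint_flowNodes_iff (hY (hsource.mapsTo hπ))).2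
      (hsided π hπ ρ hρ hne)
    exact Set.disjoint_left.1 hdisj (hu π hπ) (hpr ▸ hu ρ hρ)
  rw [← hM.ncard_sdiff_image (fun x => hX.mem_of_mate_eq_source hM) (fun x => hX.mate),
    ← htarget.image_eq, htarget.injOn.ncard_image]
  exact Set.ncard_le_ncard_of_injOn u huX hinj

theorem linkingSize_eq_ncard_pa_iff [Finite V] (hA : A ⊆ (insert v (G.sib v))ᶜ)
    (hX : IsAlternatingClosed (G.FlowEdge v A) .source .sink M X)
    (hM : IsLinking (G.FlowEdge v A) .source .sink M) :
    linkingSize .source M = (G.pa v).ncard ↔ ∃ Y ⊆ A, G.HalfTrekCriterion Y v :=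
  ⟨halfTrekCriterion_of_isLinking hA hM, fun ⟨_, hY, hv⟩ =>
    (linkingSize_le_ncard_pa hM).antisymm (ncard_pa_le_of_isAlternatingClosed hX hM hY hv)⟩

end

theorem isUnit_flowNetwork [Finite V] (G : MixedGraph V) (v : V) (A : Set V) :
    (G.flowNetwork v A).IsUnit where
  nodeCap
    | .source, h, _ => absurd rfl h
    | .sink, _, h => absurd rfl h
    | .left _, _, _ => rfl
    | .right _, _, _ => rfl
  edgeCap _ _ := rfl
  not_edge_source _ h := nomatch h
  not_edge_sink _ h := nomatch h

/-! ## The greedy construction of an order -/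

/-- The nodes of `S` can be solved one after the other: `ρ` gives the order, and every `w` that has
to precede `v` belongs to `S` as well. -/
def Solvable (G : MixedGraph V) (S : Set V) : Prop :=
  ∃ (Y : V → Set V) (ρ : V → ℕ), ∀ v ∈ S, G.HalfTrekCriterion (Y v) v ∧
    ∀ w ∈ Y v ∩ G.htr v, w ∈ S ∧ ρ w < ρ v

/-- The set `A` of the algorithm for the node `v`, if the nodes of `S` are solved. -/
def allowed (G : MixedGraph V) (S : Set V) (v : V) : Set V :=
  (S ∪ (G.htr v)ᶜ) \ insert v (G.sib v)

/-- The half-trek criterion for `v` can be satisfied if the nodes of `S` are solved. -/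
def CanSolve (G : MixedGraph V) (S : Set V) (v : V) : Prop :=
  ∃ Y ⊆ G.allowed S v, G.HalfTrekCriterion Y v

theorem halfTrekCriterion_empty (hv : G.pa v = ∅) : G.HalfTrekCriterion ∅ v := by
  refine ⟨by rw [hv], Set.empty_inter _, ∅, ⟨Set.bijOn_empty _, ?_⟩, ?_⟩
  · rw [hv]
    exact Set.bijOn_empty _
  · exact fun π hπ => hπ.elim

theorem solvable_of_pa_eq_empty {S : Set V} (hS : ∀ v ∈ S, G.pa v = ∅) : G.Solvable S :=
  ⟨fun _ => ∅, fun _ => 0, fun v hv => ⟨halfTrekCriterion_empty (hS v hv), fun _ hw => hw.1.elim⟩⟩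

theorem Solvable.insert [Finite V] {S : Set V} (hS : G.Solvable S) (hv : v ∉ S)
    (h : G.CanSolve S v) : G.Solvable (insert v S) := by
  classical
  obtain ⟨Y, ρ, hY⟩ := hS
  obtain ⟨Z, hZ, hZv⟩ := h
  obtain ⟨b, hb⟩ := (Set.finite_range ρ).bddAbove
  have hne {u : V} (hu : u ∈ S) : u ≠ v := ne_of_mem_of_not_mem hu hv
  refine ⟨Function.update Y v Z, Function.update ρ v (b + 1), ?_⟩
  rintro u (rfl | hu)
  · rw [Function.update_self]
    refine ⟨hZv, fun w hw => ?_⟩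
    have hwS : w ∈ S := (hZ hw.1).1.resolve_right (not_not.2 hw.2)
    refine ⟨.inr hwS, ?_⟩
    rw [Function.update_of_ne (hne hwS), Function.update_self]
    exact Nat.lt_succ_of_le (hb ⟨w, rfl⟩)
  · rw [Function.update_of_ne (hne hu)]
    refine ⟨(hY u hu).1, fun w hw => ?_⟩
    obtain ⟨hwS, hlt⟩ := (hY u hu).2 w hw
    refine ⟨.inr hwS, ?_⟩
    rwa [Function.update_of_ne (hne hwS), Function.update_of_ne (hne hu)]

theorem Solvable.htcIdentifiable (h : G.Solvable Set.univ) : G.HTCIdentifiable := by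
  classical
  let : LinearOrder V := linearOrderOfSTO WellOrderingRel
  obtain ⟨Y, ρ, hY⟩ := h
  let key : V → ℕ ×ₗ V := fun v => toLex (ρ v, v)
  have hkey : Function.Injective key := fun x y h => congrArg (fun p => (ofLex p).2) h
  refine ⟨Y, fun v => (hY v trivial).1, fun w v => key w < key v, ?_, ?_⟩
  · exact { irrefl := fun a => lt_irrefl (key a)
            trans := fun a b c => lt_trans
            trichotomous := fun a b h₁ h₂ => hkey ((not_lt.1 h₂).antisymm (not_lt.1 h₁)) }
  · intro v w hw
    exact Prod.Lex.toLex_lt_toLex.2 (.inl ((hY v trivial).2 w hw).2)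

theorem HTCIdentifiable.eq_univ [Finite V] (h : G.HTCIdentifiable) {S : Set V}
    (hS : ∀ v ∉ S, ¬ G.CanSolve S v) : S = Set.univ := by
  obtain ⟨Y, hY, prec, _, hlt⟩ := h
  by_contra hne
  obtain ⟨v, hv, hmin⟩ := (Finite.wellFounded_of_trans_of_irrefl prec).has_min Sᶜ
    (Set.nonempty_compl.2 hne)
  refine hS v hv ⟨Y v, fun w hw => ⟨?_, fun hwv => ?_⟩, hY v⟩
  · by_cases hh : w ∈ G.htr v
    · exact .inl (not_not.1 fun hwS => hmin w hwS (hlt v w ⟨hw, hh⟩))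
    · exact .inr hh
  · exact (hY v).2.1.subset ⟨hw, hwv⟩

end MixedGraph

/-! ## A cubic maximum flow procedure -/

namespace HTCAlgorithm

open RAM RAM.Cmd

/-- The place in the queue of the node that is being scanned. -/
abbrev rHead : ℕ := 12
/-- A row of the flow network. -/
abbrev rNode : ℕ := 13
/-- The length of the queue. -/
abbrev rTail : ℕ := 14
/-- The place in the queue of the current node of the alternating path. -/
abbrev rPlace : ℕ := 15
/-- A counter. -/
abbrev rStep : ℕ := 16
/-- Whether an alternating path has been found. -/
abbrev rFound : ℕ := 17
/-- The predecessor of the node that is being scanned. -/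
abbrev rMate : ℕ := 18
/-- The predecessor map of the linking. -/
abbrev aMate : ℕ := 6
/-- The places in the queue, increased by `1`, of the nodes. -/
abbrev aPos : ℕ := 7
/-- The queue. -/
abbrev aQueue : ℕ := 8
/-- The predecessors in the search tree, as places in the queue. -/
abbrev aLink : ℕ := 9

/-- Append the node in `rNode` to the queue. -/
def pushNode : Cmd :=
  .block [setMem aQueue rTail (.reg rNode), setMem aLink rTail (.reg rHead),
    .assign rTail (.add (.reg rTail) (.lit 1)), setMem aPos rNode (.reg rTail)]

/-- Visit the node in `rNode` if it can be reached from the node in place `rHead`. -/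
def visitNode : Cmd :=
  .when (.eq (mem aPos rNode) (.lit 0))
    (.when (.add (.get aNet (.reg rMate) (.reg rNode)) (.eq (.reg rMate) (.reg rNode))) pushNode)

/-- Visit the neighbours of the node in place `rHead`. -/
def scanNode : Cmd :=
  .block [.assign rMate (.get aMate (.lit 0) (mem aQueue rHead)),
    .forBelow rNode rSize visitNode]

/-- Let the queue consist of the source. -/
def initSearch : Cmd :=
  .block [
    .forBelow rNode rSize (setMem aPos rNode (.lit 0)),
    .put aQueue (.lit 0) (.lit 0) (.reg rSource),
    setMem aPos rSource (.lit 1),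
    .assign rTail (.lit 1)]

/-- Find all nodes that can be reached by alternating paths. -/
def searchPath : Cmd :=
  .block [initSearch, .forBelow rHead rSize (.when (.lt (.reg rHead) (.reg rTail)) scanNode)]

/-- Change the linking at the node in place `rPlace`, and go to its predecessor in the search
tree. -/
def moveBack : Cmd :=
  .block [
    .put aMate (.lit 0) (mem aQueue rPlace)
      (.get aMate (.lit 0) (.get aQueue (.lit 0) (mem aLink rPlace))),
    .assign rPlace (mem aLink rPlace)]

/-- Change the linking along the alternating path to the sink, if there is one. -/
def augment : Cmd :=
  .block [
    .assign rPlace (.sub (mem aPos rSink) (.lit 1)),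
    .forBelow rStep rSize (.when (.lt (.lit 0) (.reg rPlace)) moveBack),
    setMem aMate rSink (.reg rSink)]

/-- Search an alternating path, and if there is one, increase the linking along it. -/
def augmentOnce : Cmd :=
  .block [
    searchPath,
    augment,
    .assign rFlow (.add (.reg rFlow) (.lt (.lit 0) (mem aPos rSink))),
    .assign rFound (mem aPos rSink)]

/-- A maximum flow procedure for networks with node capacities `1`. -/
def unitMaxFlow : Cmd :=
  .block [
    .assign rFlow (.lit 0),
    .forBelow rNode rSize (setMem aMate rNode (.reg rNode)),
    .assign rFound (.lit 1),
    .loop (.reg rFound) augmentOnce]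

/-- The memory holds a relation `E` with distinguished nodes `s` and `t` as a matrix with `N` rows.
The node `x` has the row `r x`; rows that belong to no node are allowed. -/
structure HoldsRelation {ν : Type*} (N : ℕ) (r : ν → ℕ) (E : ν → ν → Prop) (s t : ν)
    (σ : Memory) : Prop where
  inj : Function.Injective r
  lt : ∀ x, r x < N
  size : σ.reg rSize = N
  source : σ.reg rSource = r s
  sink : σ.reg rSink = r t
  edge : ∀ x, ∀ j < N, σ.arr aNet (r x) j ≠ 0 ↔ ∃ y, r y = j ∧ E x y

/-- The memory holds the map `M` as the predecessor map. -/
def HoldsMates {ν : Type*} (r : ν → ℕ) (M : ν → ν) (σ : Memory) : Prop :=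
  ∀ x, σ.arr aMate 0 (r x) = r (M x)

/-- The memory holds a search tree, together with the inverse of its numbering of nodes. -/
structure HoldsSearch {ν : Type*} (r : ν → ℕ) (R : ν → ν → Prop) (s : ν) (q : ℕ → ν) (n : ℕ)
    (σ : Memory) : Prop where
  tail : σ.reg rTail = n
  queue : ∀ i < n, σ.arr aQueue 0 i = r (q i)
  pos : ∀ x i, σ.arr aPos 0 (r x) = i + 1 ↔ i < n ∧ q i = x
  tree : IsSearchTree R s q (σ.arr aLink 0) n

variable {ν : Type*} {N : ℕ} {r : ν → ℕ} {E : ν → ν → Prop} {s t : ν} {M : ν → ν} {σ τ : Memory}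

theorem HoldsRelation.of_frame (h : HoldsRelation N r E s t σ) {c : Cmd} (hF : Frame c σ τ)
    (h₁ : c.writesReg rSize = false := by rfl) (h₂ : c.writesReg rSource = false := by rfl)
    (h₃ : c.writesReg rSink = false := by rfl) (h₄ : c.writesArr aNet = false := by rfl) :
    HoldsRelation N r E s t τ :=
  ⟨h.inj, h.lt, (hF.reg _ h₁).trans h.size, (hF.reg _ h₂).trans h.source,
    (hF.reg _ h₃).trans h.sink, hF.arr _ h₄ ▸ h.edge⟩

theorem HoldsRelation.update_reg (h : HoldsRelation N r E s t σ) (x z : ℕ)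
    (h₁ : rSize ≠ x := by decide) (h₂ : rSource ≠ x := by decide)
    (h₃ : rSink ≠ x := by decide) :
    HoldsRelation N r E s t ⟨Function.update σ.reg x z, σ.arr⟩ :=
  ⟨h.inj, h.lt, (Function.update_of_ne h₁ _ _).trans h.size,
    (Function.update_of_ne h₂ _ _).trans h.source, (Function.update_of_ne h₃ _ _).trans h.sink,
    h.edge⟩

theorem HoldsRelation.card_le [Fintype ν] (h : HoldsRelation N r E s t σ) :
    Fintype.card ν ≤ N := by
  simpa using Fintype.card_le_of_injective (fun x => (⟨r x, h.lt x⟩ : Fin N)) fun x y hxy =>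
    h.inj (Fin.mk.inj_iff.1 hxy)

theorem HoldsMates.of_frame (h : HoldsMates r M σ) {c : Cmd} (hF : Frame c σ τ)
    (hc : c.writesArr aMate = false := by rfl) : HoldsMates r M τ := by
  rwa [HoldsMates, hF.arr _ hc]

namespace HoldsSearch

variable {R : ν → ν → Prop} {q : ℕ → ν} {n : ℕ}

theorem le_card [Fintype ν] (h : HoldsSearch r R s q n σ) : n ≤ Fintype.card ν := h.tree.le_card

theorem pos_ne_zero (h : HoldsSearch r R s q n σ) (x : ν) :
    σ.arr aPos 0 (r x) ≠ 0 ↔ ∃ i < n, q i = x := by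
  simp only [← h.pos, eq_comm (a := σ.arr aPos 0 (r x)), Nat.exists_add_one_eq, Nat.pos_iff_ne_zero]

theorem of_frame (h : HoldsSearch r R s q n σ) {c : Cmd} (hF : Frame c σ τ)
    (h₁ : c.writesReg rTail = false := by rfl) (h₂ : c.writesArr aQueue = false := by rfl)
    (h₃ : c.writesArr aPos = false := by rfl) (h₄ : c.writesArr aLink = false := by rfl) :
    HoldsSearch r R s q n τ :=
  ⟨(hF.reg _ h₁).trans h.tail, hF.arr _ h₂ ▸ h.queue, hF.arr _ h₃ ▸ h.pos, hF.arr _ h₄ ▸ h.tree⟩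

theorem singleton (hr : Function.Injective r) (hq : q 0 = s) (ht : σ.reg rTail = 1)
    (hQ : σ.arr aQueue 0 0 = r s)
    (hP : ∀ x, σ.arr aPos 0 (r x) = if r x = r s then 1 else 0) :
    HoldsSearch r R s q 1 σ where
  tail := ht
  queue i hi := by rw [Nat.lt_one_iff.1 hi, hQ, hq]
  pos x i := by
    rw [hP]
    split_ifs with hx
    · simp +contextual [hr hx, hq]
    · exact iff_of_false not_false fun h =>
        hx (by rw [← h.2, Nat.lt_one_iff.1 h.1, hq])
  tree := .singleton hq

theorem push (h : HoldsSearch r R s q n σ) (hr : Function.Injective r) {i : ℕ}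
    {x : ν} (hx : σ.arr aPos 0 (r x) = 0) (hi : i < n) (he : R (q i) x)
    (ht : τ.reg rTail = n + 1)
    (hQ : τ.arr aQueue 0 = Function.update (σ.arr aQueue 0) n (r x))
    (hL : τ.arr aLink 0 = Function.update (σ.arr aLink 0) n i)
    (hP : τ.arr aPos 0 = Function.update (σ.arr aPos 0) (r x) (n + 1)) :
    HoldsSearch r R s (Function.update q n x) (n + 1) τ := by
  have hq : ∀ j < n, q j ≠ x := fun j hj hjx => (h.pos_ne_zero x).2 ⟨j, hj, hjx⟩ hx
  refine ⟨ht, fun j hj => ?_, fun y j => ?_, hL ▸ h.tree.push hq hi he⟩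
  · rw [hQ]
    rcases Nat.lt_succ_iff_lt_or_eq.1 hj with hj | rfl
    · rw [Function.update_of_ne hj.ne, Function.update_of_ne hj.ne, h.queue j hj]
    · rw [Function.update_self, Function.update_self]
  · rw [hP]
    rcases eq_or_ne y x with rfl | hyx
    · rw [Function.update_self]
      rcases lt_trichotomy j n with hj | rfl | hj
      · rw [Function.update_of_ne hj.ne]
        exact iff_of_false (by omega) fun h' => hq j hj h'.2
      · simp
      · exact iff_of_false (by omega) (by omega)
    · rw [Function.update_of_ne (hr.ne hyx), h.pos]
      rcases eq_or_ne j n with rfl | hj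
      · simp [hyx.symm]
      · rw [Function.update_of_ne hj, Nat.lt_succ_iff_lt_or_eq, or_iff_left hj]

end HoldsSearch

theorem wp_pushNode : wp pushNode σ fun t τ => t = 17 ∧ τ.reg rTail = σ.reg rTail + 1 ∧
    τ.arr aQueue 0 = Function.update (σ.arr aQueue 0) (σ.reg rTail) (σ.reg rNode) ∧
    τ.arr aLink 0 = Function.update (σ.arr aLink 0) (σ.reg rTail) (σ.reg rHead) ∧
    τ.arr aPos 0 = Function.update (σ.arr aPos 0) (σ.reg rNode) (σ.reg rTail + 1) := by
  simp only [pushNode, wp_block_cons, wp_block_nil, wp_put, wp_assign, Expr.cost, Expr.eval]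
  refine ⟨trivial, by simp, ?_, ?_, ?_⟩ <;> · funext l; simp [Function.update_apply]

theorem wp_visitNode (hσ : HoldsRelation N r E s t σ) {q : ℕ → ν} {n h k : ℕ}
    (hS : HoldsSearch r (AltStep E M) s q n σ) (hh : σ.reg rHead = h) (hn : h < n)
    (hm : σ.reg rMate = r (M (q h))) (hk : σ.reg rNode = k) (hkN : k < N) :
    wp visitNode σ fun T τ => T ≤ 60 ∧ ∃ q' n',
      HoldsSearch r (AltStep E M) s q' n' τ ∧ n ≤ n' ∧ (∀ i < n, q' i = q i) ∧
      ∀ y, r y = k → AltStep E M (q h) y → ∃ j < n', q' j = y := by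
  have hstep : (σ.arr aNet (r (M (q h))) k ≠ 0 ∨ r (M (q h)) = k) ↔
      ∃ y, r y = k ∧ AltStep E M (q h) y := by
    rw [hσ.edge _ k hkN]
    constructor
    · rintro (⟨y, hy, he⟩ | he)
      · exact ⟨y, hy, .inl he⟩
      · exact ⟨_, he, .inr rfl⟩
    · rintro ⟨y, hy, he | he⟩
      · exact .inl ⟨y, hy, he⟩
      · exact .inr (he ▸ hy)
  simp only [visitNode, wp_when, Expr.cost, Expr.eval, hk, hm, ne_eq, ite_eq_right_iff,
    one_ne_zero, imp_false, not_not, Nat.add_eq_zero_iff, not_and_or, hstep]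
  refine ⟨fun hpos => ⟨?_, fun hno => ⟨by omega, q, n, hS, le_rfl, fun _ _ => rfl,
    fun y hy he => absurd (hstep.2 ⟨y, hy, he⟩) (by tauto)⟩⟩, fun hpos => ⟨by omega, q, n, hS,
    le_rfl, fun _ _ => rfl, fun y hy _ => (hS.pos_ne_zero y).1 (hy ▸ hpos)⟩⟩
  rintro ⟨x, rfl, he⟩
  refine wp_pushNode.mono ?_
  rintro T τ ⟨rfl, ht, hQ, hL, hP⟩
  rw [hS.tail] at ht hQ hL hP
  rw [hk] at hQ hP
  rw [hh] at hL
  refine ⟨by omega, _, n + 1, hS.push hσ.inj hpos hn he ht hQ hL hP, n.le_succ,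
    fun i hi => Function.update_of_ne hi.ne _ _, fun y hy _ => ⟨n, n.lt_succ_self, ?_⟩⟩
  rw [Function.update_self, hσ.inj hy]

theorem wp_scanNode (hσ : HoldsRelation N r E s t σ) (hM : HoldsMates r M σ)
    {q : ℕ → ν} {n h : ℕ} (hS : HoldsSearch r (AltStep E M) s q n σ) (hh : σ.reg rHead = h)
    (hn : h < n) :
    wp scanNode σ fun T τ => T ≤ N * 100 + 20 ∧ ∃ q' n',
      HoldsSearch r (AltStep E M) s q' n' τ ∧ n ≤ n' ∧ (∀ i < n, q' i = q i) ∧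
      ∀ y, AltStep E M (q h) y → ∃ j < n', q' j = y := by
  simp only [scanNode, wp_block_cons, wp_block_nil, wp_assign, Expr.cost, Expr.eval, hh,
    hS.queue h hn, hM (q h)]
  refine wp.mono (wp_forBelow_frame N 60 (fun k τ => ∃ q' n',
      HoldsSearch r (AltStep E M) s q' n' τ ∧ n ≤ n' ∧ (∀ i < n, q' i = q i) ∧
      ∀ y, r y < k → AltStep E M (q h) y → ∃ j < n', q' j = y) hσ.size
    ⟨q, n, ⟨hS.tail, hS.queue, hS.pos, hS.tree⟩, le_rfl, fun _ _ => rfl, by simp⟩ ?_) ?_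
  · rintro k hk τ hτk hF ⟨q₁, n₁, hS₁, hn₁, hq₁, hvis₁⟩
    have hτ := (hσ.update_reg rMate (r (M (q h)))).of_frame hF
    refine (wp_visitNode hτ hS₁ ((hF.reg rHead rfl).trans hh) (hn.trans_le hn₁)
      (by rw [hq₁ h hn]; exact hF.reg rMate rfl) hτk hk).mono ?_
    rintro T ρ ⟨hT, q₂, n₂, hS₂, hn₂, hq₂, hvis₂⟩
    refine ⟨hT, q₂, n₂, ⟨hS₂.tail, hS₂.queue, hS₂.pos, hS₂.tree⟩, hn₁.trans hn₂,
      fun i hi => (hq₂ i (hi.trans_le hn₁)).trans (hq₁ i hi), fun y hy he => ?_⟩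
    rcases Nat.lt_succ_iff_lt_or_eq.1 hy with hy | hy
    · obtain ⟨j, hj, hjy⟩ := hvis₁ y hy he
      exact ⟨j, hj.trans_le hn₂, (hq₂ j hj).trans hjy⟩
    · exact hvis₂ y hy (by rwa [hq₁ h hn])
  · rintro T τ ⟨hT, q', n', hS', hn', hq', hvis⟩
    exact ⟨by omega, q', n', hS', hn', hq', fun y => hvis y (hσ.lt y)⟩

theorem wp_initSearch {R : ν → ν → Prop} (hσ : HoldsRelation N r E s t σ) :
    wp initSearch σ fun T τ => T ≤ N * 13 + 20 ∧ HoldsSearch r R s (fun _ => s) 1 τ := by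
  simp only [initSearch, wp_block_cons, wp_block_nil, wp_assign, wp_put, Expr.cost, Expr.eval]
  refine wp.mono (wp_forBelow_frame N 4 (fun k τ => ∀ x < k, τ.arr aPos 0 x = 0) hσ.size
    (by simp) ?_).frame ?_
  · rintro k hk τ hτk - hI
    simp only [wp_put, Expr.cost, Expr.eval, hτk]
    refine ⟨by omega, fun x hx => ?_⟩
    rcases Nat.lt_succ_iff_lt_or_eq.1 hx with hx | rfl
    · simp [hI x hx]
    · simp
  · rintro T τ ⟨⟨hT, hpos⟩, hF⟩
    have hsource := (hσ.of_frame hF).source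
    refine ⟨by omega, .singleton hσ.inj rfl rfl ?_ fun x => ?_⟩
    · simp [hsource]
    · simp [hsource, hpos _ (hσ.lt x)]

theorem wp_searchPath [Finite ν] (hσ : HoldsRelation N r E s t σ)
    (hM : HoldsMates r M σ) :
    wp searchPath σ fun T τ => T ≤ N * (N * 100 + 100) + 50 ∧ ∃ q n,
      HoldsSearch r (AltStep E M) s q n τ ∧
      ∀ i < n, ∀ y, AltStep E M (q i) y → ∃ j < n, q j = y := by
  cases nonempty_fintype ν
  simp only [searchPath, wp_block_cons, wp_block_nil]
  refine (wp_initSearch (R := AltStep E M) hσ).frame.mono ?_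
  rintro T₀ τ₀ ⟨⟨hT₀, hS₀⟩, hF₀⟩
  have hτ₀ := hσ.of_frame hF₀
  refine wp.mono (wp_forBelow_frame N (N * 100 + 25) (fun k τ => ∃ q n,
      HoldsSearch r (AltStep E M) s q n τ ∧
      ∀ i < k, i < n → ∀ y, AltStep E M (q i) y → ∃ j < n, q j = y) hτ₀.size
    ⟨_, 1, ⟨hS₀.tail, hS₀.queue, hS₀.pos, hS₀.tree⟩, by simp⟩ ?_) ?_
  · rintro k hk τ hτk hF ⟨q, n, hS, hcl⟩
    simp only [wp_when, Expr.cost, Expr.eval, hτk, hS.tail, ne_eq, ite_eq_right_iff, one_ne_zero,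
      imp_false, not_not]
    refine ⟨fun hkn => (wp_scanNode (hτ₀.of_frame hF) ((hM.of_frame hF₀).of_frame hF) hS hτk
      hkn).mono ?_, fun hkn => ⟨by omega, q, n, ⟨hS.tail, hS.queue, hS.pos, hS.tree⟩,
        fun i hi hin => hcl i (by omega) hin⟩⟩
    rintro T ρ ⟨hT, q', n', hS', hn', hq', hvis⟩
    refine ⟨by omega, q', n', ⟨hS'.tail, hS'.queue, hS'.pos, hS'.tree⟩, fun i hi _ y he => ?_⟩
    rcases Nat.lt_succ_iff_lt_or_eq.1 hi with hi | rfl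
    · rw [hq' i (by omega)] at he
      obtain ⟨j, hj, hjy⟩ := hcl i hi (by omega) y he
      exact ⟨j, hj.trans_le hn', (hq' j hj).trans hjy⟩
    · exact hvis y (hq' i hkn ▸ he)
  · rintro T τ ⟨hT, q, n, hS, hcl⟩
    have hnN := hS.le_card.trans hσ.card_le
    exact ⟨by nlinarith, q, n, hS, fun i hi => hcl i (by omega) hi⟩

theorem wp_moveBack [DecidableEq ν] {R : ν → ν → Prop} {q : ℕ → ν} {n p : ℕ}
    (hr : Function.Injective r) (hS : HoldsSearch r R s q n σ) (hM : HoldsMates r M σ)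
    (hp : σ.reg rPlace = p) (hpn : p < n) (h0 : 0 < p) :
    wp moveBack σ fun T τ => T = 17 ∧ τ.reg rPlace = σ.arr aLink 0 p ∧
      HoldsMates r (Function.update M (q p) (M (q (σ.arr aLink 0 p)))) τ := by
  have hlink : σ.arr aLink 0 p < n := (hS.tree.parent p hpn h0).1.trans hpn
  simp only [moveBack, wp_block_cons, wp_block_nil, wp_put, wp_assign, Expr.cost, Expr.eval, hp,
    hS.queue p hpn, hS.queue _ hlink, hM (q _)]
  refine ⟨trivial, by simp, fun x => ?_⟩
  rcases eq_or_ne x (q p) with rfl | hx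
  · simp
  · simp [hr.ne hx, Function.update_of_ne hx, hM x]

theorem wp_closeMates [DecidableEq ν] (hσ : HoldsRelation N r E s t σ) (hM : HoldsMates r M σ) :
    wp (setMem aMate rSink (.reg rSink)) σ fun T τ => T ≤ 4 ∧
      HoldsMates r (Function.update M t t) τ := by
  simp only [wp_put, Expr.cost, Expr.eval, hσ.sink]
  refine ⟨by omega, fun x => ?_⟩
  rcases eq_or_ne x t with rfl | hx
  · simp
  · simp [hσ.inj.ne hx, Function.update_of_ne hx, hM x]

theorem wp_augment_of_pos_eq_zero (hσ : HoldsRelation N r E s t σ) (hM : HoldsMates r M σ)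
    (hMt : M t = t) (ht : σ.arr aPos 0 (r t) = 0) :
    wp augment σ fun T τ => T ≤ N * 40 + 30 ∧ HoldsMates r M τ := by
  classical
  simp only [augment, wp_block_cons, wp_block_nil, wp_assign, Expr.cost, Expr.eval, hσ.sink, ht]
  refine wp.mono (wp.frame <| wp_forBelow_frame N 25
    (fun _ τ => τ.reg rPlace = 0 ∧ HoldsMates r M τ) hσ.size ⟨rfl, hM⟩ ?_) ?_
  · rintro k - τ - - ⟨hp, hI⟩
    simp only [wp_when, Expr.cost, Expr.eval, hp]
    exact ⟨fun h => absurd rfl h, fun _ => ⟨by omega, hp, hI⟩⟩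
  · rintro T τ ⟨⟨hT, -, hI⟩, hF⟩
    have hτ := (hσ.update_reg rPlace (0 - 1)).of_frame hF
    refine (wp_closeMates hτ hI).mono fun T' ρ ⟨_, hρ⟩ => ⟨by omega, ?_⟩
    rwa [Function.update_eq_self_iff.2 hMt.symm] at hρ

theorem wp_augment_of_pos_ne_zero [Finite ν] (hσ : HoldsRelation N r E s t σ)
    (hst : s ≠ t) (hE : ¬ E s t) (hEt : ∀ x, ¬ E t x) (hL : IsLinking E s t M)
    (hM : HoldsMates r M σ) {q : ℕ → ν} {n : ℕ} (hS : HoldsSearch r (AltStep E M) s q n σ)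
    (ht : σ.arr aPos 0 (r t) ≠ 0) :
    wp augment σ fun T τ => T ≤ N * 40 + 30 ∧ ∃ M', IsLinking E s t M' ∧ HoldsMates r M' τ ∧
      linkingSize s M' = linkingSize s M + 1 := by
  classical
  cases nonempty_fintype ν
  obtain ⟨i, hi⟩ := Nat.exists_eq_add_one_of_ne_zero ht
  obtain ⟨hin, hit⟩ := (hS.pos t i).1 hi
  have hnN : n ≤ N := hS.le_card.trans hσ.card_le
  simp only [augment, wp_block_cons, wp_block_nil, wp_assign, Expr.cost, Expr.eval, hσ.sink, hi,
    Nat.add_sub_cancel]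
  refine wp.mono (wp.frame <| wp_forBelow_frame N 25 (fun k τ => ∃ M' p, τ.reg rPlace = p ∧ p < n ∧
      (p = 0 ∨ p + k < N) ∧ HoldsMates r M' τ ∧ IsAugmentation E s t M q p M') hσ.size
    ⟨M, i, rfl, hin, .inr (by omega), hM, .refl hL hst hit⟩ ?_) ?_
  · rintro k - τ - hF ⟨M', p, hp, hpn, hpk, hM', hA⟩
    have hτ : HoldsSearch r (AltStep E M) s q n τ :=
      HoldsSearch.of_frame (σ := ⟨Function.update σ.reg rPlace i, σ.arr⟩)
        ⟨hS.tail, hS.queue, hS.pos, hS.tree⟩ hF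
    simp only [wp_when, Expr.cost, Expr.eval, hp, ne_eq, ite_eq_right_iff, one_ne_zero, imp_false,
      not_not]
    refine ⟨fun h0 => (wp_moveBack hσ.inj hτ hM' hp hpn h0).mono ?_, fun h0 =>
      ⟨by omega, M', p, hp, hpn, .inl (by omega), hM', hA⟩⟩
    rintro T ρ ⟨rfl, hp', hρ⟩
    have hlt := (hτ.tree.parent p hpn h0).1
    exact ⟨by omega, _, _, hp', hlt.trans hpn, .inr (by omega), hρ, hA.move hτ.tree hpn h0⟩
  · rintro T τ ⟨⟨hT, M', p, -, hpn, hp, hM', hA⟩, hF⟩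
    obtain rfl : p = 0 := by omega
    have hτ := (hσ.update_reg rPlace i).of_frame hF
    have hopen := hA.isOpen
    have hsize := hA.size
    rw [hS.tree.root] at hopen hsize
    exact (wp_closeMates hτ hM').mono fun T' ρ ⟨_, hρ⟩ => ⟨by omega, _, hopen.close hst hEt, hρ,
      (hopen.linkingSize_close hst hE).trans hsize⟩

theorem HoldsSearch.isAlternatingClosed {q : ℕ → ν} {n : ℕ}
    (hS : HoldsSearch r (AltStep E M) s q n σ) (ht : σ.arr aPos 0 (r t) = 0)
    (hcl : ∀ i < n, ∀ y, AltStep E M (q i) y → ∃ j < n, q j = y) :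
    IsAlternatingClosed E s t M (q '' Set.Iio n) where
  source := ⟨0, hS.tree.pos, hS.tree.root⟩
  sink h := (hS.pos_ne_zero t).2 h ht
  step := by
    rintro _ ⟨i, hi, rfl⟩ y he
    exact hcl i hi y he

theorem wp_augmentOnce [Finite ν] (hσ : HoldsRelation N r E s t σ) (hst : s ≠ t)
    (hE : ¬ E s t) (hEt : ∀ x, ¬ E t x) (hL : IsLinking E s t M) (hM : HoldsMates r M σ)
    (hk : linkingSize s M = σ.reg rFlow) :
    wp augmentOnce σ fun T τ => T ≤ N * (N * 100 + 140) + 100 ∧ HoldsRelation N r E s t τ ∧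
      ∃ M', IsLinking E s t M' ∧ HoldsMates r M' τ ∧ linkingSize s M' = τ.reg rFlow ∧
        τ.reg rFlow = σ.reg rFlow + (if τ.reg rFound = 0 then 0 else 1) ∧
        (τ.reg rFound = 0 → ∃ X, IsAlternatingClosed E s t M' X) := by
  simp only [augmentOnce, wp_block_cons, wp_block_nil, wp_assign, Expr.cost, Expr.eval]
  refine (wp_searchPath hσ hM).frame.mono ?_
  rintro T₁ τ₁ ⟨⟨hT₁, q, n, hS, hcl⟩, hF₁⟩
  have hτ₁ := hσ.of_frame hF₁
  have hM₁ := hM.of_frame hF₁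
  by_cases ht : τ₁.arr aPos 0 (r t) = 0
  · refine (wp_augment_of_pos_eq_zero hτ₁ hM₁ hL.sink ht).frame.mono ?_
    rintro T₂ τ₂ ⟨⟨hT₂, hM₂⟩, hF₂⟩
    have hτ₂ := hτ₁.of_frame hF₂
    have hflow : τ₂.reg rFlow = σ.reg rFlow := (hF₂.reg _ rfl).trans (hF₁.reg _ rfl)
    have hpos : τ₂.arr aPos 0 (r t) = 0 := by rw [hF₂.arr aPos rfl, ht]
    simp only [hτ₂.sink, hpos, hflow]
    exact ⟨by nlinarith, (hτ₂.update_reg rFlow _).update_reg rFound _, M, hL, hM₂, hk,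
      by simp [hτ₂.sink, hpos], fun _ => ⟨_, hS.isAlternatingClosed ht hcl⟩⟩
  · refine (wp_augment_of_pos_ne_zero hτ₁ hst hE hEt hL hM₁ hS ht).frame.mono ?_
    rintro T₂ τ₂ ⟨⟨hT₂, M', hL', hM', hk'⟩, hF₂⟩
    have hτ₂ := hτ₁.of_frame hF₂
    have hflow : τ₂.reg rFlow = σ.reg rFlow := (hF₂.reg _ rfl).trans (hF₁.reg _ rfl)
    have hpos : τ₂.arr aPos 0 (r t) ≠ 0 := by rwa [hF₂.arr aPos rfl]
    simp only [hτ₂.sink, hflow, Nat.pos_of_ne_zero hpos, if_true]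
    exact ⟨by nlinarith, (hτ₂.update_reg rFlow _).update_reg rFound _, M', hL', hM',
      hk'.trans (congrArg (· + 1) hk), by simp [hτ₂.sink, hpos],
      fun h => absurd h (by simpa [hτ₂.sink] using hpos)⟩

theorem wp_initMates (hσ : HoldsRelation N r E s t σ) :
    wp (.forBelow rNode rSize (setMem aMate rNode (.reg rNode))) σ fun T τ =>
      T ≤ N * 13 + 7 ∧ HoldsMates r id τ := by
  refine wp.mono (wp_forBelow_frame N 4 (fun k τ => ∀ x < k, τ.arr aMate 0 x = x) hσ.size
    (by simp) ?_) fun T τ ⟨hT, hI⟩ => ⟨hT, fun x => hI _ (hσ.lt x)⟩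
  rintro k hk τ hτk - hI
  simp only [wp_put, Expr.cost, Expr.eval, hτk]
  refine ⟨by omega, fun x hx => ?_⟩
  rcases Nat.lt_succ_iff_lt_or_eq.1 hx with hx | rfl
  · simp [hI x hx, hx.ne]
  · simp

theorem wp_unitMaxFlow [Finite ν] (hσ : HoldsRelation N r E s t σ) (hst : s ≠ t)
    (hE : ¬ E s t) (hEt : ∀ x, ¬ E t x) :
    wp unitMaxFlow σ fun T τ => T ≤ 1000 * (N + 1) ^ 3 ∧
      ∃ M X, IsLinking E s t M ∧ IsAlternatingClosed E s t M X ∧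
        linkingSize s M = τ.reg rFlow := by
  cases nonempty_fintype ν
  simp only [unitMaxFlow, wp_block_cons, wp_block_nil, wp_assign, Expr.cost, Expr.eval]
  refine wp.mono (wp.frame <| wp_initMates (hσ.update_reg rFlow 0)) ?_
  rintro T₀ τ₀ ⟨⟨hT₀, hM₀⟩, hF₀⟩
  have hτ₀ := (hσ.update_reg rFlow 0).of_frame hF₀
  have hflow₀ : τ₀.reg rFlow = 0 := hF₀.reg rFlow rfl
  refine wp.mono (wp_loop (B := True) (fun n τ => HoldsRelation N r E s t τ ∧
      n = N - τ.reg rFlow + (if τ.reg rFound = 0 then 0 else 1) ∧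
      ∃ M, IsLinking E s t M ∧ HoldsMates r M τ ∧ linkingSize s M = τ.reg rFlow ∧
        (τ.reg rFound = 0 → ∃ X, IsAlternatingClosed E s t M X))
    (N * (N * 100 + 140) + 100) ?_ (N + 1) _ ⟨hτ₀.update_reg rFound 1, ?_, id,
      .of_forall_eq fun _ => rfl, hM₀, ?_, fun h => ?_⟩) ?_
  · rintro n τ ⟨hτ, hn, M, hL, hM, hk, -⟩ hb
    replace hb : τ.reg rFound ≠ 0 := hb
    have hlt : τ.reg rFlow < N := hk ▸ (linkingSize_lt_card s M).trans_le hτ.card_le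
    rw [if_neg hb] at hn
    refine (wp_augmentOnce hτ hst hE hEt hL hM hk).mono ?_
    rintro T ρ ⟨hT, hρ, M', hL', hM', hk', hflow, hX⟩
    refine ⟨fun _ => hT, _, ?_, hρ, rfl, M', hL', hM', hk', hX⟩
    split_ifs at hflow ⊢ <;> omega
  · simp [hflow₀]
  · simp [hflow₀, linkingSize_of_forall_eq]
  · simp at h
  · rintro T τ ⟨hT, ⟨n, -, -, -, M, hL, -, hk, hX⟩, hb⟩
    obtain ⟨X, hX⟩ := hX hb
    refine ⟨?_, M, X, hL, hX, hk⟩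
    have := hT trivial
    simp only [Expr.cost] at this
    nlinarith [Nat.zero_le (N ^ 2), Nat.zero_le (N ^ 3)]

section Network

variable {m : ℕ} {G : MixedGraph (Fin m)} {v : Fin m} {A : Set (Fin m)}

theorem row_injective : Function.Injective (row (A := A)) := by
  rintro (_ | _ | ⟨⟨a, _⟩, _⟩ | ⟨w, _⟩) (_ | _ | ⟨⟨b, _⟩, _⟩ | ⟨u, _⟩) h <;>
    simp [row] at h ⊢ <;> omega

theorem row_lt (x : FlowNode A) : row x < 2 * m + 2 := by
  rcases x with _ | _ | ⟨⟨a, _⟩, _⟩ | ⟨w, _⟩ <;> simp [row] <;> omega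

theorem matrixOf_ne_zero {R : ℕ → ℕ → Prop} {i j : ℕ} : matrixOf R i j ≠ 0 ↔ R i j := by
  simp [matrixOf]

theorem HoldsNetwork.holdsRelation (h : HoldsNetwork G v A σ) :
    HoldsRelation (2 * m + 2) row (G.FlowEdge v A) .source .sink σ := by
  obtain ⟨hsize, hsource, hsink, hnet⟩ := h
  refine ⟨row_injective, row_lt, hsize, hsource, hsink, fun x j hj => ?_⟩
  rw [hnet _ (row_lt x) j hj, matrixOf_ne_zero]
  constructor
  · rintro ⟨x', y, hx, rfl, h⟩
    exact ⟨y, rfl, row_injective hx ▸ h⟩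
  · rintro ⟨y, rfl, h⟩
    exact ⟨x, y, rfl, rfl, h⟩

theorem wp_unitMaxFlow_flowNetwork (hσ : HoldsNetwork G v A σ) :
    wp unitMaxFlow σ fun T τ => T ≤ 1000 * (2 * m + 3) ^ 3 ∧
      ∃ (M : FlowNode A → FlowNode A) (X : Set (FlowNode A)),
        IsLinking (G.FlowEdge v A) .source .sink M ∧
        IsAlternatingClosed (G.FlowEdge v A) .source .sink M X ∧
        linkingSize .source M = τ.reg rFlow :=
  wp_unitMaxFlow hσ.holdsRelation nofun nofun fun _ => nofun

theorem isMaxFlowProcedure_unitMaxFlow : IsMaxFlowProcedure unitMaxFlow := by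
  intro m G v A _ σ hσ
  obtain ⟨T, τ, h, ⟨-, M, X, hM, hX, hk⟩, hF⟩ := (wp_unitMaxFlow_flowNetwork hσ).frame
  refine ⟨T, τ, h, ?_, fun x hx hne => hF.reg x ?_, fun a ha => hF.arr a ?_⟩
  · rw [← hk]
    exact (G.isUnit_flowNetwork v A).isMaxFlow_of_isAlternatingClosed hM hX
  · revert hne
    interval_cases x <;> intro hne <;> first | rfl | exact absurd rfl hne
  · interval_cases a <;> rfl

theorem card_flowNode (A : Set (Fin m)) [DecidablePred (· ∈ A)] :
    Fintype.card (FlowNode A) = 2 + (Fintype.card A + m) := by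
  simpa using Fintype.card_congr (FlowNode.equivSum A).symm

theorem runsInCubicTime_unitMaxFlow : RunsInCubicTime unitMaxFlow := by
  classical
  refine ⟨8000, fun m G v A _ σ hσ t τ h => ?_⟩
  obtain ⟨T, τ', h', hT, -⟩ := wp_unitMaxFlow_flowNetwork hσ
  rw [(h'.deterministic h).1]
  calc T ≤ 1000 * (2 * m + 3) ^ 3 := hT
    _ ≤ 1000 * (2 * (Fintype.card (FlowNode A) +
          reciprocalPairs (G.flowNetwork v A).edge)) ^ 3 := by
        gcongr
        have := card_flowNode A
        omega
    _ = _ := by ring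

-- The linking is the one that a run of `unitMaxFlow` leaves in the memory.
theorem exists_isLinking (G : MixedGraph (Fin m)) (v : Fin m) (A : Set (Fin m)) :
    ∃ (M : FlowNode A → FlowNode A) (X : Set (FlowNode A)),
      IsLinking (G.FlowEdge v A) .source .sink M ∧
      IsAlternatingClosed (G.FlowEdge v A) .source .sink M X := by
  have hσ : HoldsNetwork G v A
      ⟨fun r => if r = rSize then 2 * m + 2 else if r = rSource then 2 * m else 2 * m + 1,
        fun _ => matrixOf fun i j => ∃ x y : FlowNode A,
          i = row x ∧ j = row y ∧ (G.flowNetwork v A).edge x y⟩ :=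
    ⟨rfl, rfl, rfl, fun i _ j _ => rfl⟩
  obtain ⟨T, τ, -, -, M, X, hM, hX, -⟩ := wp_unitMaxFlow_flowNetwork hσ
  exact ⟨M, X, hM, hX⟩

theorem eq_ncard_pa_iff (hA : A ⊆ (insert v (G.sib v))ᶜ) {k : ℕ}
    (hk : (G.flowNetwork v A).IsMaxFlow (k : ℝ≥0)) :
    k = (G.pa v).ncard ↔ ∃ Y ⊆ A, G.HalfTrekCriterion Y v := by
  obtain ⟨M, X, hM, hX⟩ := exists_isLinking G v A
  have hmax : k = linkingSize FlowNode.source M := Nat.cast_injective <|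
    hk.unique ((G.isUnit_flowNetwork v A).isMaxFlow_of_isAlternatingClosed hM hX)
  rw [hmax, MixedGraph.linkingSize_eq_ncard_pa_iff hA hX hM]

end Network

end HTCAlgorithm

/-! ## The steps of the test for a node -/

namespace MixedGraph

variable {V : Type*} (G : MixedGraph V)

/-- The targets of the half-treks from `v`. -/
def reach (v : V) : Set V := {w | ∃ x, (x = v ∨ G.bi v x) ∧ Relation.ReflTransGen G.dir x w}

variable {G} {S : Set V} {v x y : V}

theorem mem_insert_sib : x ∈ insert v (G.sib v) ↔ x = v ∨ G.bi v x :=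
  or_congr_right ⟨G.bi_symm _ _, G.bi_symm _ _⟩

theorem insert_sib_subset_reach : insert v (G.sib v) ⊆ G.reach v :=
  fun x hx => ⟨x, mem_insert_sib.1 hx, .refl⟩

theorem mem_reach_of_dir (hx : x ∈ G.reach v) (h : G.dir x y) : y ∈ G.reach v := by
  obtain ⟨z, hz, hzx⟩ := hx
  exact ⟨z, hz, hzx.tail h⟩

theorem reach_subset (hv : insert v (G.sib v) ⊆ S) (h : ∀ x ∈ S, ∀ y, G.dir x y → y ∈ S) :
    G.reach v ⊆ S := by
  rintro w ⟨x, hx, hxw⟩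
  induction hxw with
  | refl => exact hv (mem_insert_sib.2 hx)
  | tail _ hd ih => exact h _ ih _ hd

theorem htr_eq (v : V) : G.htr v = G.reach v \ insert v (G.sib v) := by
  ext w
  constructor
  · rintro ⟨h, π, rfl, rfl⟩
    exact ⟨⟨π.head, π.start, List.relationReflTransGen_of_exists_isChain_cons _ π.path rfl⟩, h⟩
  · rintro ⟨⟨x, hx, hxw⟩, h⟩
    obtain ⟨l, hl, hl'⟩ := List.exists_isChain_cons_of_relationReflTransGen hxw
    exact ⟨h, ⟨v, x, l, hx, hl⟩, rfl, hl'⟩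

end MixedGraph

namespace HTCAlgorithm

open RAM RAM.Cmd

variable {m : ℕ} {G : MixedGraph (Fin m)} {v w : Fin m} {σ τ : Memory}

/-- The memory holds the adjacency matrices of `G`. -/
structure HoldsGraph (G : MixedGraph (Fin m)) (σ : Memory) : Prop where
  size : σ.reg rM = m
  dir : ∀ v w : Fin m, σ.arr aDir v w ≠ 0 ↔ G.dir v w
  bi : ∀ v w : Fin m, σ.arr aBi v w ≠ 0 ↔ G.bi v w

theorem HoldsGraph.of_frame (h : HoldsGraph G σ) {c : Cmd} (hF : Frame c σ τ)
    (h₁ : c.writesReg rM = false := by rfl) (h₂ : c.writesArr aDir = false := by rfl)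
    (h₃ : c.writesArr aBi = false := by rfl) : HoldsGraph G τ :=
  ⟨(hF.reg _ h₁).trans h.size, hF.arr _ h₂ ▸ h.dir, hF.arr _ h₃ ▸ h.bi⟩

/-- The set of nodes that is stored in the row `0` of the array `a`. -/
def nodeSet (m a : ℕ) (σ : Memory) : Set (Fin m) := {w | σ.arr a 0 w ≠ 0}

theorem nodeSet_of_frame {a : ℕ} {c : Cmd} (hF : Frame c σ τ)
    (hc : c.writesArr a = false := by rfl) : nodeSet m a τ = nodeSet m a σ := by
  simp only [nodeSet, hF.arr _ hc]

theorem wp_setMem (a : ℕ) {x : ℕ} (e : Expr) (hx : σ.reg x = w) :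
    wp (setMem a x e) σ fun t τ => t = 3 + e.cost ∧ (w ∈ nodeSet m a τ ↔ e.eval σ ≠ 0) ∧
      ∀ i ≠ w, i ∈ nodeSet m a τ ↔ i ∈ nodeSet m a σ := by
  simp only [wp_put, Expr.cost, Expr.eval, hx, nodeSet, Set.mem_ofPred_eq]
  exact ⟨trivial, by simp, fun i hi => by simp [Fin.val_ne_of_ne hi]⟩

theorem wp_forBelow_nodeSet {a x : ℕ} {c : Cmd} (S : Set (Fin m)) (T : ℕ) (hm : σ.reg rM = m)
    (hstep : ∀ (w : Fin m) (τ : Memory), τ.reg x = w → Frame (.forBelow x rM c) σ τ →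
      (∀ i < w, i ∈ nodeSet m a τ ↔ i ∈ S) → (∀ i ≥ w, i ∈ nodeSet m a τ ↔ i ∈ nodeSet m a σ) →
      wp c τ fun t ρ => t ≤ T ∧ (w ∈ nodeSet m a ρ ↔ w ∈ S) ∧
        ∀ i ≠ w, i ∈ nodeSet m a ρ ↔ i ∈ nodeSet m a τ)
    (hx : rM ≠ x := by decide) (hcx : c.writesReg x = false := by rfl)
    (hcm : c.writesReg rM = false := by rfl) :
    wp (.forBelow x rM c) σ fun t τ => t ≤ m * (T + 9) + 7 ∧ nodeSet m a τ = S := by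
  refine wp.mono (wp_forBelow_frame m T (fun k τ =>
    (∀ i : Fin m, (i : ℕ) < k → (i ∈ nodeSet m a τ ↔ i ∈ S)) ∧
    ∀ i : Fin m, (i : ℕ) ≥ k → (i ∈ nodeSet m a τ ↔ i ∈ nodeSet m a σ))
    hm ⟨by simp, fun _ _ => Iff.rfl⟩ ?_ hx hcx hcm) ?_
  · rintro k hk τ hτk hF ⟨hlt, hge⟩
    refine (hstep ⟨k, hk⟩ τ hτk hF hlt hge).mono ?_
    rintro t ρ ⟨ht, hw, hne⟩
    refine ⟨ht, fun i hi => ?_, fun i hi => ?_⟩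
    · obtain rfl | hik := eq_or_ne i ⟨k, hk⟩
      · exact hw
      · exact (hne i hik).trans (hlt i (by have := Fin.val_ne_of_ne hik; grind))
    · exact (hne i (Fin.ne_of_val_ne (by grind))).trans (hge i (by grind))
  · rintro t τ ⟨ht, hlt, -⟩
    exact ⟨ht, Set.ext fun i => hlt i i.2⟩

theorem wp_countParents (hσ : HoldsGraph G σ) (hv : σ.reg rV = v) :
    wp countParents σ fun t τ => t ≤ m * 17 + 10 ∧ τ.reg rParents = (G.pa v).ncard := by
  have hpa : (G.pa v).ncard =
      ((Finset.range m).filter fun i => σ.arr aDir i v ≠ 0).card := by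
    rw [← Set.ncard_coe_finset, ← Set.ncard_image_of_injective _ Fin.val_injective]
    congr 1
    ext i
    simp only [Finset.coe_filter, Finset.mem_range, Set.mem_ofPred_eq, Set.mem_image]
    exact ⟨fun ⟨w, hw, hi⟩ => hi ▸ ⟨w.2, (hσ.dir w v).2 hw⟩,
      fun ⟨hi, h⟩ => ⟨⟨i, hi⟩, (hσ.dir ⟨i, hi⟩ v).1 h, rfl⟩⟩
  simp only [countParents, wp_block_cons, wp_block_nil, wp_assign, Expr.cost, Expr.eval]
  refine wp.mono (wp_forBelow_frame m 8 (fun k τ => τ.reg rParents =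
    ((Finset.range k).filter fun i => σ.arr aDir i v ≠ 0).card) hσ.size (by simp) ?_) ?_
  · rintro k - τ hτk hF hI
    have hτv : τ.reg rV = v := (hF.reg rV rfl).trans hv
    have hdir : τ.arr aDir = σ.arr aDir := hF.arr aDir rfl
    simp only [wp_when, wp_assign, Expr.cost, Expr.eval, hτk, hτv, hdir, Finset.range_add_one,
      Finset.filter_insert]
    refine ⟨fun h => ⟨by omega, ?_⟩, fun h => ⟨by omega, ?_⟩⟩
    · simp [h, hI]
    · simp [h, hI]
  · rintro t τ ⟨ht, hI⟩
    exact ⟨by omega, hI.trans hpa.symm⟩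

theorem isSelfOrSib_eval_ne_zero (hσ : HoldsGraph G σ) (hv : σ.reg rV = v) {x : ℕ}
    (hx : σ.reg x = w) : (isSelfOrSib x).eval σ ≠ 0 ↔ w ∈ insert v (G.sib v) := by
  rw [MixedGraph.mem_insert_sib, ← hσ.bi]
  simp only [Expr.eval, hv, hx, ne_eq, Nat.add_eq_zero_iff, not_and_or]
  exact or_congr_left (by simp [Fin.ext_iff])

/-- Add the children of the node in `rI` to the set in `aHtr` if this node belongs to it. -/
abbrev addChildren : Cmd :=
  .forBelow rJ rM (.when (mem aHtr rI) (.when (.get aDir (.reg rI) (.reg rJ))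
    (setMem aHtr rJ (.lit 1))))

theorem wp_addChildren (hσ : HoldsGraph G σ) (hw : σ.reg rI = w) :
    wp addChildren σ fun t τ => t ≤ m * 21 + 7 ∧
      nodeSet m aHtr τ = nodeSet m aHtr σ ∪ {j | w ∈ nodeSet m aHtr σ ∧ G.dir w j} := by
  refine wp_forBelow_nodeSet _ 12 hσ.size fun j τ hτj hF hlt hge => ?_
  have hτ := hσ.of_frame hF
  have hτw : τ.reg rI = w := (hF.reg rI rfl).trans hw
  have hmem : (mem aHtr rI).eval τ ≠ 0 ↔ w ∈ nodeSet m aHtr σ := by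
    have h : (mem aHtr rI).eval τ ≠ 0 ↔ w ∈ nodeSet m aHtr τ := by simp [Expr.eval, nodeSet, hτw]
    rcases lt_or_ge w j with hwj | hwj
    · exact (h.trans (hlt w hwj)).trans (or_iff_left_of_imp And.left)
    · exact h.trans (hge w hwj)
  have hdir : (Expr.get aDir (.reg rI) (.reg rJ)).eval τ ≠ 0 ↔ G.dir w j := by
    simpa only [Expr.eval, hτw, hτj] using hτ.dir w j
  have hj := hge j le_rfl
  simp only [wp_when]
  refine ⟨fun hb => ⟨fun hb' => ?_, fun hb' => ?_⟩, fun hb => ?_⟩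
  · refine (wp_setMem aHtr _ hτj).mono ?_
    rintro t ρ ⟨rfl, hρj, hρ⟩
    exact ⟨by simp [Expr.cost], iff_of_true (hρj.2 one_ne_zero)
      (Or.inr ⟨hmem.1 hb, hdir.1 hb'⟩), hρ⟩
  · have : ¬ G.dir w j := fun h => hdir.2 h hb'
    exact ⟨by simp [Expr.cost], by simp [hj, this], fun _ _ => trivial⟩
  · have : w ∉ nodeSet m aHtr σ := fun h => hmem.2 h hb
    exact ⟨by simp [Expr.cost], by simp [hj, this], fun _ _ => trivial⟩

theorem wp_forBelow_addChildren (hσ : HoldsGraph G σ) {R : Set (Fin m)}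
    (hR : ∀ i ∈ R, ∀ j, G.dir i j → j ∈ R) (hσR : nodeSet m aHtr σ ⊆ R) :
    wp (.forBelow rI rM addChildren) σ fun t τ => t ≤ m * (m * 21 + 16) + 7 ∧
      nodeSet m aHtr σ ⊆ nodeSet m aHtr τ ∧ nodeSet m aHtr τ ⊆ R ∧
      ∀ i ∈ nodeSet m aHtr σ, ∀ j, G.dir i j → j ∈ nodeSet m aHtr τ := by
  refine wp.mono (wp_forBelow_frame m (m * 21 + 7) (fun k τ =>
    nodeSet m aHtr σ ⊆ nodeSet m aHtr τ ∧ nodeSet m aHtr τ ⊆ R ∧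
    ∀ i ∈ nodeSet m aHtr σ, (i : ℕ) < k → ∀ j, G.dir i j → j ∈ nodeSet m aHtr τ)
    hσ.size ⟨subset_rfl, hσR, by simp⟩ ?_) ?_
  · rintro k hk τ hτk hF ⟨hsub, hτR, hdir⟩
    refine (wp_addChildren (w := ⟨k, hk⟩) (hσ.of_frame hF) hτk).mono ?_
    rintro t ρ ⟨ht, hρ⟩
    have hρ' : nodeSet m aHtr ⟨Function.update ρ.reg rI (k + 1), ρ.arr⟩ = _ := hρ
    simp only [hρ']
    refine ⟨ht, hsub.trans Set.subset_union_left,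
      Set.union_subset hτR fun j hj => hR _ (hτR hj.1) _ hj.2, fun i hi hik j hij => ?_⟩
    rcases Nat.lt_succ_iff_lt_or_eq.1 hik with hik | hik
    · exact Or.inl (hdir i hi hik j hij)
    · obtain rfl : i = ⟨k, hk⟩ := Fin.ext hik
      exact Or.inr ⟨hsub hi, hij⟩
  · rintro t τ ⟨ht, hsub, hτR, hdir⟩
    exact ⟨ht, hsub, hτR, fun i hi => hdir i hi i.2⟩

-- As long as the set in `aHtr` is not closed under children, every round increases it.
theorem wp_closeHtr (hσ : HoldsGraph G σ) (hH : nodeSet m aHtr σ = insert v (G.sib v)) :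
    wp (.forBelow rK rM (.forBelow rI rM addChildren)) σ fun t τ =>
      t ≤ m * (m * (m * 21 + 16) + 16) + 7 ∧ nodeSet m aHtr τ = G.reach v := by
  refine wp.mono (wp_forBelow_frame m (m * (m * 21 + 16) + 7) (fun k τ =>
    insert v (G.sib v) ⊆ nodeSet m aHtr τ ∧ nodeSet m aHtr τ ⊆ G.reach v ∧
    (G.reach v ⊆ nodeSet m aHtr τ ∨ k + 1 ≤ (nodeSet m aHtr τ).ncard))
    hσ.size ⟨hH.ge, hH.le.trans MixedGraph.insert_sib_subset_reach, Or.inr ?_⟩ ?_) ?_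
  · rw [zero_add]
    exact (Set.ncard_pos (Set.toFinite _)).2 ⟨v, hH.ge (Set.mem_insert v _)⟩
  · rintro k - τ - hF ⟨hv, hτR, hor⟩
    refine (wp_forBelow_addChildren (hσ.of_frame hF)
      (fun i hi j => MixedGraph.mem_reach_of_dir hi) hτR).mono ?_
    rintro t ρ ⟨ht, hsub, hρR, hdir⟩
    refine ⟨ht, hv.trans hsub, hρR, ?_⟩
    rcases hor with hor | hor
    · exact Or.inl (hor.trans hsub)
    · by_cases hρ : nodeSet m aHtr ρ ⊆ nodeSet m aHtr τ
      · exact Or.inl ((MixedGraph.reach_subset hv fun x hx y hxy =>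
          hρ (hdir x hx y hxy)).trans hsub)
      · exact Or.inr (hor.trans_lt
          (Set.ncard_lt_ncard (ssubset_of_subset_not_subset hsub hρ) (Set.toFinite _)))
  · rintro t τ ⟨ht, -, hτR, hor⟩
    refine ⟨ht, hτR.antisymm (hor.resolve_right fun h => ?_)⟩
    have := Set.ncard_le_card (nodeSet m aHtr τ)
    rw [Nat.card_fin] at this
    omega

theorem wp_computeHtr (hσ : HoldsGraph G σ) (hv : σ.reg rV = v) :
    wp computeHtr σ fun t τ => t ≤ 30 * (m + 1) ^ 3 ∧ nodeSet m aHtr τ = G.htr v := by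
  simp only [computeHtr, wp_block_cons, wp_block_nil]
  refine wp.mono (wp.frame <| wp_forBelow_nodeSet (a := aHtr) (insert v (G.sib v)) 12 hσ.size
    fun w τ hτw hF _ _ => ?_) ?_
  · have hb := isSelfOrSib_eval_ne_zero (hσ.of_frame hF) ((hF.reg rV rfl).trans hv) hτw
    rw [wp_cond]
    refine ⟨fun h => (wp_setMem aHtr _ hτw).mono ?_, fun h => (wp_setMem aHtr _ hτw).mono ?_⟩ <;>
      rintro t ρ ⟨rfl, hρw, hρ⟩ <;> refine ⟨by simp [Expr.cost], hρw.trans ?_, hρ⟩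
    · exact iff_of_true one_ne_zero (hb.1 h)
    · exact iff_of_false (fun h' => h' rfl) fun h' => hb.2 h' h
  rintro t₁ τ₁ ⟨⟨ht₁, hτ₁⟩, hF₁⟩
  refine wp.mono (wp.frame <| wp_closeHtr (hσ.of_frame hF₁) hτ₁) ?_
  rintro t₂ τ₂ ⟨⟨ht₂, hτ₂⟩, hF₂⟩
  refine wp.mono (wp_forBelow_nodeSet (a := aHtr) (G.htr v) 12 ((hσ.of_frame hF₁).of_frame hF₂).size
    fun w τ hτw hF _ hge => ?_) ?_
  · have hb := isSelfOrSib_eval_ne_zero (((hσ.of_frame hF₁).of_frame hF₂).of_frame hF)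
      ((hF.reg rV rfl).trans ((hF₂.reg rV rfl).trans ((hF₁.reg rV rfl).trans hv))) hτw
    have hw : w ∈ nodeSet m aHtr τ ↔ w ∈ G.reach v := hτ₂ ▸ hge w le_rfl
    rw [MixedGraph.htr_eq, wp_when]
    refine ⟨fun h => (wp_setMem aHtr _ hτw).mono ?_, fun h => ?_⟩
    · rintro t ρ ⟨rfl, hρw, hρ⟩
      exact ⟨by simp [Expr.cost],
        hρw.trans (iff_of_false (fun h' => h' rfl) fun h' => h'.2 (hb.1 h)), hρ⟩
    · exact ⟨by simp [Expr.cost], hw.trans (iff_self_and.2 fun _ => mt hb.2 (not_not.2 h)),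
        fun _ _ => Iff.rfl⟩
  · rintro t₃ τ₃ ⟨ht₃, hτ₃⟩
    refine ⟨?_, hτ₃⟩
    nlinarith [Nat.zero_le (m ^ 3), Nat.zero_le (m ^ 2)]

theorem wp_computeAllowed (hσ : HoldsGraph G σ) (hv : σ.reg rV = v)
    (hH : nodeSet m aHtr σ = G.htr v) :
    wp computeAllowed σ fun t τ => t ≤ m * 31 + 7 ∧
      nodeSet m aAllowed τ = G.allowed (nodeSet m aSolved σ) v := by
  refine wp_forBelow_nodeSet _ 22 hσ.size fun w τ hτw hF _ _ => ?_
  have hb := isSelfOrSib_eval_ne_zero (hσ.of_frame hF) ((hF.reg rV rfl).trans hv) hτw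
  have hc : (Expr.add (mem aSolved rI) (not (mem aHtr rI))).eval τ ≠ 0 ↔
      w ∈ nodeSet m aSolved σ ∪ (G.htr v)ᶜ := by
    rw [← hH, ← nodeSet_of_frame hF, ← nodeSet_of_frame hF]
    simp [Expr.eval, hτw, nodeSet, imp_iff_not_or]
  simp only [wp_cond]
  refine ⟨fun h => (wp_setMem aAllowed _ hτw).mono ?_,
    fun h => ⟨fun h' => (wp_setMem aAllowed _ hτw).mono ?_,
      fun h' => (wp_setMem aAllowed _ hτw).mono ?_⟩⟩ <;>
    rintro t ρ ⟨rfl, hρw, hρ⟩ <;> refine ⟨by simp [Expr.cost], hρw.trans ?_, hρ⟩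
  · exact iff_of_false (fun h₀ => h₀ rfl) fun hw => hw.2 (hb.1 h)
  · exact iff_of_true one_ne_zero ⟨hc.1 h', mt hb.2 (not_not.2 h)⟩
  · exact iff_of_false (fun h₀ => h₀ rfl) fun hw => hc.2 hw.1 h'

end HTCAlgorithm

/-! ## The construction of the flow network -/

namespace HTCAlgorithm

open RAM RAM.Cmd

variable {m N : ℕ} {G : MixedGraph (Fin m)} {v : Fin m} {A : Set (Fin m)} {E : Set (ℕ × ℕ)}
  {σ : Memory}

/-- The memory holds, on the rows and columns below `N` of the array for the network, the matrix of
the relation `E`. -/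
def HoldsEdges (N : ℕ) (E : Set (ℕ × ℕ)) (σ : Memory) : Prop :=
  ∀ i < N, ∀ j < N, σ.arr aNet i j = matrixOf (fun i j => (i, j) ∈ E) i j

theorem HoldsEdges.wp_put (h : HoldsEdges N E σ) (i j : Expr) :
    wp (.put aNet i j (.lit 1)) σ fun t τ =>
      t = 2 + i.cost + j.cost ∧ HoldsEdges N (insert (i.eval σ, j.eval σ) E) τ := by
  simp only [RAM.wp_put, Expr.cost, Expr.eval]
  refine ⟨by omega, fun k hk l hl => ?_⟩
  simp only [h k hk l hl, matrixOf, Set.mem_insert_iff, Prod.mk.injEq, true_and]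
  grind

theorem HoldsEdges.wp_when_put (h : HoldsEdges N E σ) {b i j : Expr} {P : Prop} {e : ℕ × ℕ}
    (hb : b.eval σ ≠ 0 ↔ P) (he : (i.eval σ, j.eval σ) = e) :
    wp (.when b (.put aNet i j (.lit 1))) σ fun t τ =>
      t ≤ b.cost + i.cost + j.cost + 3 ∧ HoldsEdges N (E ∪ {p | P ∧ p = e}) τ := by
  rw [wp_when]
  refine ⟨fun hP => (h.wp_put i j).mono ?_, fun hP => ⟨by omega, ?_⟩⟩
  · rintro t τ ⟨rfl, hτ⟩
    refine ⟨by omega, ?_⟩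
    simpa [he, hb.1 hP, Set.union_comm] using hτ
  · have : ¬ P := fun h' => hb.2 h' hP
    simpa [this] using h

theorem HoldsEdges.wp_forBelow (hE : HoldsEdges N E σ) {x : ℕ} {c : Cmd}
    (F : Fin m → Set (ℕ × ℕ)) (T : ℕ) (hm : σ.reg rM = m)
    (hstep : ∀ (w : Fin m) (τ : Memory) (E' : Set (ℕ × ℕ)), τ.reg x = w →
      Frame (.forBelow x rM c) σ τ → HoldsEdges N E' τ →
      wp c τ fun t ρ => t ≤ T ∧ HoldsEdges N (E' ∪ F w) ρ)
    (hx : rM ≠ x := by decide) (hcx : c.writesReg x = false := by rfl)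
    (hcm : c.writesReg rM = false := by rfl) :
    wp (.forBelow x rM c) σ fun t τ =>
      t ≤ m * (T + 9) + 7 ∧ HoldsEdges N (E ∪ ⋃ w, F w) τ := by
  refine wp.mono (wp_forBelow_frame m T (fun k τ =>
    HoldsEdges N (E ∪ {p | ∃ w : Fin m, (w : ℕ) < k ∧ p ∈ F w}) τ)
    hm ?_ ?_ hx hcx hcm) ?_
  · have hzero : E ∪ {p | ∃ w : Fin m, (w : ℕ) < 0 ∧ p ∈ F w} = E := by simp
    rw [hzero]
    exact hE
  · rintro k hk τ hτk hF hτ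
    refine (hstep ⟨k, hk⟩ τ _ hτk hF hτ).mono ?_
    rintro t ρ ⟨ht, hρ⟩
    have hsucc : {p | ∃ w : Fin m, (w : ℕ) < k + 1 ∧ p ∈ F w} =
        {p | ∃ w : Fin m, (w : ℕ) < k ∧ p ∈ F w} ∪ F ⟨k, hk⟩ := by
      ext p
      constructor
      · rintro ⟨w, hw, hp⟩
        rcases Nat.lt_succ_iff_lt_or_eq.1 hw with hw | rfl
        · exact Or.inl ⟨w, hw, hp⟩
        · exact Or.inr hp
      · rintro (⟨w, hw, hp⟩ | hp)
        · exact ⟨w, hw.trans (Nat.lt_succ_self k), hp⟩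
        · exact ⟨_, Nat.lt_succ_self k, hp⟩
    rw [hsucc, ← Set.union_assoc]
    exact ⟨ht, hρ⟩
  · rintro t τ ⟨ht, hτ⟩
    refine ⟨ht, ?_⟩
    convert hτ using 3
    ext p
    simp

/-- The edges of the network from the source to `L(a)`, and from `L(a)`. -/
def leftEdges (G : MixedGraph (Fin m)) (A : Set (Fin m)) (a : Fin m) : Set (ℕ × ℕ) :=
  {p | a ∈ A ∧ (p = (2 * m, ↑a) ∨ p = (↑a, m + a) ∨ ∃ w, G.bi a w ∧ p = (↑a, m + w))}

/-- The edges of the network from `R(w)` to right-hand nodes. -/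
def rightEdges (G : MixedGraph (Fin m)) (w : Fin m) : Set (ℕ × ℕ) :=
  ⋃ u, {p | G.dir w u ∧ p = (m + w, m + u)}

/-- The edges of the network from `R(w)` to the sink. -/
def sinkEdges (G : MixedGraph (Fin m)) (v w : Fin m) : Set (ℕ × ℕ) :=
  {p | G.dir w v ∧ p = (m + w, 2 * m + 1)}

theorem exists_row_flowEdge_iff {i j : ℕ} :
    (∃ x y : FlowNode A, i = row x ∧ j = row y ∧ (G.flowNetwork v A).edge x y) ↔
      (i, j) ∈ (⋃ a, leftEdges G A a) ∪ (⋃ w, rightEdges G w) ∪ ⋃ w, sinkEdges G v w := by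
  simp only [leftEdges, rightEdges, sinkEdges, Set.mem_union, Set.mem_iUnion, Set.mem_ofPred_eq,
    Prod.mk.injEq]
  constructor
  · rintro ⟨x, y, rfl, rfl, h⟩
    cases h with
    | source_left a => exact .inl (.inl ⟨a, a.2, .inl ⟨rfl, rfl⟩⟩)
    | left_right a => exact .inl (.inl ⟨a, a.2, .inr (.inl ⟨rfl, rfl⟩)⟩)
    | left_sibling a w h => exact .inl (.inl ⟨a, a.2, .inr (.inr ⟨w, h, rfl, rfl⟩)⟩)
    | right_right w u h => exact .inl (.inr ⟨w, u, h, rfl, rfl⟩)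
    | right_sink w h => exact .inr ⟨w, h, rfl, rfl⟩
  · rintro ((⟨a, ha, ⟨rfl, rfl⟩ | ⟨rfl, rfl⟩ | ⟨w, h, rfl, rfl⟩⟩ | ⟨w, u, h, rfl, rfl⟩) |
      ⟨w, h, rfl, rfl⟩)
    · exact ⟨.source, .left ⟨a, ha⟩, rfl, rfl, .source_left _⟩
    · exact ⟨.left ⟨a, ha⟩, .right a, rfl, rfl, .left_right ⟨a, ha⟩⟩
    · exact ⟨.left ⟨a, ha⟩, .right w, rfl, rfl, .left_sibling ⟨a, ha⟩ w h⟩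
    · exact ⟨.right w, .right u, rfl, rfl, .right_right w u h⟩
    · exact ⟨.right w, .sink, rfl, rfl, .right_sink w h⟩

theorem wp_clearRow {k : ℕ} (hN : σ.reg rSize = N) (hk : σ.reg rI = k) :
    wp (.forBelow rJ rSize (.put aNet (.reg rI) (.reg rJ) (.lit 0))) σ fun t τ =>
      t ≤ N * 13 + 7 ∧ (∀ j < N, τ.arr aNet k j = 0) ∧
        ∀ i ≠ k, τ.arr aNet i = σ.arr aNet i := by
  refine wp_forBelow_frame N 4 (fun l τ => (∀ j < l, τ.arr aNet k j = 0) ∧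
    ∀ i ≠ k, τ.arr aNet i = σ.arr aNet i) hN (by simp) ?_
  rintro l hl τ hτl hF ⟨hrow, hne⟩
  have hτk : τ.reg rI = k := (hF.reg rI rfl).trans hk
  simp only [wp_put, Expr.cost, Expr.eval, hτk, hτl]
  refine ⟨by omega, fun j hj => ?_, fun i hi => by simp [hi, hne i hi]⟩
  rcases Nat.lt_succ_iff_lt_or_eq.1 hj with hj | rfl
  · simp [hrow j hj]
  · simp

theorem wp_clearNetwork (hN : σ.reg rSize = N) :
    wp (.forBelow rI rSize (.forBelow rJ rSize (.put aNet (.reg rI) (.reg rJ) (.lit 0)))) σ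
      fun t τ => t ≤ N * (N * 13 + 16) + 7 ∧ HoldsEdges N ∅ τ := by
  refine wp.mono (wp_forBelow_frame N (N * 13 + 7) (fun k τ =>
    ∀ i < k, ∀ j < N, τ.arr aNet i j = 0) hN (by simp) ?_) ?_
  · rintro k hk τ hτk hF hτ
    refine (wp_clearRow ((hF.reg rSize rfl).trans hN) hτk).mono ?_
    rintro t ρ ⟨ht, hrow, hne⟩
    refine ⟨ht, fun i hi j hj => ?_⟩
    rcases Nat.lt_succ_iff_lt_or_eq.1 hi with hi | rfl
    · exact (congrFun (hne i hi.ne) j).trans (hτ i hi j hj)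
    · exact hrow j hj
  · rintro t τ ⟨ht, hτ⟩
    exact ⟨ht, fun i hi j hj => by simp [hτ i hi j hj, matrixOf]⟩

theorem HoldsEdges.wp_leftEdges (hE : HoldsEdges N E σ) (hσ : HoldsGraph G σ)
    (hs : σ.reg rSource = 2 * m) :
    wp (.forBelow rI rM (.when (mem aAllowed rI) (.block [
      .put aNet (.reg rSource) (.reg rI) (.lit 1),
      .put aNet (.reg rI) (.add (.reg rM) (.reg rI)) (.lit 1),
      .forBelow rJ rM (.when (.get aBi (.reg rI) (.reg rJ))
        (.put aNet (.reg rI) (.add (.reg rM) (.reg rJ)) (.lit 1)))]))) σ fun t τ =>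
      t ≤ m * (m * 19 + 31) + 7 ∧
        HoldsEdges N (E ∪ ⋃ a, leftEdges G (nodeSet m aAllowed σ) a) τ := by
  refine hE.wp_forBelow _ (m * 19 + 22) hσ.size fun a τ E' hτa hF hE' => ?_
  have hb : (mem aAllowed rI).eval τ ≠ 0 ↔ a ∈ nodeSet m aAllowed σ := by
    rw [← nodeSet_of_frame hF]
    simp [Expr.eval, nodeSet, hτa]
  simp only [wp_when, wp_block_cons, wp_block_nil]
  refine ⟨fun h => (wp.frame <| hE'.wp_put _ _).mono ?_, fun h => ?_⟩
  · rintro t₁ τ₁ ⟨⟨rfl, hE₁⟩, hF₁⟩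
    refine (wp.frame <| hE₁.wp_put _ _).mono ?_
    rintro t₂ τ₂ ⟨⟨rfl, hE₂⟩, hF₂⟩
    have hτ₂ : HoldsGraph G τ₂ := ((hσ.of_frame hF).of_frame hF₁).of_frame hF₂
    have ha₁ : τ₁.reg rI = a := (hF₁.reg rI rfl).trans hτa
    have ha₂ : τ₂.reg rI = a := (hF₂.reg rI rfl).trans ha₁
    refine (hE₂.wp_forBelow (fun w => {p | G.bi a w ∧ p = (↑a, m + w)}) 10 hτ₂.size
      fun w ρ E'' hρw hF' hE'' => ?_).mono ?_
    · have hρ := hτ₂.of_frame hF'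
      have hρa : ρ.reg rI = a := (hF'.reg rI rfl).trans ha₂
      exact hE''.wp_when_put (by simpa [Expr.eval, hρa, hρw] using hρ.bi a w)
        (by simp [Expr.eval, hρa, hρw, hρ.size])
    · rintro t₃ ρ ⟨ht₃, hρ⟩
      refine ⟨by simp only [Expr.cost]; omega, ?_⟩
      convert hρ using 1
      have hs₀ : τ.reg rSource = 2 * m := (hF.reg rSource rfl).trans hs
      ext p
      simp only [Expr.eval, leftEdges, hb.1 h, hτa, ha₁, hs₀, (hσ.of_frame hF).of_frame hF₁ |>.size,
        true_and, Set.mem_union, Set.mem_ofPred_eq, Set.mem_insert_iff, Set.mem_iUnion]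
      tauto
  · have : a ∉ nodeSet m aAllowed σ := fun h' => hb.2 h' h
    exact ⟨by simp only [Expr.cost]; omega, by simpa [leftEdges, this] using hE'⟩

theorem HoldsEdges.wp_rightEdges (hE : HoldsEdges N E σ) (hσ : HoldsGraph G σ) :
    wp (.forBelow rI rM (.forBelow rJ rM (.when (.get aDir (.reg rI) (.reg rJ))
      (.put aNet (.add (.reg rM) (.reg rI)) (.add (.reg rM) (.reg rJ)) (.lit 1))))) σ fun t τ =>
      t ≤ m * (m * 21 + 16) + 7 ∧ HoldsEdges N (E ∪ ⋃ w, rightEdges G w) τ := by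
  refine hE.wp_forBelow _ (m * 21 + 7) hσ.size fun w τ E' hτw hF hE' => ?_
  have hτ := hσ.of_frame hF
  refine hE'.wp_forBelow _ 12 hτ.size fun u ρ E'' hρu hF' hE'' => ?_
  have hρ := hτ.of_frame hF'
  have hρw : ρ.reg rI = w := (hF'.reg rI rfl).trans hτw
  exact hE''.wp_when_put (by simpa [Expr.eval, hρw, hρu] using hρ.dir w u)
    (by simp [Expr.eval, hρw, hρu, hρ.size])

theorem HoldsEdges.wp_sinkEdges (hE : HoldsEdges N E σ) (hσ : HoldsGraph G σ)
    (hv : σ.reg rV = v) (ht : σ.reg rSink = 2 * m + 1) :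
    wp (.forBelow rI rM (.when (.get aDir (.reg rI) (.reg rV))
      (.put aNet (.add (.reg rM) (.reg rI)) (.reg rSink) (.lit 1)))) σ fun t τ =>
      t ≤ m * 19 + 7 ∧ HoldsEdges N (E ∪ ⋃ w, sinkEdges G v w) τ := by
  refine hE.wp_forBelow _ 10 hσ.size fun w τ E' hτw hF hE' => ?_
  have hτ := hσ.of_frame hF
  have hτv : τ.reg rV = v := (hF.reg rV rfl).trans hv
  have hτt : τ.reg rSink = 2 * m + 1 := (hF.reg rSink rfl).trans ht
  exact hE'.wp_when_put (by simpa [Expr.eval, hτw, hτv] using hτ.dir w v)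
    (by simp [Expr.eval, hτw, hτt, hτ.size])

theorem wp_buildNetwork (hσ : HoldsGraph G σ) (hv : σ.reg rV = v) :
    wp buildNetwork σ fun t τ =>
      t ≤ 200 * (m + 1) ^ 2 ∧ HoldsNetwork G v (nodeSet m aAllowed σ) τ := by
  simp only [buildNetwork, wp_block_cons, wp_block_nil, wp_assign, Expr.cost, Expr.eval]
  refine wp.mono (wp.frame <| wp_clearNetwork (N := 2 * m + 2)
    (by simp [hσ.size, two_mul])) ?_
  rintro t₁ τ₁ ⟨⟨ht₁, hE₁⟩, hF₁⟩
  have hτ₁ : HoldsGraph G τ₁ :=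
    ⟨(hF₁.reg rM rfl).trans hσ.size, hF₁.arr aDir rfl ▸ hσ.dir, hF₁.arr aBi rfl ▸ hσ.bi⟩
  have hsource : τ₁.reg rSource = 2 * m :=
    (hF₁.reg rSource rfl).trans (by simp [hσ.size, two_mul])
  have hsink : τ₁.reg rSink = 2 * m + 1 := (hF₁.reg rSink rfl).trans (by simp [hσ.size, two_mul])
  have hsize : τ₁.reg rSize = 2 * m + 2 := (hF₁.reg rSize rfl).trans (by simp [hσ.size, two_mul])
  have hallowed : nodeSet m aAllowed τ₁ = nodeSet m aAllowed σ := by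
    simp only [nodeSet, hF₁.arr aAllowed rfl]
  refine wp.mono (wp.frame <| hE₁.wp_leftEdges hτ₁ hsource) ?_
  rintro t₂ τ₂ ⟨⟨ht₂, hE₂⟩, hF₂⟩
  refine wp.mono (wp.frame <| hE₂.wp_rightEdges (hτ₁.of_frame hF₂)) ?_
  rintro t₃ τ₃ ⟨⟨ht₃, hE₃⟩, hF₃⟩
  refine wp.mono (wp.frame <| hE₃.wp_sinkEdges (v := v) ((hτ₁.of_frame hF₂).of_frame hF₃)
    ((hF₃.reg rV rfl).trans ((hF₂.reg rV rfl).trans ((hF₁.reg rV rfl).trans hv)))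
    ((hF₃.reg rSink rfl).trans ((hF₂.reg rSink rfl).trans hsink))) ?_
  rintro t₄ τ₄ ⟨⟨ht₄, hE₄⟩, hF₄⟩
  have hreg : ∀ r ∈ [rSize, rSource, rSink], τ₄.reg r = τ₁.reg r := by
    intro r hr
    fin_cases hr <;> exact (hF₄.reg _ rfl).trans ((hF₃.reg _ rfl).trans (hF₂.reg _ rfl))
  refine ⟨by nlinarith, (hreg _ (by simp)).trans hsize, (hreg _ (by simp)).trans hsource,
    (hreg _ (by simp)).trans hsink, fun i hi j hj => ?_⟩
  rw [hE₄ i hi j hj, Set.empty_union, hallowed]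
  simp only [matrixOf]
  congr 1
  exact propext exists_row_flowEdge_iff.symm

end HTCAlgorithm

/-! ## Correctness and running time of the algorithm -/

theorem two_mul_reciprocalPairs_le {V : Type*} [Finite V] (E : V → V → Prop) :
    2 * reciprocalPairs E ≤ Set.ncard {e : V × V | E e.1 e.2} := by
  classical
  let : LinearOrder V := linearOrderOfSTO WellOrderingRel
  let P := {e : Sym2 V | ∃ v w, e = s(v, w) ∧ v ≠ w ∧ E v w ∧ E w v}
  let up (e : Sym2 V) : V × V := (e.inf, e.sup)
  have hup : Function.Injective up := fun e e' h =>
    Sym2.inf_eq_inf_and_sup_eq_sup.1 (Prod.ext_iff.1 h)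
  have hP : ∀ e ∈ P, e.inf < e.sup ∧ E e.inf e.sup ∧ E e.sup e.inf := by
    rintro _ ⟨v, w, rfl, hne, hvw, hwv⟩
    rcases lt_or_gt_of_ne hne with h | h <;> simp [h.le, h, hvw, hwv]
  have hdisj : Disjoint (up '' P) ((Prod.swap ∘ up) '' P) := by
    rw [Set.disjoint_left]
    rintro _ ⟨e, he, rfl⟩ ⟨e', he', h⟩
    obtain ⟨hsup, hinf⟩ := Prod.ext_iff.1 h
    have hlt : e'.inf < e'.sup := (hP e' he').1
    rw [show e'.sup = e.inf from hsup, show e'.inf = e.sup from hinf] at hlt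
    exact lt_asymm (hP e he).1 hlt
  calc 2 * reciprocalPairs E = (up '' P).ncard + ((Prod.swap ∘ up) '' P).ncard := by
        rw [Set.ncard_image_of_injective _ hup,
          Set.ncard_image_of_injective _ (Prod.swap_injective.comp hup), two_mul]
        rfl
    _ = (up '' P ∪ (Prod.swap ∘ up) '' P).ncard := (Set.ncard_union_eq hdisj).symm
    _ ≤ _ := by
        refine Set.ncard_le_ncard (Set.union_subset ?_ ?_) <;> rintro _ ⟨e, he, rfl⟩
        exacts [(hP e he).2.1, (hP e he).2.2]

namespace HTCAlgorithm

open RAM RAM.Cmd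

variable {m k c TP : ℕ} {B : Prop} {P : Cmd} {G : MixedGraph (Fin m)} {v : Fin m}
  {S S' : Set (Fin m)} {σ τ ρ : Memory}

/-- The last step of the treatment of the node in `rV`. -/
def markSolved : Cmd :=
  .when (.eq (.reg rFlow) (.reg rParents)) (.block [
    setMem aSolved rV (.lit 1),
    .assign rChanged (.lit 1)])

/-- The treatment of the node in `rV` in an iteration of the algorithm. -/
def processNode (maxFlow : Cmd) : Cmd :=
  .when (not (mem aSolved rV)) (.block [
    computeHtr,
    computeAllowed,
    buildNetwork,
    maxFlow,
    countParents,
    markSolved])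

/-- An iteration of the algorithm. -/
def iteration (maxFlow : Cmd) : Cmd :=
  .block [.assign rChanged (.lit 0), .forBelow rV rM (processNode maxFlow), checkAllSolved]

/-- The initialization of the algorithm. -/
def initSolved : Cmd :=
  .forBelow rV rM (.block [countParents, setMem aSolved rV (not (.reg rParents))])

theorem testHTC_eq (P : Cmd) : testHTC P = .block [initSolved, .seq (iteration P)
    (.loop (.eq (.add (.reg rAnswer) (not (.reg rChanged))) (.lit 0)) (iteration P))] := rfl

/-- The running time of `P` on the networks of `G` is at most `TP`. -/
def RunsWithin (P : Cmd) (G : MixedGraph (Fin m)) (TP : ℕ) : Prop :=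
  ∀ (v : Fin m) (A : Set (Fin m)), A ⊆ (insert v (G.sib v))ᶜ → ∀ σ : Memory,
    HoldsNetwork G v A σ → ∀ (t : ℕ) (τ : Memory), Exec P σ t τ → t ≤ TP

/-- The memories agree on the data that have to survive the test of the node in `rV`. -/
structure SameState (σ τ : Memory) : Prop where
  reg : ∀ x ∈ [rM, rV, rChanged], τ.reg x = σ.reg x
  arr : ∀ a ∈ [aDir, aBi, aSolved], τ.arr a = σ.arr a

theorem SameState.of_frame {c : Cmd} (hF : Frame c σ τ)
    (hr : ∀ x ∈ [rM, rV, rChanged], c.writesReg x = false := by decide)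
    (ha : ∀ a ∈ [aDir, aBi, aSolved], c.writesArr a = false := by decide) : SameState σ τ :=
  ⟨fun x hx => hF.reg x (hr x hx), fun a hx => hF.arr a (ha a hx)⟩

theorem SameState.trans (h : SameState σ τ) (h' : SameState τ ρ) : SameState σ ρ :=
  ⟨fun x hx => (h'.reg x hx).trans (h.reg x hx), fun a ha => (h'.arr a ha).trans (h.arr a ha)⟩

theorem SameState.holdsGraph (h : SameState σ τ) (hσ : HoldsGraph G σ) : HoldsGraph G τ :=
  ⟨(h.reg rM (by simp)).trans hσ.size, h.arr aDir (by simp) ▸ hσ.dir, h.arr aBi (by simp) ▸ hσ.bi⟩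

theorem SameState.nodeSet_eq (h : SameState σ τ) : nodeSet m aSolved τ = nodeSet m aSolved σ := by
  simp only [nodeSet, h.arr aSolved (by simp)]

theorem IsMaxFlowProcedure.wp {A : Set (Fin m)} (hP : IsMaxFlowProcedure P)
    (hT : B → RunsWithin P G TP) (hA : A ⊆ (insert v (G.sib v))ᶜ) (hσ : HoldsNetwork G v A σ) :
    RAM.wp P σ fun t τ => (B → t ≤ TP) ∧ (G.flowNetwork v A).IsMaxFlow (τ.reg rFlow : ℝ≥0) ∧
      SameState σ τ := by
  obtain ⟨t, τ, h, hmax, hreg, harr⟩ := hP m G v A hA σ hσ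
  exact ⟨t, τ, h, fun hB => hT hB v A hA σ hσ t τ h, hmax,
    fun x hx => hreg x (by revert x; decide) (by revert x; decide),
    fun a ha => harr a (by revert a; decide)⟩

theorem wp_initSolved (hσ : HoldsGraph G σ) :
    wp initSolved σ fun t τ => t ≤ m * (m * 17 + 29) + 7 ∧
      nodeSet m aSolved τ = {v | G.pa v = ∅} := by
  refine wp_forBelow_nodeSet _ (m * 17 + 20) hσ.size fun w τ hτw hF _ _ => ?_
  simp only [wp_block_cons, wp_block_nil]
  refine (wp.frame <| wp_countParents (hσ.of_frame hF) hτw).mono ?_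
  rintro t₁ τ₁ ⟨⟨ht₁, hp⟩, hF₁⟩
  refine (wp_setMem aSolved (not (.reg rParents)) ((hF₁.reg rV rfl).trans hτw)).mono ?_
  rintro t₂ τ₂ ⟨rfl, hw, hne⟩
  refine ⟨by simp only [Expr.cost]; omega, hw.trans ?_,
    fun i hi => (hne i hi).trans (by rw [nodeSet_of_frame hF₁])⟩
  simp [Expr.eval, hp, Set.ncard_eq_zero (Set.toFinite _)]

/-- The possible values `S'` of the set of solved nodes and `c` of `rChanged` in an iteration that
started with the solved nodes `S`, when the nodes below `k` have been treated. -/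
def Progress (G : MixedGraph (Fin m)) (S : Set (Fin m)) (k : ℕ) (S' : Set (Fin m)) (c : ℕ) : Prop :=
  (c = 0 ∧ S' = S ∧ ∀ v ∉ S, (v : ℕ) < k → ¬ G.CanSolve S v) ∨ (c = 1 ∧ S.ncard < S'.ncard)

theorem Progress.skip (h : Progress G S v S' c) (hv : v ∈ S' ∨ ¬ G.CanSolve S' v) :
    Progress G S (v + 1) S' c := by
  refine h.imp_left fun ⟨hc, hS, hlt⟩ => ⟨hc, hS, fun w hw hwv => ?_⟩
  rcases Nat.lt_succ_iff_lt_or_eq.1 hwv with hwv | hwv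
  · exact hlt w hw hwv
  · obtain rfl := Fin.ext hwv
    exact hS ▸ hv.resolve_left (hS ▸ hw)

theorem Progress.insert (h : Progress G S k S' c) (hv : v ∉ S') :
    Progress G S (k + 1) (insert v S') 1 := by
  refine .inr ⟨rfl, ?_⟩
  rw [Set.ncard_insert_of_notMem hv]
  rcases h with ⟨-, rfl, -⟩ | ⟨-, h⟩ <;> omega

/-- The memory holds the graph, and the nodes that are marked as solved can be solved one after the
other. -/
structure Sound (G : MixedGraph (Fin m)) (σ : Memory) : Prop where
  holdsGraph : HoldsGraph G σ
  solvable : G.Solvable (nodeSet m aSolved σ)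

theorem Sound.of_sameState (hσ : Sound G σ) (h : SameState σ τ) : Sound G τ :=
  ⟨h.holdsGraph hσ.holdsGraph, h.nodeSet_eq ▸ hσ.solvable⟩

theorem wp_markSolved (hv : σ.reg rV = v) (hσ : Sound G σ) (hvS : v ∉ nodeSet m aSolved σ)
    (h : σ.reg rFlow = σ.reg rParents ↔ G.CanSolve (nodeSet m aSolved σ) v)
    (hp : Progress G S v (nodeSet m aSolved σ) (σ.reg rChanged)) :
    wp markSolved σ fun t τ => t ≤ 20 ∧ Sound G τ ∧
      Progress G S (v + 1) (nodeSet m aSolved τ) (τ.reg rChanged) := by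
  have hb : (Expr.eq (.reg rFlow) (.reg rParents)).eval σ ≠ 0 ↔
      G.CanSolve (nodeSet m aSolved σ) v := by
    rw [← h]
    exact ite_ne_right_iff.trans (and_iff_left one_ne_zero)
  rw [markSolved, wp_when]
  refine ⟨fun hs => ?_, fun hs => ⟨by simp [Expr.cost], hσ, hp.skip (.inr fun h' => hb.2 h' hs)⟩⟩
  rw [wp_block_cons]
  refine (wp.frame <| wp_setMem aSolved (.lit 1) hv).mono ?_
  rintro t τ ⟨⟨rfl, hvτ, hne⟩, hF⟩
  simp only [wp_block_cons, wp_block_nil, wp_assign, Expr.cost, Expr.eval, Function.update_self]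
  have hset : nodeSet m aSolved τ = insert v (nodeSet m aSolved σ) := by
    ext i
    obtain rfl | hi := eq_or_ne i v
    · simpa [Expr.eval] using hvτ
    · simpa [hi] using hne i hi
  have hτ := hσ.holdsGraph.of_frame hF
  exact ⟨by omega, ⟨⟨hτ.size, hτ.dir, hτ.bi⟩, hset ▸ hσ.solvable.insert hvS (hb.1 hs)⟩,
    hset ▸ hp.insert hvS⟩

theorem wp_maxFlow_markSolved (hP : IsMaxFlowProcedure P) (hT : B → RunsWithin P G TP)
    (hv : σ.reg rV = v) (hσ : Sound G σ) (hvS : v ∉ nodeSet m aSolved σ)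
    (hN : HoldsNetwork G v (G.allowed (nodeSet m aSolved σ) v) σ)
    (hp : Progress G S v (nodeSet m aSolved σ) (σ.reg rChanged)) :
    wp (.block [P, countParents, markSolved]) σ fun t τ => (B → t ≤ TP + m * 17 + 32) ∧
      τ.reg rV = v ∧ Sound G τ ∧ Progress G S (v + 1) (nodeSet m aSolved τ) (τ.reg rChanged) := by
  simp only [wp_block_cons, wp_block_nil]
  refine (hP.wp hT (fun _ h => h.2) hN).mono ?_
  rintro t₁ τ₁ ⟨ht₁, hmax, h₁⟩
  have hv₁ : τ₁.reg rV = v := (h₁.reg rV (by simp)).trans hv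
  refine (wp.frame <| wp_countParents (h₁.holdsGraph hσ.holdsGraph) hv₁).mono ?_
  rintro t₂ τ₂ ⟨⟨ht₂, hpa⟩, hF₂⟩
  have h₂ : SameState σ τ₂ := h₁.trans (.of_frame hF₂)
  have hv₂ : τ₂.reg rV = v := (h₂.reg rV (by simp)).trans hv
  have hsolve : τ₂.reg rFlow = τ₂.reg rParents ↔ G.CanSolve (nodeSet m aSolved τ₂) v := by
    rw [hpa, hF₂.reg rFlow rfl, h₂.nodeSet_eq]
    exact eq_ncard_pa_iff (fun _ h => h.2) hmax
  rw [← h₂.nodeSet_eq] at hvS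
  rw [← h₂.nodeSet_eq, ← h₂.reg rChanged (by simp)] at hp
  refine (wp.frame <| wp_markSolved hv₂ (hσ.of_sameState h₂) hvS hsolve hp).mono ?_
  rintro t₃ τ₃ ⟨⟨ht₃, hsound, hprog⟩, hF₃⟩
  refine ⟨fun hB => ?_, (hF₃.reg rV rfl).trans hv₂, hsound, hprog⟩
  have := ht₁ hB
  omega

theorem wp_processNode (hP : IsMaxFlowProcedure P) (hT : B → RunsWithin P G TP)
    (hv : σ.reg rV = v) (hσ : Sound G σ)
    (hp : Progress G S v (nodeSet m aSolved σ) (σ.reg rChanged)) :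
    wp (processNode P) σ fun t τ => (B → t ≤ TP + 300 * (m + 1) ^ 3) ∧ τ.reg rV = v ∧ Sound G τ ∧
      Progress G S (v + 1) (nodeSet m aSolved τ) (τ.reg rChanged) := by
  have hb : (not (mem aSolved rV)).eval σ ≠ 0 ↔ v ∉ nodeSet m aSolved σ := by
    simp [Expr.eval, hv, nodeSet]
  have hpow₁ : m + 1 ≤ (m + 1) ^ 2 := Nat.le_self_pow two_ne_zero _
  have hpow₂ : (m + 1) ^ 2 ≤ (m + 1) ^ 3 := Nat.pow_le_pow_right m.succ_pos (by norm_num)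
  rw [processNode, wp_when]
  refine ⟨fun h => ?_, fun h => ⟨fun _ => ?_, hv, hσ, hp.skip (.inl (not_not.1 (mt hb.2 ?_)))⟩⟩
  · rw [wp_block_cons]
    refine (wp.frame <| wp_computeHtr hσ.holdsGraph hv).mono ?_
    rintro t₁ τ₁ ⟨⟨ht₁, hH⟩, hF₁⟩
    have h₁ : SameState σ τ₁ := .of_frame hF₁
    have hv₁ : τ₁.reg rV = v := (h₁.reg rV (by simp)).trans hv
    rw [wp_block_cons]
    refine (wp.frame <| wp_computeAllowed (h₁.holdsGraph hσ.holdsGraph) hv₁ hH).mono ?_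
    rintro t₂ τ₂ ⟨⟨ht₂, hA⟩, hF₂⟩
    have h₂ : SameState σ τ₂ := h₁.trans (.of_frame hF₂)
    have hv₂ : τ₂.reg rV = v := (h₂.reg rV (by simp)).trans hv
    rw [wp_block_cons]
    refine (wp.frame <| wp_buildNetwork (h₂.holdsGraph hσ.holdsGraph) hv₂).mono ?_
    rintro t₃ τ₃ ⟨⟨ht₃, hN⟩, hF₃⟩
    have h₃ : SameState σ τ₃ := h₂.trans (.of_frame hF₃)
    have hv₃ : τ₃.reg rV = v := (h₃.reg rV (by simp)).trans hv
    rw [hA, h₁.nodeSet_eq, ← h₃.nodeSet_eq] at hN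
    rw [← h₃.nodeSet_eq, ← h₃.reg rChanged (by simp)] at hp
    refine (wp_maxFlow_markSolved hP hT hv₃ (hσ.of_sameState h₃)
      (h₃.nodeSet_eq ▸ hb.1 h) hN hp).mono ?_
    refine fun t τ hτ => ⟨fun hB => ?_, hτ.2⟩
    have := hτ.1 hB
    simp only [Expr.cost]
    omega
  · simp only [Expr.cost]
    omega
  · exact not_not.2 h

/-- The register `rAnswer` tells whether all nodes are solved. -/
def HoldsAnswer (m : ℕ) (σ : Memory) : Prop :=
  (σ.reg rAnswer = 1 ∧ nodeSet m aSolved σ = Set.univ) ∨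
    (σ.reg rAnswer = 0 ∧ nodeSet m aSolved σ ≠ Set.univ)

theorem wp_checkAllSolved (hm : σ.reg rM = m) :
    wp checkAllSolved σ fun t τ => t ≤ m * 19 + 10 ∧ HoldsAnswer m τ := by
  simp only [checkAllSolved, wp_block_cons, wp_block_nil, wp_assign, Expr.cost, Expr.eval]
  refine wp.mono (wp.frame <| wp_forBelow_frame m 10 (fun k τ =>
    (τ.reg rAnswer = 1 ∧ ∀ i : Fin m, (i : ℕ) < k → i ∈ nodeSet m aSolved σ) ∨
    (τ.reg rAnswer = 0 ∧ nodeSet m aSolved σ ≠ Set.univ)) hm (.inl ⟨rfl, by simp⟩) ?_) ?_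
  · rintro k hk τ hτk hF hI
    have hb : (not (mem aSolved rI)).eval τ ≠ 0 ↔ ⟨k, hk⟩ ∉ nodeSet m aSolved σ := by
      simp [Expr.eval, hτk, nodeSet, hF.arr aSolved rfl]
    rw [wp_when, wp_assign]
    refine ⟨fun h => ⟨by simp [Expr.cost], .inr ⟨rfl, fun hS => hb.1 h (hS ▸ trivial)⟩⟩,
      fun h => ⟨by simp [Expr.cost], hI.imp_left fun ⟨hans, hlt⟩ => ⟨hans, fun i hi => ?_⟩⟩⟩
    rcases Nat.lt_succ_iff_lt_or_eq.1 hi with hi | rfl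
    · exact hlt i hi
    · exact not_not.1 (mt hb.2 (not_not.2 h))
  · rintro t τ ⟨⟨ht, hI⟩, hF⟩
    have hset : nodeSet m aSolved τ = nodeSet m aSolved σ := by
      simp only [nodeSet, hF.arr aSolved rfl]
    rw [← hset] at hI
    exact ⟨by omega, hI.imp_left fun ⟨hans, h⟩ => ⟨hans, Set.eq_univ_of_forall fun i => h i i.2⟩⟩

theorem wp_iteration (hP : IsMaxFlowProcedure P) (hT : B → RunsWithin P G TP) (hσ : Sound G σ) :
    wp (iteration P) σ fun t τ => (B → t ≤ m * (TP + 300 * (m + 1) ^ 3 + 28) + 20) ∧ Sound G τ ∧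
      HoldsAnswer m τ ∧
      Progress G (nodeSet m aSolved σ) m (nodeSet m aSolved τ) (τ.reg rChanged) := by
  simp only [iteration, wp_block_cons, wp_block_nil, wp_assign, Expr.cost, Expr.eval]
  refine wp.mono (wp_forBelow (B := B) m (TP + 300 * (m + 1) ^ 3) (fun k τ => Sound G τ ∧
    Progress G (nodeSet m aSolved σ) k (nodeSet m aSolved τ) (τ.reg rChanged)) (by decide)
    hσ.holdsGraph.size ?_ ?_) ?_
  · exact ⟨⟨⟨hσ.holdsGraph.size, hσ.holdsGraph.dir, hσ.holdsGraph.bi⟩, hσ.solvable⟩,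
      .inl ⟨rfl, rfl, by simp⟩⟩
  · rintro k hk τ hτk - ⟨hτ, hp⟩
    refine (wp_processNode (v := ⟨k, hk⟩) hP hT hτk hτ hp).mono ?_
    rintro t ρ ⟨ht, hρv, hρ, hp⟩
    have hG := hρ.holdsGraph
    exact ⟨ht, hρv, hG.size, ⟨⟨hG.size, hG.dir, hG.bi⟩, hρ.solvable⟩, hp⟩
  · rintro t τ ⟨ht, hτ, hp⟩
    refine (wp.frame <| wp_checkAllSolved hτ.holdsGraph.size).mono ?_
    rintro t' ρ ⟨⟨ht', hans⟩, hF⟩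
    have hρ : SameState τ ρ := .of_frame hF
    refine ⟨fun hB => ?_, hτ.of_sameState hρ, hans, ?_⟩
    · have := ht hB
      linarith
    · rwa [hρ.nodeSet_eq, hρ.reg rChanged (by simp)]

theorem holdsGraph_input (G : MixedGraph (Fin m)) : HoldsGraph G (input G) where
  size := rfl
  dir v w := by
    refine (matrixOf_ne_zero
      (R := fun i j => ∃ v w : Fin m, i = v ∧ j = w ∧ G.dir v w)).trans ?_
    simp [← Fin.ext_iff]
  bi v w := by
    refine (matrixOf_ne_zero
      (R := fun i j => ∃ v w : Fin m, i = v ∧ j = w ∧ G.bi v w)).trans ?_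
    simp [← Fin.ext_iff]

/-- The invariant of the main loop, after at least one iteration, with the variant `n`. -/
def LoopInvariant (G : MixedGraph (Fin m)) (n : ℕ) (σ : Memory) : Prop :=
  Sound G σ ∧ HoldsAnswer m σ ∧
    ((σ.reg rChanged = 0 ∧ ∀ v ∉ nodeSet m aSolved σ, ¬ G.CanSolve (nodeSet m aSolved σ) v) ∨
      (σ.reg rChanged = 1 ∧ m < n + (nodeSet m aSolved σ).ncard))

theorem wp_iteration_loopInvariant {n : ℕ} (hP : IsMaxFlowProcedure P)
    (hT : B → RunsWithin P G TP) (hσ : Sound G σ) (hn : m ≤ n + (nodeSet m aSolved σ).ncard) :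
    wp (iteration P) σ fun t τ => (B → t ≤ m * (TP + 300 * (m + 1) ^ 3 + 28) + 20) ∧
      LoopInvariant G n τ := by
  refine (wp_iteration hP hT hσ).mono ?_
  rintro t τ ⟨ht, hτ, hans, hp⟩
  refine ⟨ht, hτ, hans, hp.imp (fun ⟨hc, hS, h⟩ => ⟨hc, ?_⟩) fun ⟨hc, _⟩ => ⟨hc, by omega⟩⟩
  rw [hS]
  exact fun v hv => h v hv v.2

theorem LoopInvariant.rAnswer_iff {n : ℕ} (h : LoopInvariant G n σ)
    (hb : (Expr.eq (.add (.reg rAnswer) (not (.reg rChanged))) (.lit 0)).eval σ = 0) :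
    (σ.reg rAnswer = 1 ↔ G.HTCIdentifiable) ∧ (σ.reg rAnswer = 0 ↔ ¬ G.HTCIdentifiable) := by
  obtain ⟨hσ, ⟨hans, huniv⟩ | ⟨hans, hne⟩, hc⟩ := h
  · have : G.HTCIdentifiable := (huniv ▸ hσ.solvable).htcIdentifiable
    simp [hans, this]
  · have : ¬ G.HTCIdentifiable := fun hid => by
      rcases hc with ⟨-, hc⟩ | ⟨hc, -⟩
      · exact hne (hid.eq_univ hc)
      · simp [Expr.eval, hans, hc] at hb
    simp [hans, this]

theorem wp_testHTC (hP : IsMaxFlowProcedure P) (hT : B → RunsWithin P G TP) :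
    wp (testHTC P) (input G) fun t τ =>
      (B → t ≤ (m + 1) * (m * (TP + 300 * (m + 1) ^ 3 + 45) + 60)) ∧
      (τ.reg rAnswer = 1 ↔ G.HTCIdentifiable) ∧ (τ.reg rAnswer = 0 ↔ ¬ G.HTCIdentifiable) := by
  simp only [testHTC_eq, wp_block_cons, wp_block_nil, wp_seq]
  refine (wp.frame <| wp_initSolved (holdsGraph_input G)).mono ?_
  rintro t₁ τ₁ ⟨⟨ht₁, hS₁⟩, hF₁⟩
  have hτ₁ : Sound G τ₁ := ⟨(holdsGraph_input G).of_frame hF₁,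
    hS₁ ▸ MixedGraph.solvable_of_pa_eq_empty fun v hv => hv⟩
  refine (wp_iteration_loopInvariant (n := m) hP hT hτ₁ (Nat.le_add_right _ _)).mono ?_
  rintro t₂ τ₂ ⟨ht₂, hI⟩
  refine wp.mono (wp_loop (B := B) (LoopInvariant G)
    (m * (TP + 300 * (m + 1) ^ 3 + 28) + 20) ?_ m τ₂ hI) ?_
  · rintro n τ ⟨hτ, -, hc⟩ hb
    have hn : m < n + (nodeSet m aSolved τ).ncard := by
      rcases hc with ⟨hc, -⟩ | ⟨-, hn⟩
      · simp [Expr.eval, hc] at hb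
      · exact hn
    have hcard : (nodeSet m aSolved τ).ncard ≤ m := by
      simpa using Set.ncard_le_ncard (Set.subset_univ (nodeSet m aSolved τ))
    refine (wp_iteration_loopInvariant (n := n - 1) hP hT hτ (by omega)).mono ?_
    exact fun t ρ ⟨ht, hρ⟩ => ⟨ht, n - 1, by omega, hρ⟩
  · rintro t₃ τ₃ ⟨ht₃, ⟨n, -, hI⟩, hb⟩
    refine ⟨fun hB => ?_, hI.rAnswer_iff hb⟩
    have h₂ := ht₂ hB
    have h₃ := ht₃ hB
    simp only [Expr.cost] at h₃
    nlinarith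

theorem reciprocalPairs_flowNetwork_le (G : MixedGraph (Fin m)) (v : Fin m) (A : Set (Fin m)) :
    reciprocalPairs (G.flowNetwork v A).edge ≤ reciprocalPairs G.dir := by
  refine (Set.ncard_le_ncard ?_ (Set.toFinite _)).trans (Set.ncard_image_of_injective _
    (Sym2.map.injective (FlowNode.right_injective (A := A)))).le
  rintro _ ⟨x, y, rfl, hne, hxy, hyx⟩
  cases hxy with
  | right_right w u h =>
    cases hyx with
    | right_right _ _ h' => exact ⟨s(w, u), ⟨w, u, rfl, fun e => hne (e ▸ rfl), h, h'⟩, rfl⟩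
  | _ => cases hyx

theorem exists_testHTC_time_le (hP : IsMaxFlowProcedure P) (hcubic : RunsInCubicTime P) :
    ∃ C : ℕ, ∀ (m : ℕ) (G : MixedGraph (Fin m)), 0 < m →
      ∀ (t : ℕ) (τ : Memory), Exec (testHTC P) (input G) t τ →
        t ≤ C * (m ^ 2 * (m + reciprocalPairs G.dir) ^ 3) := by
  obtain ⟨K, hK⟩ := hcubic
  refine ⟨2 * (64 * K + 2505), fun m G hm t τ h => ?_⟩
  set r := reciprocalPairs G.dir
  have hT : True → RunsWithin P G (K * (2 * m + 2 + r) ^ 3) := by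
    intro _ v A hA σ hσ t τ h
    refine (hK m G v A hA σ hσ t τ h).trans ?_
    have hcard : Fintype.card (FlowNode A) ≤ 2 * m + 2 := by
      classical
      have := (card_flowNode A).trans_le
        (Nat.add_le_add_left (Nat.add_le_add_right (set_fintype_card_le_univ A) m) 2)
      simp only [Fintype.card_fin] at this
      omega
    gcongr
    exact reciprocalPairs_flowNetwork_le G v A
  obtain ⟨t', τ', h', hle, -⟩ := wp_testHTC hP hT
  rw [(h'.deterministic h).1]
  have h₁ : (2 * m + 2 + r) ^ 3 ≤ 64 * (m + r) ^ 3 := by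
    calc (2 * m + 2 + r) ^ 3 ≤ (4 * (m + r)) ^ 3 := by gcongr; omega
      _ = 64 * (m + r) ^ 3 := by ring
  have h₂ : (m + 1) ^ 3 ≤ 8 * (m + r) ^ 3 := by
    calc (m + 1) ^ 3 ≤ (2 * (m + r)) ^ 3 := by gcongr; omega
      _ = 8 * (m + r) ^ 3 := by ring
  have h₃ : 1 ≤ (m + r) ^ 3 := Nat.one_le_pow _ _ (by omega)
  calc t' ≤ (m + 1) * (m * (K * (2 * m + 2 + r) ^ 3 + 300 * (m + 1) ^ 3 + 45) + 60) := hle trivial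
    _ ≤ 2 * m * (m * (K * (2 * m + 2 + r) ^ 3 + 300 * (m + 1) ^ 3 + 45) + 60 * m) := by
        gcongr <;> omega
    _ = 2 * m ^ 2 * (K * (2 * m + 2 + r) ^ 3 + 300 * (m + 1) ^ 3 + 105 * 1) := by ring
    _ ≤ 2 * m ^ 2 * (K * (64 * (m + r) ^ 3) + 300 * (8 * (m + r) ^ 3) + 105 * (m + r) ^ 3) := by
        gcongr
    _ = 2 * (64 * K + 2505) * (m ^ 2 * (m + r) ^ 3) := by ring

end HTCAlgorithm

theorem theorem7 :
    -- the algorithm halts and returns "yes" if and only if the graph is HTC-identifiable,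
    -- whatever correct maximum flow procedure it calls
    (∀ P : RAM.Cmd, HTCAlgorithm.IsMaxFlowProcedure P →
      ∀ (m : ℕ) (G : MixedGraph (Fin m)), ∃ (t : ℕ) (τ : RAM.Memory),
        RAM.Exec (HTCAlgorithm.testHTC P) (HTCAlgorithm.input G) t τ ∧
        (τ.reg HTCAlgorithm.rAnswer = 1 ↔ G.HTCIdentifiable) ∧
        (τ.reg HTCAlgorithm.rAnswer = 0 ↔ ¬ G.HTCIdentifiable)) ∧
    -- with a cubic-time maximum flow procedure, its running time is `O(|V|^2 (|V| + r)^3)`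
    (∀ P : RAM.Cmd, HTCAlgorithm.IsMaxFlowProcedure P → HTCAlgorithm.RunsInCubicTime P →
      ∃ C : ℕ, ∀ (m : ℕ) (G : MixedGraph (Fin m)), 0 < m →
        ∀ (t : ℕ) (τ : RAM.Memory),
          RAM.Exec (HTCAlgorithm.testHTC P) (HTCAlgorithm.input G) t τ →
          t ≤ C * (m ^ 2 * (m + reciprocalPairs G.dir) ^ 3)) ∧
    -- and such a maximum flow procedure exists
    (∃ P : RAM.Cmd, HTCAlgorithm.IsMaxFlowProcedure P ∧ HTCAlgorithm.RunsInCubicTime P) ∧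
    -- the number of reciprocal edge pairs is at most half the number of directed edges
    (∀ (m : ℕ) (G : MixedGraph (Fin m)),
      2 * reciprocalPairs G.dir ≤ Set.ncard {e : Fin m × Fin m | G.dir e.1 e.2}) := by
  refine ⟨fun P hP m G => ?_, fun P => HTCAlgorithm.exists_testHTC_time_le,
    ⟨_, HTCAlgorithm.isMaxFlowProcedure_unitMaxFlow, HTCAlgorithm.runsInCubicTime_unitMaxFlow⟩,
    fun m G => two_mul_reciprocalPairs_le G.dir⟩
  obtain ⟨t, τ, h, -, hans⟩ :=
    HTCAlgorithm.wp_testHTC (G := G) (B := False) (TP := 0) hP False.elim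
  exact ⟨t, τ, h, hans⟩
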